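/- **Setting.** Let $d>2$ and $\delta\ge 1$ be integers with $2\delta-1\le d$, put $D=(2\delta-1)d$ and $a=\max\{4,\frac{\delta-1}{2}\}$; indices of vectors in $\mathbb C^d$ are read modulo $d$. Define the masks $\mathbf m_1,\dots,\mathbf m_{2\delta-1}\in\mathbb C^d$ by $$(\mathbf m_l)_i=\frac{e^{-i/a}}{\sqrt[4]{2\delta-1}}\,e^{2\pi \mathrm i (i-1)(l-1)/(2\delta-1)}\ (i\le\delta),\qquad (\mathbf m_l)_i=0\ (i>\delta),$$ and let $M\in\mathbb C^{D\times d}$ consist of the circulant blocks $M_1,\dots,M_{2\delta-1}$ with $(M_l)_{i,j}=\overline{(\mathbf m_l)_{((j-i)\bmod d)+1}}$. Let $P$ be the permutation that lists the entries $(l,i)$ of a vector in $\mathbb R^D$ grouped by $i$ instead of by $l$, and let $\mathbf y\in\mathbb C^D$ list the products $\overline{x_j}\,x_{j+o}$, $|o|<\delta$, in the order $(j,o)=(1,0),\dots,(1,\delta-1),(2,1-\delta),\dots,(2,\delta-1),(3,1-\delta),\dots,(d,\delta-1),(1,1-\delta),\dots,(1,-1)$. Let $M'\in\mathbb C^{D\times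 D}$ be the block circulant matrix with $P|M\mathbf x|^2=M'\mathbf y$ for all $\mathbf x$, whose block in block row $r$ and block column $p$ is $M'_{((p-r)\bmod d)+1}$, where for $l\le\delta$ and $1\le i,j\le 2\delta-1$: $(M'_l)_{i,j}=(\mathbf m_i)_l\overline{(\mathbf m_i)_{j+l-1}}$ if $l+j\le\delta+1$; $(M'_l)_{i,j}=(\mathbf m_i)_{l+1}\overline{(\mathbf m_i)_{l+j+1-2\delta}}$ if $l+j\ge2\delta$ and $l<\delta$; and $(M'_l)_{i,j}=0$ otherwise; $M'_l=0$ for $l>\delta$. For $|(i-j)\bmod d|<\delta$ (residues taken in $(-d/2,d/2]$) let $k(i,j)$ be the position of $x_i\overline{x_j}$ in $\mathbf y$. **Algorithm.** Input: $\mathbf b\in\mathbb R^D$. 1. Compute $\tilde{\mathbf y}=(M')^{-1}P\mathbf b$. 2. Choose $s$ maximizing $|\tilde y_{k(s,s)}|$, set all phases $\tilde\phi$ to $0$, mark $s$ as set, and let $j=s$. While some entry among $j+1,\dots,j+\delta-1$ is not marked: for every unmarked $q$ with $|(q-j)\bmod d|<\delta$ put $\tilde\phi_q=\tilde\phi_j+\frac12\big(\arg\tilde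 y_{k(q,j)}-\arg^{-}\tilde y_{k(j,q)}\big)$ and mark $q$; then replace $j$ by an entry $j+i$, $0<i<\delta$, maximizing $|\tilde y_{k(j+i,j+i)}|$. Here $\arg$ takes values in $(-\pi,\pi]$ and $\arg^{-}z:=-\arg\bar z$ in $[-\pi,\pi)$, with $\arg 0=0$. 3. Return $\tilde x_j=\sqrt{|\tilde y_{k(j,j)}|}\,e^{\mathrm i\tilde\phi_j}$, $j=1,\dots,d$. Ties in the maximizations may be broken arbitrarily. **Flatness.** For $1\le m\le d$, $\mathbf x\in\mathbb C^d$ is $m$-flat if its (cyclically ordered) entries can be partitioned into at least $\lfloor d/m\rfloor$ blocks of $m$ or $m+1$ consecutive entries, each containing an entry of magnitude at least $\frac{\|\mathbf x\|_2}{2\sqrt d}$. **Theorem.** There are universal constants $C,C',K>0$ such that for all $d,\delta$ as above the matrix $M'$ is invertible and the following hold. (i) Let $\mathbf x\in\mathbb C^d$ be $\lfloor\frac{\delta-3}{2}\rfloor$-flat (in particular $\lfloor\frac{\delta-3}{2}\rfloor\ge1$) and let $\mathbf n\in\mathbb R^D$ satisfy $\|\mathbf x\|_2^2\ge C(\delta-1)d^2\|\mathbf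 n\|_2$. Then every output $\tilde{\mathbf x}$ of the algorithm on $\mathbf b=|M\mathbf x|^2+\mathbf n$ satisfies $$\min_{\theta\in[0,2\pi]}\|\mathbf x-e^{\mathrm i\theta}\tilde{\mathbf x}\|_2^2\le C'd^2(\delta-1)\|\mathbf n\|_2 .$$ (ii) The algorithm runs in $O(\delta\, d\log d)$ operations: there is a single program for a unit-cost random access machine with exact complex arithmetic (basic operations: index arithmetic, memory access, comparisons, $+,-,\times,/$, conjugation, $|\cdot|$, $\arg$, $\sqrt{\cdot}$, $\exp$, and the constants $\pi$, $\mathrm i$) which, for all such $d,\delta$ and every $\mathbf b\in\mathbb R^D$, returns an output of the algorithm on $\mathbf b$ after at most $K\,\delta\, d\log d$ operations. -/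

import Mathlib

noncomputable section

open scoped ComplexConjugate
open Matrix

namespace BlockPR

instance instNeZeroBlockSize (δ : ℕ) [NeZero δ] : NeZero (2 * δ - 1) :=
  ⟨by have := NeZero.pos δ; omega⟩

/-! ### The measurements

Vectors of `ℂ^d` are indexed by `ZMod d`, so that indices are read modulo `d`; the residue with
representative `r < d` is the entry number `r + 1` of the vector. -/

/-- The damping parameter `a = max {4, (δ - 1) / 2}`. -/
def damping (δ : ℕ) : ℝ := max 4 (((δ : ℝ) - 1) / 2)

/-- The entry `(m_l)_i` of the damped and windowed Fourier mask `m_l`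
(both `l` and `i` are counted from `1`). -/
def mask (δ l i : ℕ) : ℂ :=
  if i ≤ δ then
    ((Real.exp (-(i : ℝ) / damping δ) / (2 * (δ : ℝ) - 1) ^ (1 / 4 : ℝ) : ℝ) : ℂ) *
      Complex.exp (2 * Real.pi * Complex.I * ((i : ℂ) - 1) * ((l : ℂ) - 1) / (2 * (δ : ℂ) - 1))
  else 0

/-- The `(2δ-1)d × d` measurement matrix `M`. Its row `(l, r)` is the `r`-th row of the `l`-th
circulant block, i.e. the correlation with the mask number `l + 1` shifted by `r`:
`(M x)_(l, r) = ∑_k conj (m_(l+1))_k x_(r + k - 1)`. -/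
def measurementMatrix (d δ : ℕ) : Matrix (Fin (2 * δ - 1) × ZMod d) (ZMod d) ℂ :=
  Matrix.of fun q j => conj (mask δ (q.1 + 1) ((j - q.2).val + 1))

/-- The noisy squared magnitude measurements `b = |M x|² + n`. -/
def measurements {d δ : ℕ} [NeZero d] (x : EuclideanSpace ℂ (ZMod d))
    (n : EuclideanSpace ℝ (Fin (2 * δ - 1) × ZMod d)) : Fin (2 * δ - 1) × ZMod d → ℝ :=
  fun q => ‖(measurementMatrix d δ *ᵥ fun j => x j) q‖ ^ 2 + n q

/-- The entry `(M'_l)_{i,j}` of the `l`-th block of the lifted system (`l`, `i`, `j` are counted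
from `1`); it vanishes for `l > δ`. -/
def liftedBlock (δ l i j : ℕ) : ℂ :=
  if l + j ≤ δ + 1 then mask δ i l * conj (mask δ i (j + l - 1))
  else if 2 * δ ≤ l + j ∧ l < δ then mask δ i (l + 1) * conj (mask δ i (l + j + 1 - 2 * δ))
  else 0

/-- The block circulant matrix `M'` of the lifted linear system: the block in the block row `r` and
the block column `p` is `M'_((p - r) mod d + 1)`. -/
def liftedMatrix (d δ : ℕ) :
    Matrix (ZMod d × Fin (2 * δ - 1)) (ZMod d × Fin (2 * δ - 1)) ℂ :=
  Matrix.of fun q c => liftedBlock δ ((c.1 - q.1).val + 1) (q.2 + 1) (c.2 + 1)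

/-! ### Flat vectors -/

/-- `x` is `m`-flat: the (cyclically ordered) entries of `x` split into at least `⌊d/m⌋` blocks of
`m` or `m + 1` consecutive entries, each of which contains an entry of magnitude at least
`‖x‖₂ / (2 √d)`. Block number `t` consists of the positions `c t, …, c (t + 1) - 1` modulo `d`. -/
def IsFlat {d : ℕ} [NeZero d] (m : ℕ) (x : EuclideanSpace ℂ (ZMod d)) : Prop :=
  1 ≤ m ∧ m ≤ d ∧ ∃ (N : ℕ) (c : ℕ → ℕ), d / m ≤ N ∧ c N = c 0 + d ∧
    (∀ t < N, c (t + 1) = c t + m ∨ c (t + 1) = c t + (m + 1)) ∧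
    ∀ t < N, ∃ p, c t ≤ p ∧ p < c (t + 1) ∧ ‖x‖ / (2 * √(d : ℝ)) ≤ ‖x (p : ZMod d)‖

/-! ### The recovery algorithm -/

/-- `ỹ = (M')⁻¹ P b`, where the permutation `P` groups the measurements by shift. -/
def liftedEstimate {d δ : ℕ} [NeZero d] (b : Fin (2 * δ - 1) × ZMod d → ℝ) :
    ZMod d × Fin (2 * δ - 1) → ℂ :=
  (liftedMatrix d δ)⁻¹ *ᵥ fun q => ((b (q.2, q.1) : ℝ) : ℂ)

/-- The position `k(i, j)` of the product `x_i conj(x_j)`, for `|(i - j) mod d| < δ`. With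
`o = (i - j) mod d` in `(-d/2, d/2]`, the products `conj(x_j) x_(j+o)` are ordered by
`(j, o) = (1, 0), …, (1, δ-1), (2, 1-δ), …, (2, -1), (2, 0), …` and are cut into blocks of length
`2δ-1`. -/
def productIndex {d δ : ℕ} [NeZero δ] (i j : ZMod d) : ZMod d × Fin (2 * δ - 1) :=
  (if 0 ≤ (i - j).valMinAbs then j else j - 1,
    Fin.ofNat (2 * δ - 1) ((i - j).valMinAbs % ((2 * δ - 1 : ℕ) : ℤ)).toNat)

/-- The argument of a complex number in the branch `[-π, π)`. -/
def argLower (z : ℂ) : ℝ := -Complex.arg (conj z)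

/-- The variables of the greedy angular synchronization. -/
structure SyncState (d : ℕ) where
  /-- the current reference entry -/
  ref : ZMod d
  /-- the phase estimates -/
  phase : ZMod d → ℝ
  /-- `1` as long as the phase of the entry has not been set, then `0` -/
  flag : ZMod d → ℕ

variable {d δ : ℕ} [NeZero d] [NeZero δ]

/-- The initial state, with the phase of the entry `a` set to zero. -/
def SyncState.init (a : ZMod d) : SyncState d where
  ref := a
  phase := fun _ => 0
  flag := fun q => if q = a then 0 else 1

/-- The loop condition: some entry in `(j, j + δ)` has no phase yet. -/
def SyncState.Unfinished (δ : ℕ) (s : SyncState d) : Prop :=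
  0 < ∑ i ∈ Finset.Ioo 0 δ, s.flag (s.ref + (i : ZMod d))

open Classical in
/-- One pass of the loop body: every entry `q` with `|(q - j) mod d| < δ` whose phase is not yet set
gets its phase from the reference entry `j`; then `j` is replaced by `j + i`. (For `2δ - 1 ≤ d` the
entries of the window are distinct, and the update of one does not affect that of another.) -/
def SyncState.advance (y : ZMod d × Fin (2 * δ - 1) → ℂ) (s : SyncState d) (i : ℕ) :
    SyncState d where
  ref := s.ref + (i : ZMod d)
  phase := fun q =>
    if |(q - s.ref).valMinAbs| < (δ : ℤ) ∧ s.flag q = 1 then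
      s.phase s.ref +
        (1 / 2) * (Complex.arg (y (productIndex q s.ref)) - argLower (y (productIndex s.ref q)))
    else s.phase q
  flag := fun q => if |(q - s.ref).valMinAbs| < (δ : ℤ) then 0 else s.flag q

/-- `SyncLoop y s s'`: started in the state `s`, the while-loop of the greedy angular
synchronization can terminate in the state `s'`. The next reference entry is one of largest
estimated magnitude among `j + 1, …, j + δ - 1`; ties may be broken in any way. -/
inductive SyncLoop (y : ZMod d × Fin (2 * δ - 1) → ℂ) : SyncState d → SyncState d → Prop
  | done (s : SyncState d) : ¬ s.Unfinished δ → SyncLoop y s s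
  | step (s s' : SyncState d) (i : ℕ) : s.Unfinished δ → 0 < i → i < δ →
      (∀ i' : ℕ, 0 < i' → i' < δ →
        ‖y (productIndex (s.ref + (i' : ZMod d)) (s.ref + (i' : ZMod d)))‖ ≤
          ‖y (productIndex (s.ref + (i : ZMod d)) (s.ref + (i : ZMod d)))‖) →
      SyncLoop y (s.advance y i) s' → SyncLoop y s s'

/-- `x'` is an output of the recovery algorithm on the measurements `b`: linear inversion of the
lifted system, then greedy angular synchronization from an entry `a` of largest estimated
magnitude, then assembly of the estimated magnitudes and phases. -/
def IsOutput (b : Fin (2 * δ - 1) × ZMod d → ℝ) (x' : EuclideanSpace ℂ (ZMod d)) : Prop :=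
  let y : ZMod d × Fin (2 * δ - 1) → ℂ := liftedEstimate b
  ∃ (a : ZMod d) (s : SyncState d),
    (∀ j, ‖y (productIndex j j)‖ ≤ ‖y (productIndex a a)‖) ∧
    SyncLoop y (SyncState.init a) s ∧
    ∀ j, x' j = (√‖y (productIndex j j)‖ : ℝ) * Complex.exp (Complex.I * (s.phase j : ℂ))

/-! ### Programs and operation counts

A unit-cost random access machine with exact numbers: registers for natural numbers, arrays of
complex numbers, structured programs with bounded loops. Every arithmetic operation, memory access,
comparison, assignment and loop iteration is counted, on indices as well as on numbers. -/

/-- Expressions with natural number values; `var v` reads the register `v`. -/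
inductive IndexExpr
  | lit (n : ℕ)
  | var (v : ℕ)
  | add (e f : IndexExpr)
  | sub (e f : IndexExpr)
  | mul (e f : IndexExpr)
  | div (e f : IndexExpr)
  | mod (e f : IndexExpr)

/-- Expressions with complex values; `read r e` is the cell `e` of the array `r`
and `cconj` is complex conjugation. -/
inductive NumExpr
  | ofIndex (e : IndexExpr)
  | pi
  | I
  | read (r : ℕ) (e : IndexExpr)
  | add (u v : NumExpr)
  | sub (u v : NumExpr)
  | mul (u v : NumExpr)
  | div (u v : NumExpr)
  | cconj (u : NumExpr)
  | abs (u : NumExpr)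
  | arg (u : NumExpr)
  | sqrt (u : NumExpr)
  | exp (u : NumExpr)

/-- Comparisons of indices and of (real parts of) numbers. -/
inductive Test
  | indexLe (e f : IndexExpr)
  | numLe (u v : NumExpr)

/-- Programs; `loop v e p` executes `p` with the register `v` set to `0, 1, …, N - 1` in turn, where
`N` is the value of `e` on entry. -/
inductive Program
  | skip
  | setIndex (v : ℕ) (e : IndexExpr)
  | write (r : ℕ) (e : IndexExpr) (u : NumExpr)
  | seq (p q : Program)
  | ite (t : Test) (p q : Program)
  | loop (v : ℕ) (e : IndexExpr) (p : Program)

/-- The contents of the registers and of the arrays. -/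
structure Store where
  reg : ℕ → ℕ
  mem : ℕ → ℕ → ℂ

/-- Assignment to a register. -/
def Store.setReg (σ : Store) (v n : ℕ) : Store :=
  { σ with reg := Function.update σ.reg v n }

/-- Assignment to a cell of an array. -/
def Store.setMem (σ : Store) (r t : ℕ) (z : ℂ) : Store :=
  { σ with mem := Function.update σ.mem r (Function.update (σ.mem r) t z) }

/-- The value of an index expression. -/
def IndexExpr.eval (σ : Store) : IndexExpr → ℕ
  | lit n => n
  | var v => σ.reg v
  | add e f => e.eval σ + f.eval σ
  | sub e f => e.eval σ - f.eval σ
  | mul e f => e.eval σ * f.eval σ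
  | div e f => e.eval σ / f.eval σ
  | mod e f => e.eval σ % f.eval σ

/-- The number of operations in an index expression. -/
def IndexExpr.cost : IndexExpr → ℕ
  | lit _ => 1
  | var _ => 1
  | add e f => e.cost + f.cost + 1
  | sub e f => e.cost + f.cost + 1
  | mul e f => e.cost + f.cost + 1
  | div e f => e.cost + f.cost + 1
  | mod e f => e.cost + f.cost + 1

/-- The value of a number expression; `sqrt` is the square root of the real part. -/
def NumExpr.eval (σ : Store) : NumExpr → ℂ
  | ofIndex e => (e.eval σ : ℂ)
  | pi => (Real.pi : ℂ)
  | I => Complex.I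
  | read r e => σ.mem r (e.eval σ)
  | add u v => u.eval σ + v.eval σ
  | sub u v => u.eval σ - v.eval σ
  | mul u v => u.eval σ * v.eval σ
  | div u v => u.eval σ / v.eval σ
  | cconj u => conj (u.eval σ)
  | abs u => (‖u.eval σ‖ : ℂ)
  | arg u => (Complex.arg (u.eval σ) : ℂ)
  | sqrt u => ((√(u.eval σ).re : ℝ) : ℂ)
  | exp u => Complex.exp (u.eval σ)

/-- The number of operations in a number expression. -/
def NumExpr.cost : NumExpr → ℕ
  | ofIndex e => e.cost + 1
  | pi => 1
  | I => 1
  | read _ e => e.cost + 1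
  | add u v => u.cost + v.cost + 1
  | sub u v => u.cost + v.cost + 1
  | mul u v => u.cost + v.cost + 1
  | div u v => u.cost + v.cost + 1
  | cconj u => u.cost + 1
  | abs u => u.cost + 1
  | arg u => u.cost + 1
  | sqrt u => u.cost + 1
  | exp u => u.cost + 1

/-- The truth of a test. -/
def Test.Holds (σ : Store) : Test → Prop
  | indexLe e f => e.eval σ ≤ f.eval σ
  | numLe u v => (u.eval σ).re ≤ (v.eval σ).re

/-- The number of operations in a test. -/
def Test.cost : Test → ℕ
  | indexLe e f => e.cost + f.cost + 1
  | numLe u v => u.cost + v.cost + 1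

/-- Runs `body 0`, …, `body (N - 1)` one after the other and counts one operation per iteration in
addition to those of the bodies. -/
def iterate (body : ℕ → Store → Store × ℕ) (σ : Store) : ℕ → Store × ℕ
  | 0 => (σ, 0)
  | N + 1 =>
    let before := iterate body σ N
    let last := body N before.1
    (last.1, before.2 + last.2 + 1)

open Classical in
/-- The final store of a program, and the number of operations it has performed. -/
def Program.run : Program → Store → Store × ℕ
  | skip, σ => (σ, 1)
  | setIndex v e, σ => (σ.setReg v (e.eval σ), e.cost + 1)
  | write r e u, σ => (σ.setMem r (e.eval σ) (u.eval σ), e.cost + u.cost + 1)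
  | seq p q, σ => ((q.run (p.run σ).1).1, (p.run σ).2 + (q.run (p.run σ).1).2)
  | ite t p q, σ =>
    if t.Holds σ then ((p.run σ).1, t.cost + (p.run σ).2 + 1)
    else ((q.run σ).1, t.cost + (q.run σ).2 + 1)
  | loop v e p, σ =>
    let r := iterate (fun n τ => p.run (τ.setReg v n)) σ (e.eval σ)
    (r.1, e.cost + r.2 + 1)

/-- The initial store: `d` and `δ` in the registers `0` and `1`, the measurement `b (l, r)` in the
cell `l d + r` of the array `0`, and zeros elsewhere. -/
def inputStore (b : Fin (2 * δ - 1) × ZMod d → ℝ) : Store where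
  reg := fun v => if v = 0 then d else if v = 1 then δ else 0
  mem := fun r t =>
    if r = 0 then
      if h : t < d * (2 * δ - 1) then
        ((b (⟨t / d, Nat.div_lt_of_lt_mul h⟩, (t : ZMod d)) : ℝ) : ℂ)
      else 0
    else 0

/-- The vector that a program returns, in the cells `0, …, d - 1` of the array `1`. -/
def Program.output (p : Program) (b : Fin (2 * δ - 1) × ZMod d → ℝ) :
    EuclideanSpace ℂ (ZMod d) :=
  WithLp.toLp 2 fun j => (p.run (inputStore b)).1.mem 1 j.val

/-- The number of operations that a program performs on the measurements `b`. -/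
def Program.operations (p : Program) (b : Fin (2 * δ - 1) × ZMod d → ℝ) : ℕ :=
  (p.run (inputStore b)).2

end BlockPR

end

set_option linter.unusedSectionVars false

noncomputable section
open scoped ComplexConjugate
open Matrix
namespace BlockPR

/-! Conditioning. In M' the phases and the damping separate: the entry at block k (counted from 0),
row i and position j is a real weight depending only on k and j, times a conjugate character of
ℤ/(2δ-1), over √(2δ-1) (`liftedBlock_eq`). A unitary Fourier transform inside every block row
therefore splits M' into 2δ-1 independent correlations along ℤ/d, one per position, whose weights
form a truncated geometric progression (`windowSum`). Subtracting the ratio times the next value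
telescopes such a correlation to y - Q S y, up to a positive factor and a translation, where S is
the shift by L = δ - |o| and Q is the L-th power of the ratio (`windowSum_sub`). Shifts are
isometries and Q < 1, so this is invertible. The choice of a gives 1 - Q ≥ 1/a and keeps the factor
above exp (-3), whence the inverse of M' has norm at most 2 exp(3) a (`sum_norm_sq_le`). So M' is
invertible, and every product is recovered within ε = 2 exp(3) a ‖n‖ (`norm_liftedEstimate_sub_le`).

Synchronization. The data are real, so the estimated products are Hermitian (`liftedEstimate_conj`)
and the averaged argument is the argument of one product. Flatness puts an entry of size at least
‖x‖/(2√d) among any δ-1 successive entries (`IsFlat.exists_large`). Hence all greedy reference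
entries have size at least m = ‖x‖/√(8d), and one transfer of the phase adds at most 2ε/m² to the
relative error (`phase_error_step`). Each pass marks a new entry, so at most d transfers accumulate
(`PhaseInvariant.advance`). Summing squares, with d²ε/‖x‖² ≤ 1/16, leaves a multiple of d²ε, and ε
is of order (δ-1)‖n‖ once δ ≥ 2 (`sum_error_le`, `recovery_error`).

Speed. The Fourier transforms of length 2δ-1 are reduced to power-of-two transforms by chirps
(`bluestein`, `fft_spec`); there are d of them, costing O(δ log δ) each. The equation y - Q S y = U
needs no Fourier transform of length d: the d-th power of S is the identity, so d terms of the
Neumann series give (1 - Q^d) y exactly, and repeated doubling sums them in O(d log d) operations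
(`neumann_of_eq`, `neumann_double`). Synchronization makes at most d effective passes over windows
of 2δ-1 entries. A syntactic bound turns the loop counts into an operation count (`run_cost_le`). -/

/-! ### Characters of finite cyclic groups -/

/-- The value `exp (2πi a b / n)` of a character of `ℤ/n`. -/
def char (n a b : ℕ) : ℂ := Complex.exp (2 * Real.pi * Complex.I * a * b / n)

lemma char_eq_ofReal (n a b : ℕ) :
    char n a b = Complex.exp ((2 * Real.pi * a * b / n : ℝ) * Complex.I) := by
  unfold char; congr 1; push_cast; ring

lemma conj_char (n a b : ℕ) :
    conj (char n a b) = Complex.exp (-(2 * Real.pi * Complex.I * a * b / n)) := by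
  rw [char_eq_ofReal, ← Complex.exp_conj, map_mul, Complex.conj_ofReal, Complex.conj_I]
  congr 1; push_cast; ring

lemma char_mul_conj_self (n a b : ℕ) : char n a b * conj (char n a b) = 1 := by
  rw [conj_char, char, ← Complex.exp_add]; simp

lemma char_comm (n a b : ℕ) : char n a b = char n b a := by
  unfold char; congr 1; ring

/-- The summands are the powers of one n-th root of unity, which differs from 1 unless j = k because
|j - k| < n; the geometric sum then vanishes. -/
lemma sum_char_mul_conj {n j k : ℕ} (hj : j < n) (hk : k < n) :
    ∑ i ∈ Finset.range n, char n i j * conj (char n i k) = if j = k then (n : ℂ) else 0 := by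
  have hn : (n : ℂ) ≠ 0 := by exact_mod_cast (by omega : n ≠ 0)
  split_ifs with h
  · subst h; simp [char_mul_conj_self]
  · set z : ℂ := Complex.exp (2 * Real.pi * Complex.I * ((j : ℂ) - k) / n) with hz
    have hpow : ∀ i : ℕ, char n i j * conj (char n i k) = z ^ i := by
      intro i
      rw [conj_char, char, ← Complex.exp_add, hz, ← Complex.exp_nat_mul]
      congr 1; ring
    simp only [hpow]
    have hzn : z ^ n = 1 := by
      rw [hz, ← Complex.exp_nat_mul, Complex.exp_eq_one_iff]
      exact ⟨(j : ℤ) - k, by push_cast; field_simp⟩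
    have hz1 : z ≠ 1 := by
      intro h1
      rw [hz, Complex.exp_eq_one_iff] at h1
      obtain ⟨m, hm⟩ := h1
      have h2 : ((j : ℂ) - k) = m * n := by
        have : (2 * Real.pi * Complex.I : ℂ) ≠ 0 := Complex.two_pi_I_ne_zero
        field_simp at hm
        linear_combination hm
      have h3 : (j : ℤ) - k = m * n := by exact_mod_cast h2
      have h4 : m = 0 := by
        by_contra hm0
        have : (n : ℤ) ∣ (j : ℤ) - k := ⟨m, by rw [h3]; ring⟩
        have := Int.eq_zero_of_abs_lt_dvd this (by rw [abs_lt]; omega)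
        omega
      rw [h4] at h3; omega
    have := mul_neg_geom_sum z n
    rw [hzn, sub_self] at this
    exact (mul_eq_zero.mp this).resolve_left (sub_ne_zero.mpr hz1.symm)

/-! ### Sums over residues -/

lemma sum_zmod {d : ℕ} [NeZero d] {A : Type*} [AddCommMonoid A] (f : ℕ → ZMod d → A)
    (r : ZMod d) :
    ∑ p : ZMod d, f (p - r).val p = ∑ k ∈ Finset.range d, f k (r + k) := by
  symm
  refine Finset.sum_bij' (fun k _ => r + (k : ZMod d)) (fun p _ => (p - r).val) ?_ ?_ ?_ ?_ ?_
  · simp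
  · intro p _; simpa using ZMod.val_lt _
  · intro k hk; simp [ZMod.val_natCast, Nat.mod_eq_of_lt (Finset.mem_range.mp hk)]
  · intro p _; simp
  · intro k hk; simp [ZMod.val_natCast, Nat.mod_eq_of_lt (Finset.mem_range.mp hk)]

/-! ### The blocks of the lifted matrix -/

/-- The ratio of the geometric progressions in the lifted matrix. -/
def ratio (δ : ℕ) : ℝ := Real.exp (-2 / damping δ)

/-- The absolute offset `|o|` of the products in position `j` of a block. -/
def offset (δ j : ℕ) : ℕ := if j < δ then j else 2 * δ - 1 - j

/-- The first circulant block, counted from `0`, that acts on position `j`. -/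
def blockShift (δ j : ℕ) : ℕ := if j < δ then 0 else 2 * δ - 2 - j

/-- The leading coefficient of the geometric progression for position `j`. -/
def leading (δ j : ℕ) : ℝ := Real.exp (-(2 + offset δ j) / damping δ)

lemma four_le_damping (δ : ℕ) : 4 ≤ damping δ := le_max_left _ _

lemma damping_pos (δ : ℕ) : 0 < damping δ := lt_of_lt_of_le (by norm_num) (four_le_damping δ)

lemma leading_pos (δ j : ℕ) : 0 < leading δ j := Real.exp_pos _

lemma ratio_pos (δ : ℕ) : 0 < ratio δ := Real.exp_pos _

lemma ratio_lt_one (δ : ℕ) : ratio δ < 1 := by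
  rw [ratio, Real.exp_lt_one_iff]
  exact div_neg_of_neg_of_pos (by norm_num) (damping_pos δ)

lemma offset_lt {δ j : ℕ} (hj : j < 2 * δ - 1) : offset δ j < δ := by
  unfold offset; split_ifs <;> omega

lemma ratio_pow_lt_one {δ j : ℕ} (hj : j < 2 * δ - 1) : ratio δ ^ (δ - offset δ j) < 1 :=
  pow_lt_one₀ (ratio_pos δ).le (ratio_lt_one δ) (by have := offset_lt hj; omega)

lemma mask_succ {δ k : ℕ} (hk : k < δ) (i : ℕ) :
    mask δ (i + 1) (k + 1) =
      ((Real.exp (-((k : ℝ) + 1) / damping δ) / (2 * (δ : ℝ) - 1) ^ (1 / 4 : ℝ) : ℝ) : ℂ) *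
        char (2 * δ - 1) k i := by
  have h : ((2 * δ - 1 : ℕ) : ℂ) = 2 * (δ : ℂ) - 1 := by
    rw [Nat.cast_sub (by omega)]; push_cast; ring
  rw [mask, if_pos (by omega), char, h]
  congr 2
  · push_cast; ring_nf
  · push_cast; ring

lemma mask_mul_conj {δ k k' : ℕ} (hk : k < δ) (hk' : k' < δ) (i : ℕ) :
    mask δ (i + 1) (k + 1) * conj (mask δ (i + 1) (k' + 1)) =
      ((Real.exp (-((k : ℝ) + k' + 2) / damping δ) / √((2 * δ - 1 : ℕ) : ℝ) : ℝ) : ℂ) *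
        (char (2 * δ - 1) k i * conj (char (2 * δ - 1) k' i)) := by
  have hN : (((2 * δ - 1 : ℕ) : ℝ)) = 2 * (δ : ℝ) - 1 := by
    rw [Nat.cast_sub (by omega)]; push_cast; ring
  have hpos : (0 : ℝ) < 2 * (δ : ℝ) - 1 := by
    have : (1 : ℝ) ≤ δ := by exact_mod_cast (by omega : 1 ≤ δ)
    linarith
  have hs : √(2 * (δ : ℝ) - 1) =
      (2 * (δ : ℝ) - 1) ^ (1 / 4 : ℝ) * (2 * (δ : ℝ) - 1) ^ (1 / 4 : ℝ) := by
    rw [← Real.rpow_add hpos, Real.sqrt_eq_rpow]; norm_num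
  have he : Real.exp (-((k : ℝ) + k' + 2) / damping δ) =
      Real.exp (-((k : ℝ) + 1) / damping δ) * Real.exp (-((k' : ℝ) + 1) / damping δ) := by
    rw [← Real.exp_add]; congr 1; ring
  rw [mask_succ hk, mask_succ hk', map_mul, Complex.conj_ofReal, hN, hs, he]
  push_cast
  ring

/-- The product of two mask entries has a phase that depends only on the difference of their
indices, which is -j modulo 2δ-1 in both branches of the definition, and a modulus that depends only
on their sum. So the phase does not see the block number k, while the modulus is geometric in k. -/
lemma liftedBlock_eq {δ j : ℕ} (hj : j < 2 * δ - 1) (k i : ℕ) :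
    liftedBlock δ (k + 1) (i + 1) (j + 1) =
      (if blockShift δ j ≤ k ∧ k < blockShift δ j + (δ - offset δ j) then
        ((leading δ j * ratio δ ^ (k - blockShift δ j) : ℝ) : ℂ) else 0) *
      (((1 / √((2 * δ - 1 : ℕ) : ℝ) : ℝ) : ℂ) * conj (char (2 * δ - 1) j i)) := by
  have hlead : ∀ t : ℕ, leading δ j * ratio δ ^ t =
      Real.exp (-(2 + offset δ j + 2 * t) / damping δ) := by
    intro t
    rw [leading, ratio, ← Real.exp_nat_mul, ← Real.exp_add]; congr 1; ring
  simp only [hlead]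
  have hN : ((2 * δ - 1 : ℕ) : ℂ) ≠ 0 := by exact_mod_cast (by omega : 2 * δ - 1 ≠ 0)
  unfold liftedBlock
  by_cases hjδ : j < δ
  · simp only [offset, blockShift, if_pos hjδ]
    by_cases h1 : k + 1 + (j + 1) ≤ δ + 1
    · rw [if_pos h1, if_pos (by omega), show j + 1 + (k + 1) - 1 = (j + k) + 1 by omega,
        mask_mul_conj (by omega) (by omega)]
      have : char (2 * δ - 1) k i * conj (char (2 * δ - 1) (j + k) i) =
          conj (char (2 * δ - 1) j i) := by
        rw [conj_char, conj_char, char, ← Complex.exp_add]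
        congr 1; push_cast; ring
      rw [this, ← mul_assoc, ← Complex.ofReal_mul]
      congr 3
      rw [div_eq_mul_one_div]
      congr 3
      rw [Nat.sub_zero]; push_cast; ring
    · rw [if_neg h1, if_neg (by omega), if_neg (by omega), zero_mul]
  · simp only [offset, blockShift, if_neg hjδ]
    rw [if_neg (by omega)]
    by_cases h1 : 2 * δ ≤ k + 1 + (j + 1) ∧ k + 1 < δ
    · rw [if_pos h1, if_pos (by omega),
        show k + 1 + (j + 1) + 1 - 2 * δ = (k + j + 2 - 2 * δ) + 1 by omega,
        mask_mul_conj (by omega) (by omega)]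
      have hc : ((k + j + 2 - 2 * δ : ℕ) : ℂ) = k + 1 + j - ((2 * δ - 1 : ℕ) : ℂ) := by
        rw [Nat.cast_sub (by omega), Nat.cast_sub (by omega)]; push_cast; ring
      have : char (2 * δ - 1) (k + 1) i * conj (char (2 * δ - 1) (k + j + 2 - 2 * δ) i) =
          conj (char (2 * δ - 1) j i) := by
        rw [conj_char, conj_char, char, ← Complex.exp_add]
        rw [Complex.exp_eq_exp_iff_exists_int]
        -- For negative offsets the two mask indices differ by 2δ-1-j instead of -j; over 2δ-1 this
        -- changes the exponent by exactly i full turns.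
        refine ⟨i, ?_⟩
        rw [hc]
        field_simp
        push_cast; ring
      rw [this, ← mul_assoc, ← Complex.ofReal_mul]
      congr 3
      rw [div_eq_mul_one_div]
      congr 3
      rw [Nat.cast_sub (by omega : 2 * δ ≤ k + j + 2), Nat.cast_sub (by omega : j ≤ 2 * δ - 1),
        Nat.cast_sub (by omega : 1 ≤ 2 * δ), Nat.cast_sub (by omega : 2 * δ - 2 - j ≤ k),
        Nat.cast_sub (by omega : j ≤ 2 * δ - 2), Nat.cast_sub (by omega : 2 ≤ 2 * δ)]
      push_cast; ring
    · rw [if_neg h1, if_neg (by omega), zero_mul]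

lemma sum_range_window {A : Type*} [AddCommMonoid A] {m n s : ℕ} (h : s + n ≤ m) (f : ℕ → A) :
    ∑ k ∈ Finset.range m, (if s ≤ k ∧ k < s + n then f k else 0) =
      ∑ t ∈ Finset.range n, f (s + t) := by
  rw [← Finset.sum_filter]
  have : (Finset.range m).filter (fun k => s ≤ k ∧ k < s + n) = Finset.Ico s (s + n) := by
    ext k; simp; omega
  rw [this, Finset.sum_Ico_eq_sum_range]; simp

/-- The truncated geometric correlation that the lifted matrix applies to the position `j`. -/
def windowSum {d δ : ℕ} (y : ZMod d × Fin (2 * δ - 1) → ℂ) (r : ZMod d) (j : Fin (2 * δ - 1)) : ℂ :=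
  ∑ t ∈ Finset.range (δ - offset δ j),
    (leading δ j : ℂ) * (ratio δ : ℂ) ^ t * y (r + (blockShift δ j : ℕ) + (t : ℕ), j)

/-- Telescoping of a geometric window: only its two ends survive. This replaces a correlation with
up to δ terms by a two-term equation. -/
lemma windowSum_sub {d δ : ℕ} (y : ZMod d × Fin (2 * δ - 1) → ℂ) (r : ZMod d) (j : Fin (2 * δ - 1)) :
    windowSum y r j - ratio δ * windowSum y (r + 1) j =
      leading δ j * (y (r + (blockShift δ j : ℕ), j) - (ratio δ : ℂ) ^ (δ - offset δ j) *
        y (r + (blockShift δ j : ℕ) + ((δ - offset δ j : ℕ) : ZMod d), j)) := by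
  set f : ℕ → ℂ := fun t => (leading δ j : ℂ) * (ratio δ : ℂ) ^ t *
    y (r + (blockShift δ j : ℕ) + (t : ℕ), j) with hf
  have h1 : windowSum y r j = ∑ t ∈ Finset.range (δ - offset δ j), f t := rfl
  have h2 : ratio δ * windowSum y (r + 1) j = ∑ t ∈ Finset.range (δ - offset δ j), f (t + 1) := by
    rw [windowSum, Finset.mul_sum]
    refine Finset.sum_congr rfl fun t _ => ?_
    simp only [hf]
    rw [show r + 1 + ((blockShift δ j : ℕ) : ZMod d) + (t : ZMod d) =
      r + (blockShift δ j : ℕ) + ((t + 1 : ℕ) : ZMod d) by push_cast; ring]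
    ring
  rw [h1, h2, ← Finset.sum_sub_distrib, Finset.sum_range_sub']
  simp only [hf]; push_cast; ring_nf

variable {d δ : ℕ} [NeZero d] [NeZero δ]

lemma liftedMatrix_mulVec (hd : 2 * δ - 1 ≤ d) (y : ZMod d × Fin (2 * δ - 1) → ℂ) (r : ZMod d)
    (i : Fin (2 * δ - 1)) :
    (liftedMatrix d δ *ᵥ y) (r, i) = ((1 / √((2 * δ - 1 : ℕ) : ℝ) : ℝ) : ℂ) *
      ∑ j : Fin (2 * δ - 1), conj (char (2 * δ - 1) j i) * windowSum y r j := by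
  rw [mulVec, dotProduct, Fintype.sum_prod_type, Finset.sum_comm, Finset.mul_sum]
  refine Finset.sum_congr rfl fun j _ => ?_
  have hδ := NeZero.pos δ
  have h := sum_zmod (fun k p => liftedBlock δ (k + 1) (i + 1) (j + 1) * y (p, j)) r
  simp only [liftedMatrix, of_apply]
  rw [h]
  have hj := j.2
  -- The window has to fit into one period of ℤ/d, otherwise distinct blocks would be added up.
  have hle : blockShift δ j + (δ - offset δ j) ≤ d := by
    unfold blockShift offset; split_ifs <;> omega
  simp only [liftedBlock_eq hj, ite_mul, zero_mul]
  rw [sum_range_window hle, windowSum, Finset.mul_sum, Finset.mul_sum]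
  refine Finset.sum_congr rfl fun t _ => ?_
  rw [Nat.add_sub_cancel_left]
  push_cast
  rw [add_assoc r]
  ring

/-- Fourier inversion within a block row. It is also the formula by which the program obtains the
correlations from the data. -/
lemma windowSum_eq (hd : 2 * δ - 1 ≤ d) (y : ZMod d × Fin (2 * δ - 1) → ℂ) (r : ZMod d)
    (j : Fin (2 * δ - 1)) :
    windowSum y r j = ((1 / √((2 * δ - 1 : ℕ) : ℝ) : ℝ) : ℂ) *
      ∑ i : Fin (2 * δ - 1), char (2 * δ - 1) j i * (liftedMatrix d δ *ᵥ y) (r, i) := by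
  simp only [liftedMatrix_mulVec hd, Finset.mul_sum]
  rw [Finset.sum_comm]
  have hδ := NeZero.pos δ
  have hN : (0 : ℝ) < ((2 * δ - 1 : ℕ) : ℝ) := by exact_mod_cast (by omega : 0 < 2 * δ - 1)
  have hs : ((1 / √((2 * δ - 1 : ℕ) : ℝ) : ℝ) : ℂ) * ((1 / √((2 * δ - 1 : ℕ) : ℝ) : ℝ) : ℂ) *
      ((2 * δ - 1 : ℕ) : ℂ) = 1 := by
    have : (1 / √((2 * δ - 1 : ℕ) : ℝ)) * (1 / √((2 * δ - 1 : ℕ) : ℝ)) * ((2 * δ - 1 : ℕ) : ℝ)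
        = 1 := by
      rw [div_mul_div_comm, Real.mul_self_sqrt hN.le]; field_simp
    exact_mod_cast this
  set s : ℂ := ((1 / √((2 * δ - 1 : ℕ) : ℝ) : ℝ) : ℂ)
  have hj' : ∀ j' : Fin (2 * δ - 1), ∑ i : Fin (2 * δ - 1),
      s * (char (2 * δ - 1) j i * (s * (conj (char (2 * δ - 1) j' i) * windowSum y r j'))) =
      if j = j' then windowSum y r j else 0 := by
    intro j'
    have := sum_char_mul_conj j.2 j'.2
    rw [← Fin.sum_univ_eq_sum_range
      (fun i => char (2 * δ - 1) i j * conj (char (2 * δ - 1) i j'))] at this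
    calc _ = s * s * windowSum y r j' * ∑ i : Fin (2 * δ - 1),
          char (2 * δ - 1) i j * conj (char (2 * δ - 1) i j') := by
          rw [Finset.mul_sum]
          refine Finset.sum_congr rfl fun i _ => ?_
          rw [char_comm _ j i, char_comm _ j' i]; ring
      _ = _ := by
          rw [this]
          by_cases h : j = j'
          · subst h; simp only [if_true]; linear_combination windowSum y r j * hs
          · rw [if_neg h, if_neg (by simpa [Fin.ext_iff] using h), mul_zero]
  simp only [hj']
  simp

end BlockPR
end

noncomputable section
open scoped ComplexConjugate
open Matrix
namespace BlockPR
variable {d δ : ℕ} [NeZero d] [NeZero δ]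

/-! ### Conditioning of the lifted matrix -/

/-- Plancherel for the transform within a block row: the transform and its inverse, with the same
normalization, are adjoint to each other. -/
lemma sum_norm_windowSum_sq (hd : 2 * δ - 1 ≤ d) (y : ZMod d × Fin (2 * δ - 1) → ℂ) (r : ZMod d) :
    ∑ j, ‖windowSum y r j‖ ^ 2 = ∑ i, ‖(liftedMatrix d δ *ᵥ y) (r, i)‖ ^ 2 := by
  set s : ℝ := 1 / √((2 * δ - 1 : ℕ) : ℝ)
  have h : ∑ j, conj (windowSum y r j) * windowSum y r j =
      ∑ i, conj ((liftedMatrix d δ *ᵥ y) (r, i)) * (liftedMatrix d δ *ᵥ y) (r, i) := by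
    calc _ = ∑ j, conj (windowSum y r j) * ((s : ℂ) *
            ∑ i : Fin (2 * δ - 1), char (2 * δ - 1) j i * (liftedMatrix d δ *ᵥ y) (r, i)) := by
          refine Finset.sum_congr rfl fun j _ => ?_
          rw [← windowSum_eq hd]
      _ = ∑ i : Fin (2 * δ - 1), conj ((s : ℂ) *
            ∑ j : Fin (2 * δ - 1), conj (char (2 * δ - 1) j i) * windowSum y r j) *
              (liftedMatrix d δ *ᵥ y) (r, i) := by
          simp only [map_mul, map_sum, Complex.conj_ofReal, Complex.conj_conj, Finset.mul_sum,
            Finset.sum_mul]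
          rw [Finset.sum_comm]
          refine Finset.sum_congr rfl fun i _ => Finset.sum_congr rfl fun j _ => ?_
          ring
      _ = _ := by
          refine Finset.sum_congr rfl fun i _ => ?_
          rw [← liftedMatrix_mulVec hd]
  simp only [Complex.conj_mul'] at h
  exact_mod_cast h

lemma norm_toLp_comp_add (f : ZMod d → ℂ) (c : ZMod d) :
    ‖(WithLp.toLp 2 fun r => f (r + c) : EuclideanSpace ℂ (ZMod d))‖ =
      ‖(WithLp.toLp 2 f : EuclideanSpace ℂ (ZMod d))‖ := by
  simp only [EuclideanSpace.norm_eq]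
  congr 1
  exact Fintype.sum_equiv (Equiv.addRight c) _ _ fun r => rfl

/-- A bound for the norm of the inverse of the lifted matrix. -/
def inverseBound (δ : ℕ) : ℝ := 2 * Real.exp 3 * damping δ

lemma inverseBound_pos (δ : ℕ) : 0 < inverseBound δ :=
  mul_pos (by positivity) (damping_pos δ)

/-- With |o| ≤ δ - 1 ≤ 2a and 2 ≤ a, the exponent (2 + |o|)/a is at most 3. This is why a must grow
with δ. -/
lemma exp_neg_three_le_leading {δ j : ℕ} (hj : j < 2 * δ - 1) :
    Real.exp (-3) ≤ leading δ j := by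
  rw [leading, Real.exp_le_exp, le_div_iff₀ (damping_pos δ)]
  have h1 : ((offset δ j : ℕ) : ℝ) + 1 ≤ δ := by exact_mod_cast offset_lt hj
  have h2 : ((δ : ℝ) - 1) / 2 ≤ damping δ := le_max_right _ _
  have h3 := four_le_damping δ
  linarith

/-- The worst case is a window of length one, where Q is the ratio itself; then exp (-2/a) ≤ 1/(1 +
2/a) ≤ 1 - 1/a, as 1/a is at most 1/2. -/
lemma one_div_damping_le {δ j : ℕ} (hj : j < 2 * δ - 1) :
    1 / damping δ ≤ 1 - ratio δ ^ (δ - offset δ j) := by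
  have ha := four_le_damping δ
  have ha0 := damping_pos δ
  have h1 : ratio δ ^ (δ - offset δ j) ≤ ratio δ :=
    pow_le_of_le_one (ratio_pos δ).le (ratio_lt_one δ).le (by have := offset_lt hj; omega)
  have h2 : ratio δ ≤ 1 / (1 + 2 / damping δ) := by
    have h3 : ratio δ = 1 / Real.exp (2 / damping δ) := by
      rw [ratio, neg_div, Real.exp_neg, one_div]
    rw [h3]
    apply one_div_le_one_div_of_le (by positivity)
    linarith [Real.add_one_le_exp (2 / damping δ)]
  have h4 : 1 / (1 + 2 / damping δ) ≤ 1 - 1 / damping δ := by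
    rw [div_le_iff₀ (by positivity)]
    have : 0 ≤ 1 / damping δ * (1 - 2 * (1 / damping δ)) := by
      apply mul_nonneg (by positivity)
      have : 1 / damping δ ≤ 1 / 4 := one_div_le_one_div_of_le (by norm_num) ha
      linarith
    rw [show (2 : ℝ) / damping δ = 2 * (1 / damping δ) by ring]
    nlinarith
  linarith

/-- Solving the telescoped equation for y and using that translations are isometries gives V ≤ Q V +
(1 + ratio) W / c, with V and W the norms of the two sides and c the leading coefficient. The two
preceding bounds control 1/c and 1/(1 - Q). -/
lemma norm_column_le (y : ZMod d × Fin (2 * δ - 1) → ℂ) (j : Fin (2 * δ - 1)) :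
    ‖(WithLp.toLp 2 fun r => y (r, j) : EuclideanSpace ℂ (ZMod d))‖ ≤ inverseBound δ *
      ‖(WithLp.toLp 2 fun r => windowSum y r j : EuclideanSpace ℂ (ZMod d))‖ := by
  set Q : ℝ := ratio δ ^ (δ - offset δ j) with hQ
  set c := leading δ j with hc
  set f : ZMod d → ℂ := fun r => y (r, j)
  set g : ZMod d → ℂ := fun r => windowSum y r j
  set V := ‖(WithLp.toLp 2 f : EuclideanSpace ℂ (ZMod d))‖ with hV
  set W := ‖(WithLp.toLp 2 g : EuclideanSpace ℂ (ZMod d))‖ with hW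
  have hW0 : 0 ≤ W := norm_nonneg _
  have hc0 : 0 < c := leading_pos δ j
  have hQ0 : 0 ≤ Q := pow_nonneg (ratio_pos δ).le _
  have hq := ratio_lt_one δ
  have hq0 := ratio_pos δ
  have key : (WithLp.toLp 2 fun r => f (r + (blockShift δ j : ℕ)) : EuclideanSpace ℂ (ZMod d)) =
      (Q : ℂ) • (WithLp.toLp 2 fun r =>
        f (r + ((blockShift δ j : ℕ) + ((δ - offset δ j : ℕ) : ZMod d)))) +
      (((c⁻¹ : ℝ)) : ℂ) • ((WithLp.toLp 2 g : EuclideanSpace ℂ (ZMod d)) -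
        (ratio δ : ℂ) • (WithLp.toLp 2 fun r => g (r + 1))) := by
    ext r
    have h := windowSum_sub y r j
    have hcc : (c : ℂ) ≠ 0 := by exact_mod_cast hc0.ne'
    simp only [PiLp.add_apply, PiLp.smul_apply, PiLp.sub_apply, smul_eq_mul, f, g, h, hQ]
    push_cast
    rw [← hc, ← add_assoc]
    field_simp
    ring
  have h1 : V ≤ Q * V + c⁻¹ * (W + ratio δ * W) := by
    calc V = ‖(WithLp.toLp 2 fun r => f (r + (blockShift δ j : ℕ)) :
              EuclideanSpace ℂ (ZMod d))‖ := (norm_toLp_comp_add f _).symm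
      _ ≤ _ := by
          rw [key]
          refine (norm_add_le _ _).trans (add_le_add ?_ ?_)
          · rw [norm_smul, norm_toLp_comp_add, Complex.norm_real, Real.norm_of_nonneg hQ0]
          · rw [norm_smul, Complex.norm_real, Real.norm_of_nonneg (by positivity)]
            refine mul_le_mul_of_nonneg_left ((norm_sub_le _ _).trans ?_) (by positivity)
            rw [norm_smul, norm_toLp_comp_add, Complex.norm_real, Real.norm_of_nonneg hq0.le]
  have h2 : c⁻¹ ≤ Real.exp 3 := by
    rw [inv_le_comm₀ hc0 (by positivity), ← Real.exp_neg]
    exact exp_neg_three_le_leading j.2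
  have h3 : (1 - Q) * V ≤ Real.exp 3 * (2 * W) := by
    have h4 : c⁻¹ * (W + ratio δ * W) ≤ Real.exp 3 * (2 * W) := by
      apply mul_le_mul h2 _ (by positivity) (by positivity)
      nlinarith
    linarith
  have h5 := one_div_damping_le j.2
  have h6 : 1 / damping δ * V ≤ Real.exp 3 * (2 * W) :=
    (mul_le_mul_of_nonneg_right h5 (norm_nonneg _)).trans h3
  have ha := damping_pos δ
  rw [one_div_mul_eq_div, div_le_iff₀ ha] at h6
  rw [inverseBound]; linarith

lemma sum_norm_sq_le (hd : 2 * δ - 1 ≤ d) (y : ZMod d × Fin (2 * δ - 1) → ℂ) :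
    ∑ q, ‖y q‖ ^ 2 ≤ inverseBound δ ^ 2 * ∑ q, ‖(liftedMatrix d δ *ᵥ y) q‖ ^ 2 := by
  have h : ∀ j, ∑ r, ‖y (r, j)‖ ^ 2 ≤ inverseBound δ ^ 2 * ∑ r, ‖windowSum y r j‖ ^ 2 := by
    intro j
    have h1 := pow_le_pow_left₀ (norm_nonneg _) (norm_column_le y j) 2
    rw [mul_pow, EuclideanSpace.norm_sq_eq, EuclideanSpace.norm_sq_eq] at h1
    exact h1
  rw [Fintype.sum_prod_type_right, Fintype.sum_prod_type]
  simp only [← sum_norm_windowSum_sq hd]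
  rw [Finset.sum_comm (f := fun r j => ‖windowSum y r j‖ ^ 2), Finset.mul_sum]
  exact Finset.sum_le_sum fun j _ => h j

lemma isUnit_det_liftedMatrix (hd : 2 * δ - 1 ≤ d) : IsUnit (liftedMatrix d δ).det := by
  rw [← Matrix.isUnit_iff_isUnit_det, ← Matrix.mulVec_injective_iff_isUnit]
  intro y z h
  have h0 : liftedMatrix d δ *ᵥ (y - z) = 0 := by rw [Matrix.mulVec_sub]; exact sub_eq_zero.mpr h
  have h1 := sum_norm_sq_le hd (y - z)
  rw [h0] at h1
  simp only [Pi.zero_apply, norm_zero, ne_eq, OfNat.ofNat_ne_zero, not_false_eq_true, zero_pow,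
    Finset.sum_const_zero, mul_zero] at h1
  have h2 := (Finset.sum_eq_zero_iff_of_nonneg (fun q _ => by positivity)).mp
    (le_antisymm h1 (Finset.sum_nonneg fun q _ => by positivity))
  ext q
  have := h2 q (Finset.mem_univ q)
  simpa [sub_eq_zero] using this

lemma liftedMatrix_mulVec_liftedEstimate (hd : 2 * δ - 1 ≤ d)
    (b : Fin (2 * δ - 1) × ZMod d → ℝ) :
    liftedMatrix d δ *ᵥ liftedEstimate b = fun q => ((b (q.2, q.1) : ℝ) : ℂ) := by
  rw [liftedEstimate, Matrix.mulVec_mulVec,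
    Matrix.mul_nonsing_inv _ (isUnit_det_liftedMatrix hd), Matrix.one_mulVec]

lemma eq_liftedEstimate (hd : 2 * δ - 1 ≤ d) {b : Fin (2 * δ - 1) × ZMod d → ℝ}
    {y : ZMod d × Fin (2 * δ - 1) → ℂ}
    (h : liftedMatrix d δ *ᵥ y = fun q => ((b (q.2, q.1) : ℝ) : ℂ)) : y = liftedEstimate b := by
  rw [liftedEstimate, ← h, Matrix.mulVec_mulVec,
    Matrix.nonsing_inv_mul _ (isUnit_det_liftedMatrix hd), Matrix.one_mulVec]

/-! ### Positions of products -/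

/-- This is where 2δ - 1 ≤ d enters the indexing: it makes 2|o| < d, so that o is its own
representative in (-d/2, d/2]. -/
lemma valMinAbs_intCast (hd : 2 * δ - 1 ≤ d) {o : ℤ} (h1 : -(δ : ℤ) < o) (h2 : o < δ) :
    ((o : ℤ) : ZMod d).valMinAbs = o := by
  rw [ZMod.valMinAbs_spec]
  refine ⟨rfl, ?_⟩
  rw [Set.mem_Ioc]
  omega

lemma productIndex_add_nonneg (hd : 2 * δ - 1 ≤ d) (p : ZMod d) {j : ℕ} (hj : j < δ) :
    productIndex (p + (j : ZMod d)) p = (p, (⟨j, by omega⟩ : Fin (2 * δ - 1))) := by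
  have h : (p + (j : ZMod d) - p).valMinAbs = (j : ℤ) := by
    rw [add_sub_cancel_left, ← Int.cast_natCast]
    exact valMinAbs_intCast hd (by omega) (by omega)
  have h2 : ((j : ℤ) % ((2 * δ - 1 : ℕ) : ℤ)).toNat = j := by
    rw [← Int.natCast_mod, Int.toNat_natCast, Nat.mod_eq_of_lt (by omega)]
  unfold productIndex
  rw [h, h2, if_pos (by omega)]
  ext
  · rfl
  · simp [Nat.mod_eq_of_lt (show j < 2 * δ - 1 by omega)]

/-- A block begins at offset 0 of an entry, so the negative offsets of the entry p close the block
of its predecessor p - 1. -/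
lemma productIndex_sub_pos (hd : 2 * δ - 1 ≤ d) (p : ZMod d) {j : ℕ} (hj : 0 < j) (hj' : j < δ) :
    productIndex (p - (j : ZMod d)) p = (p - 1, (⟨2 * δ - 1 - j, by omega⟩ : Fin (2 * δ - 1))) := by
  have h : (p - (j : ZMod d) - p).valMinAbs = -(j : ℤ) := by
    rw [sub_sub_cancel_left, ← Int.cast_natCast, ← Int.cast_neg]
    exact valMinAbs_intCast hd (by omega) (by omega)
  have h2 : (-(j : ℤ) % ((2 * δ - 1 : ℕ) : ℤ)).toNat = 2 * δ - 1 - j := by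
    rw [← Int.add_emod_right, Int.emod_eq_of_lt (by omega) (by omega)]
    omega
  unfold productIndex
  rw [h, h2, if_neg (by omega)]
  ext
  · rfl
  · simp [Nat.mod_eq_of_lt (show 2 * δ - 1 - j < 2 * δ - 1 by omega)]

/-- The vector that has `Y u v` in the position of the product `conj x_u * x_v`. -/
def arrange (Y : ZMod d → ZMod d → ℂ) : ZMod d × Fin (2 * δ - 1) → ℂ := fun c =>
  if (c.2 : ℕ) < δ then Y c.1 (c.1 + (c.2 : ℕ))
  else Y (c.1 + 1) (c.1 + 1 - ((2 * δ - 1 - c.2 : ℕ) : ZMod d))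

lemma exists_offset (u v : ZMod d) (h : |(v - u).valMinAbs| < (δ : ℤ)) :
    (∃ j < δ, v = u + (j : ℕ)) ∨ ∃ j, 0 < j ∧ j < δ ∧ v = u - (j : ℕ) := by
  have hv : (((v - u).valMinAbs : ℤ) : ZMod d) = v - u := ZMod.coe_valMinAbs _
  rw [abs_lt] at h
  rcases le_or_gt 0 (v - u).valMinAbs with h0 | h0
  · left
    obtain ⟨j, hj⟩ := Int.eq_ofNat_of_zero_le h0
    rw [hj] at h hv
    refine ⟨j, by omega, ?_⟩
    rw [Int.cast_natCast] at hv; rw [hv]; ring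
  · right
    obtain ⟨j, hj⟩ := Int.eq_ofNat_of_zero_le (by omega : 0 ≤ -(v - u).valMinAbs)
    have hj' : (v - u).valMinAbs = -(j : ℤ) := by omega
    rw [hj'] at h hv
    refine ⟨j, by omega, by omega, ?_⟩
    rw [Int.cast_neg, Int.cast_natCast] at hv
    linear_combination -hv

lemma arrange_productIndex (hd : 2 * δ - 1 ≤ d) (Y : ZMod d → ZMod d → ℂ) {u v : ZMod d}
    (h : |(v - u).valMinAbs| < (δ : ℤ)) :
    (arrange Y : ZMod d × Fin (2 * δ - 1) → ℂ) (productIndex v u) = Y u v := by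
  rcases exists_offset u v h with ⟨j, hj, rfl⟩ | ⟨j, hj, hj', rfl⟩
  · rw [productIndex_add_nonneg hd u hj]; simp [arrange, hj]
  · rw [productIndex_sub_pos hd u hj hj']
    simp only [arrange]
    rw [if_neg (by omega), show 2 * δ - 1 - (2 * δ - 1 - j) = j by omega]; simp

/-- Every vector arises from a banded matrix of products, so the double-sum formula for M' applies
to arbitrary vectors and not only to those of the form conj x_u x_v. -/
lemma arrange_apply_productIndex (hd : 2 * δ - 1 ≤ d) (y : ZMod d × Fin (2 * δ - 1) → ℂ) :
    arrange (fun u v => y (productIndex v u)) = y := by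
  ext ⟨p, j⟩
  simp only [arrange]
  split_ifs with hj
  · rw [productIndex_add_nonneg hd p hj]
  · have := j.2
    rw [productIndex_sub_pos hd (p + 1) (j := 2 * δ - 1 - j) (by omega) (by omega)]
    congr 2
    · simp
    · ext; simp only; omega

/-- In these coordinates M' is a sesquilinear sum over pairs of entries of one mask. Both the
identity with the squared magnitudes and the Hermitian symmetry can be read off from it. -/
lemma liftedMatrix_mulVec_arrange (hd : 2 * δ - 1 ≤ d) (Y : ZMod d → ZMod d → ℂ) (r : ZMod d)
    (i : Fin (2 * δ - 1)) :
    (liftedMatrix d δ *ᵥ arrange Y) (r, i) =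
      ∑ k ∈ Finset.range δ, ∑ k' ∈ Finset.range δ,
        mask δ (i + 1) (k + 1) * conj (mask δ (i + 1) (k' + 1)) *
          Y (r + (k : ℕ)) (r + (k' : ℕ)) := by
  have hδ := NeZero.pos δ
  rw [mulVec, dotProduct, Fintype.sum_prod_type]
  simp only [liftedMatrix, of_apply]
  have h := sum_zmod (fun k p => ∑ j : Fin (2 * δ - 1),
    liftedBlock δ (k + 1) (i + 1) (j + 1) * (arrange Y : _ → ℂ) (p, j)) r
  rw [h]
  have h2 : ∀ k : ℕ, ∑ j : Fin (2 * δ - 1),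
      liftedBlock δ (k + 1) (i + 1) (j + 1) * (arrange Y : _ → ℂ) (r + (k : ℕ), j) =
      ∑ j ∈ Finset.range (2 * δ - 1), if k + j < δ ∨ (2 * δ ≤ k + j + 2 ∧ k + 1 < δ) then
        (if k + j < δ then mask δ (i + 1) (k + 1) * conj (mask δ (i + 1) (k + j + 1)) *
            Y (r + (k : ℕ)) (r + ((k + j : ℕ) : ZMod d))
          else mask δ (i + 1) (k + 1 + 1) * conj (mask δ (i + 1) (k + j + 2 - 2 * δ + 1)) *
            Y (r + ((k + 1 : ℕ) : ZMod d)) (r + ((k + j + 2 - 2 * δ : ℕ) : ZMod d))) else 0 := by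
    intro k
    rw [← Fin.sum_univ_eq_sum_range (fun j =>
      if k + j < δ ∨ (2 * δ ≤ k + j + 2 ∧ k + 1 < δ) then
        (if k + j < δ then mask δ (i + 1) (k + 1) * conj (mask δ (i + 1) (k + j + 1)) *
            Y (r + (k : ℕ)) (r + ((k + j : ℕ) : ZMod d))
          else mask δ (i + 1) (k + 1 + 1) * conj (mask δ (i + 1) (k + j + 2 - 2 * δ + 1)) *
            Y (r + ((k + 1 : ℕ) : ZMod d)) (r + ((k + j + 2 - 2 * δ : ℕ) : ZMod d))) else 0)]
    refine Finset.sum_congr rfl fun j _ => ?_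
    have hj := j.2
    simp only [liftedBlock, arrange]
    by_cases h1 : k + (j : ℕ) < δ
    · rw [if_pos (by omega), if_pos (by omega), if_pos (Or.inl h1), if_pos h1,
        show (j : ℕ) + 1 + (k + 1) - 1 = k + j + 1 by omega]
      push_cast; rw [add_assoc r]
    · rw [if_neg (by omega)]
      by_cases h3 : 2 * δ ≤ k + (j : ℕ) + 2 ∧ k + 1 < δ
      · rw [if_pos (by omega), if_pos (Or.inr h3), if_neg h1, if_neg (by omega),
          show k + 1 + ((j : ℕ) + 1) + 1 - 2 * δ = k + j + 2 - 2 * δ + 1 by omega]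
        have e : r + (k : ZMod d) + 1 - ((2 * δ - 1 - (j : ℕ) : ℕ) : ZMod d) =
            r + ((k + j + 2 - 2 * δ : ℕ) : ZMod d) := by
          have : k + 1 = (2 * δ - 1 - (j : ℕ)) + (k + j + 2 - 2 * δ) := by omega
          have h4 : ((k + 1 : ℕ) : ZMod d) =
            (((2 * δ - 1 - (j : ℕ)) + (k + j + 2 - 2 * δ) : ℕ) : ZMod d) := by rw [← this]
          rw [Nat.cast_add, Nat.cast_add, Nat.cast_one] at h4
          linear_combination h4
        rw [e]; push_cast; rw [add_assoc r]
      · rw [if_neg (by omega), zero_mul, if_neg (by omega)]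
  simp only [h2]
  rw [← Finset.sum_product', ← Finset.sum_product', ← Finset.sum_filter]
  -- A nonzero pair of block number and position corresponds to one pair of mask indices:
  -- nonnegative offsets give (k, k + j), negative ones (k + 1, k + j + 2 - 2δ), whose second index
  -- is the smaller one.
  refine Finset.sum_nbij' (fun c => if c.1 + c.2 < δ then (c.1, c.1 + c.2)
      else (c.1 + 1, c.1 + c.2 + 2 - 2 * δ))
    (fun c => if c.1 ≤ c.2 then (c.1, c.2 - c.1) else (c.1 - 1, c.2 + 2 * δ - 1 - c.1)) ?_ ?_ ?_ ?_ ?_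
  · rintro ⟨k, j⟩ hc
    simp only [Finset.mem_filter, Finset.mem_product, Finset.mem_range] at hc ⊢
    split_ifs <;> simp only <;> omega
  · rintro ⟨k, j⟩ hc
    simp only [Finset.mem_filter, Finset.mem_product, Finset.mem_range] at hc ⊢
    split_ifs <;> simp only <;> omega
  · rintro ⟨k, j⟩ hc
    simp only [Finset.mem_filter, Finset.mem_product, Finset.mem_range] at hc
    by_cases h1 : k + j < δ
    · simp only [if_pos h1]
      rw [if_pos (by omega)]; ext <;> simp only; omega
    · simp only [if_neg h1]
      rw [if_neg (by omega)]; ext <;> simp only <;> omega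
  · rintro ⟨k, j⟩ hc
    simp only [Finset.mem_product, Finset.mem_range] at hc
    by_cases h1 : k ≤ j
    · simp only [if_pos h1]
      rw [if_pos (by omega)]; ext <;> simp only; omega
    · simp only [if_neg h1]
      rw [if_neg (by omega)]; ext <;> simp only <;> omega
  · rintro ⟨k, j⟩ hc
    dsimp only
    split_ifs with h1 <;> rfl

lemma measurementMatrix_mulVec (hd : 2 * δ - 1 ≤ d) (x : ZMod d → ℂ) (i : Fin (2 * δ - 1))
    (r : ZMod d) :
    (measurementMatrix d δ *ᵥ x) (i, r) =
      ∑ k ∈ Finset.range δ, conj (mask δ (i + 1) (k + 1)) * x (r + (k : ℕ)) := by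
  have hδ := NeZero.pos δ
  rw [mulVec, dotProduct]
  simp only [measurementMatrix, of_apply]
  rw [sum_zmod (fun k p => conj (mask δ (i + 1) (k + 1)) * x p) r]
  symm
  refine Finset.sum_subset (by intro a; simp; omega) fun k _ hk => ?_
  have hk' : ¬ (k + 1 ≤ δ) := by simp at hk; omega
  rw [mask, if_neg hk', map_zero, zero_mul]

/-- The lifted linear system for the squared magnitudes of the measurements. -/
lemma liftedMatrix_mulVec_products (hd : 2 * δ - 1 ≤ d) (x : ZMod d → ℂ) (r : ZMod d)
    (i : Fin (2 * δ - 1)) :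
    (liftedMatrix d δ *ᵥ arrange fun u v => conj (x u) * x v) (r, i) =
      ((‖(measurementMatrix d δ *ᵥ x) (i, r)‖ ^ 2 : ℝ) : ℂ) := by
  rw [liftedMatrix_mulVec_arrange hd]
  push_cast
  rw [← Complex.conj_mul', measurementMatrix_mulVec hd, map_sum, Finset.sum_mul_sum]
  refine Finset.sum_congr rfl fun k _ => Finset.sum_congr rfl fun k' _ => ?_
  rw [map_mul, Complex.conj_conj]; ring

/-- The conjugate transpose of the estimated products solves the same linear system, because the
data are real; the solution is unique. -/
lemma liftedEstimate_conj (hd : 2 * δ - 1 ≤ d) (b : Fin (2 * δ - 1) × ZMod d → ℝ) {u v : ZMod d}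
    (h : |(v - u).valMinAbs| < (δ : ℤ)) :
    liftedEstimate b (productIndex u v) = conj (liftedEstimate b (productIndex v u)) := by
  set y : ZMod d × Fin (2 * δ - 1) → ℂ := liftedEstimate b with hy
  have h1 : arrange (fun u v => conj (y (productIndex u v))) = y := by
    apply eq_liftedEstimate hd
    ext ⟨r, i⟩
    have h2 : conj ((liftedMatrix d δ *ᵥ y) (r, i)) = (liftedMatrix d δ *ᵥ y) (r, i) := by
      rw [hy, liftedMatrix_mulVec_liftedEstimate hd]; simp
    have h3 := congrFun (liftedMatrix_mulVec_liftedEstimate hd b) (r, i)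
    rw [← h3, ← hy, ← h2, liftedMatrix_mulVec_arrange hd]
    conv_rhs => rw [← arrange_apply_productIndex hd y]
    rw [liftedMatrix_mulVec_arrange hd, map_sum, Finset.sum_comm]
    simp only [map_sum]
    refine Finset.sum_congr rfl fun k _ => Finset.sum_congr rfl fun k' _ => ?_
    simp only [map_mul, Complex.conj_conj]; ring
  have h4 := arrange_productIndex hd (fun u v => conj (y (productIndex u v))) h
  rw [h1] at h4
  rw [h4, Complex.conj_conj]

/-- M' maps the error of the products to the permuted noise, and a single entry is bounded by the
Euclidean norm. -/
lemma norm_liftedEstimate_sub_le (hd : 2 * δ - 1 ≤ d) (x : EuclideanSpace ℂ (ZMod d))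
    (n : EuclideanSpace ℝ (Fin (2 * δ - 1) × ZMod d)) {u v : ZMod d}
    (h : |(v - u).valMinAbs| < (δ : ℤ)) :
    ‖liftedEstimate (measurements x n) (productIndex v u) - conj (x u) * x v‖ ≤
      inverseBound δ * ‖n‖ := by
  set y : ZMod d × Fin (2 * δ - 1) → ℂ := liftedEstimate (measurements x n) with hy
  set w : ZMod d × Fin (2 * δ - 1) → ℂ := arrange fun u v => conj (x u) * x v with hw
  have h1 : ∀ q, (liftedMatrix d δ *ᵥ (y - w)) q = ((n (q.2, q.1) : ℝ) : ℂ) := by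
    rintro ⟨r, i⟩
    rw [Matrix.mulVec_sub, Pi.sub_apply, hy, liftedMatrix_mulVec_liftedEstimate hd, hw,
      liftedMatrix_mulVec_products hd (fun j => x j)]
    simp only [measurements]; push_cast; ring
  have h2 := sum_norm_sq_le hd (y - w)
  simp only [h1] at h2
  have h3 : ∑ q : ZMod d × Fin (2 * δ - 1), ‖((n (q.2, q.1) : ℝ) : ℂ)‖ ^ 2 = ‖n‖ ^ 2 := by
    rw [EuclideanSpace.norm_sq_eq]
    refine Fintype.sum_equiv (Equiv.prodComm _ _) _ _ fun q => ?_
    simp [Complex.norm_real]; rfl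
  rw [h3, ← mul_pow] at h2
  have h4 := Finset.single_le_sum (f := fun q => ‖(y - w) q‖ ^ 2) (fun q _ => by positivity)
    (Finset.mem_univ (productIndex v u))
  have h5 := abs_le_of_sq_le_sq (h4.trans h2)
    (mul_nonneg (inverseBound_pos δ).le (norm_nonneg _))
  have h6 : w (productIndex v u) = conj (x u) * x v := arrange_productIndex hd _ h
  rw [← h6]
  exact (le_abs_self _).trans h5

end BlockPR
end

noncomputable section
open scoped ComplexConjugate
open Matrix
namespace BlockPR
variable {d δ : ℕ} [NeZero d] [NeZero δ]

/-! ### Greedy angular synchronization -/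

/-- Correcting the magnitude of z to that of w moves z by at most |z - w| once more. Nothing is
assumed about zeros; the chosen value of arg 0 does no harm. -/
lemma norm_mul_exp_arg_sub_le (z w : ℂ) :
    ‖(‖w‖ : ℂ) * Complex.exp (Complex.arg z * Complex.I) - w‖ ≤ 2 * ‖z - w‖ := by
  have h1 : (‖w‖ : ℂ) * Complex.exp (Complex.arg z * Complex.I) - w =
      ((‖w‖ - ‖z‖ : ℝ) : ℂ) * Complex.exp (Complex.arg z * Complex.I) + (z - w) := by
    push_cast
    linear_combination Complex.norm_mul_exp_arg_mul_I z
  rw [h1]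
  refine (norm_add_le _ _).trans ?_
  rw [norm_mul, Complex.norm_exp_ofReal_mul_I, Complex.norm_real, mul_one, Real.norm_eq_abs,
    abs_sub_comm]
  linarith [abs_norm_sub_norm_le z w]

/-- One transfer of the phase from j to q. The error e at the reference is rescaled by |x_q|/|x_j|,
and only the fresh error 2ε/|x_j| is added; both need x_j to be large, while x_q may be arbitrarily
small. -/
lemma phase_error_step {xj xq z s : ℂ} {ε e : ℝ} (hj : xj ≠ 0)
    (hz : ‖z - conj xj * xq‖ ≤ ε) (he : ‖xj - ‖xj‖ * s‖ ≤ e) :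
    ‖xq - ‖xq‖ * (s * Complex.exp (Complex.arg z * Complex.I))‖ ≤
      2 * ε / ‖xj‖ + ‖xq‖ * (e / ‖xj‖) := by
  set α := Complex.exp (Complex.arg z * Complex.I) with hα
  have hα1 : ‖α‖ = 1 := Complex.norm_exp_ofReal_mul_I _
  have hp : 0 < ‖xj‖ := norm_pos_iff.mpr hj
  have h1 := norm_mul_exp_arg_sub_le z (conj xj * xq)
  rw [← hα, norm_mul, RCLike.norm_conj] at h1
  -- This separates the inherited error at the reference from the error of the product used in the
  -- transfer.
  have h2 : (‖xj‖ : ℂ) ^ 2 * (xq - ‖xq‖ * (s * α)) =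
      (‖xj‖ * ‖xq‖ * α) * (xj - ‖xj‖ * s) - xj * ((‖xj‖ * ‖xq‖ : ℝ) * α - conj xj * xq) := by
    rw [← Complex.mul_conj']; push_cast
    have := Complex.mul_conj' xj
    linear_combination (-(‖xq‖ : ℂ) * s * α) * this
  have h3 : ‖xj‖ ^ 2 * ‖xq - ‖xq‖ * (s * α)‖ ≤ ‖xj‖ * ‖xq‖ * e + ‖xj‖ * (2 * ε) := by
    calc _ = ‖(‖xj‖ : ℂ) ^ 2 * (xq - ‖xq‖ * (s * α))‖ := by rw [norm_mul]; simp
      _ ≤ _ := by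
        rw [h2]
        refine (norm_sub_le _ _).trans (add_le_add ?_ ?_)
        · rw [norm_mul, norm_mul, norm_mul, hα1]
          simp only [Complex.norm_real, norm_norm, mul_one]
          exact mul_le_mul_of_nonneg_left he (by positivity)
        · rw [norm_mul]
          refine mul_le_mul_of_nonneg_left (h1.trans ?_) hp.le
          linarith
  have h4 : ‖xj‖ * ‖xq - ‖xq‖ * (s * α)‖ ≤ ‖xq‖ * e + 2 * ε := by
    have : ‖xj‖ * (‖xj‖ * ‖xq - ‖xq‖ * (s * α)‖) ≤ ‖xj‖ * (‖xq‖ * e + 2 * ε) := by nlinarith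
    exact le_of_mul_le_mul_left this hp
  rw [show 2 * ε / ‖xj‖ + ‖xq‖ * (e / ‖xj‖) = (‖xq‖ * e + 2 * ε) / ‖xj‖ by ring, le_div_iff₀ hp]
  linarith

/-- The two branches of the argument are matched so that no exception arises on the negative real
axis. -/
lemma half_arg_sub_argLower_conj (z : ℂ) :
    (1 / 2) * (Complex.arg z - argLower (conj z)) = Complex.arg z := by
  rw [argLower, Complex.conj_conj]; ring

lemma mem_window (hd : 2 * δ - 1 ≤ d) (u : ZMod d) {i : ℕ} (hi : i < δ) :
    |(u + (i : ZMod d) - u).valMinAbs| < (δ : ℤ) := by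
  rw [add_sub_cancel_left, ← Int.cast_natCast, valMinAbs_intCast hd (by omega) (by omega), abs_lt]
  omega

lemma zero_mem_window (u : ZMod d) : |(u - u).valMinAbs| < (δ : ℤ) := by
  have := NeZero.pos δ
  simpa using this

lemma abs_valMinAbs_sub_comm (u v : ZMod d) : |(u - v).valMinAbs| = |(v - u).valMinAbs| := by
  rw [← neg_sub v u, Int.abs_eq_natAbs, Int.abs_eq_natAbs, ZMod.natAbs_valMinAbs_neg]

lemma exists_flag_of_unfinished {s : SyncState d} (h : s.Unfinished δ) :
    ∃ i : ℕ, 0 < i ∧ i < δ ∧ 0 < s.flag (s.ref + (i : ZMod d)) := by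
  by_contra hc
  push Not at hc
  have : ∑ i ∈ Finset.Ioo 0 δ, s.flag (s.ref + (i : ZMod d)) = 0 :=
    Finset.sum_eq_zero fun i hi => by
      rw [Finset.mem_Ioo] at hi
      have := hc i hi.1 hi.2
      omega
  rw [SyncState.Unfinished, this] at h
  exact lt_irrefl _ h

lemma flag_eq_zero_of_not_unfinished {s : SyncState d} (h : ¬ s.Unfinished δ) {i : ℕ} (h0 : 0 < i)
    (h1 : i < δ) : s.flag (s.ref + (i : ZMod d)) = 0 := by
  rw [SyncState.Unfinished, not_lt, Nat.le_zero, Finset.sum_eq_zero_iff] at h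
  exact h i (Finset.mem_Ioo.mpr ⟨h0, h1⟩)

/-- The number of unmarked entries is the measure that bounds the number of passes, both for the
error and for the program. -/
lemma sum_flag_advance_lt (hd : 2 * δ - 1 ≤ d) (y : ZMod d × Fin (2 * δ - 1) → ℂ)
    {s : SyncState d} (h : s.Unfinished δ) (i : ℕ) :
    ∑ q, (s.advance y i).flag q < ∑ q, s.flag q := by
  obtain ⟨i', h0, h1, h2⟩ := exists_flag_of_unfinished h
  refine Finset.sum_lt_sum (fun q _ => ?_) ⟨s.ref + (i' : ZMod d), Finset.mem_univ _, ?_⟩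
  · simp only [SyncState.advance]; split_ifs <;> simp
  · simp only [SyncState.advance]
    rw [if_pos (mem_window hd _ h1)]
    exact h2

/-- The loop invariant of the greedy angular synchronization: marked entries have phases that are
correct up to the global phase `θ`. -/
structure PhaseInvariant (δ : ℕ) (x : EuclideanSpace ℂ (ZMod d)) (θ ε m : ℝ)
    (s : SyncState d) : Prop where
  flag_le : ∀ q, s.flag q ≤ 1
  flag_ref : s.flag s.ref = 0
  succ_mem : ∀ q, s.flag q = 0 →
    s.flag (q + 1) = 0 ∨ ∃ i : ℕ, 0 < i ∧ i < δ ∧ q + 1 = s.ref + (i : ZMod d)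
  le_norm_ref : m ≤ ‖x s.ref‖
  phase_error : ∃ T : ℕ, T + ∑ q, s.flag q ≤ d ∧ ∀ q, s.flag q = 0 →
    ‖x q - ‖x q‖ * Complex.exp (Complex.I * ((θ + s.phase q : ℝ) : ℂ))‖ ≤
      ‖x q‖ * (T * (2 * ε / m ^ 2)) + 2 * ε / m

/-- T counts the passes made so far, and its sum with the number of unmarked entries stays at most
d. The bound for the phases is split into a part proportional to |x_q|, which grows with T, and a
constant part, which does not: dividing by |x_j| ≥ m at the next transfer turns the constant part
into one more unit of the first. -/
lemma PhaseInvariant.advance (hd : 2 * δ - 1 ≤ d) {x : EuclideanSpace ℂ (ZMod d)} {θ ε m : ℝ}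
    (hm : 0 < m) (hε : 0 ≤ ε) {y : ZMod d × Fin (2 * δ - 1) → ℂ}
    (hy : ∀ u v : ZMod d, |(v - u).valMinAbs| < (δ : ℤ) →
      ‖y (productIndex v u) - conj (x u) * x v‖ ≤ ε)
    (hconj : ∀ u v : ZMod d, |(v - u).valMinAbs| < (δ : ℤ) →
      y (productIndex u v) = conj (y (productIndex v u)))
    {s : SyncState d} (hs : PhaseInvariant δ x θ ε m s) (hu : s.Unfinished δ) {i : ℕ}
    (hi : 0 < i) (hi' : i < δ) (hlarge : m ≤ ‖x (s.ref + (i : ZMod d))‖) :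
    PhaseInvariant δ x θ ε m (s.advance y i) := by
  have hwin : ∀ q, (s.advance y i).flag q =
      if |(q - s.ref).valMinAbs| < (δ : ℤ) then 0 else s.flag q := fun q => rfl
  refine ⟨?_, ?_, ?_, hlarge, ?_⟩
  · intro q; rw [hwin]; split_ifs
    · exact zero_le_one
    · exact hs.flag_le q
  · rw [hwin]; exact if_pos (mem_window hd _ hi')
  · intro q hq
    rw [hwin] at hq
    split_ifs at hq with hq'
    · rcases exists_offset s.ref q hq' with ⟨j, hj, rfl⟩ | ⟨j, hj, hj', rfl⟩
      · rcases lt_or_ge (j + 1) δ with hj1 | hj1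
        · left
          rw [hwin, add_assoc, ← Nat.cast_succ]
          exact if_pos (mem_window hd _ hj1)
        · right
          -- The one unmarked successor at the right edge of the window is at distance δ from the
          -- old reference, hence at distance δ - i from the new one, which is again in front of it.
          refine ⟨δ - i, by omega, by omega, ?_⟩
          have h1 : j + 1 = i + (δ - i) := by omega
          have h2 : ((j + 1 : ℕ) : ZMod d) = ((i + (δ - i) : ℕ) : ZMod d) := by rw [h1]
          push_cast [Nat.cast_sub hi'.le] at h2
          simp only [SyncState.advance]
          rw [Nat.cast_sub hi'.le, add_assoc, h2]; ring
      · left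
        rw [hwin]
        apply if_pos
        have h1 : s.ref - (j : ZMod d) + 1 - s.ref = ((-(j : ℤ) + 1 : ℤ) : ZMod d) := by
          push_cast; ring
        rw [h1, valMinAbs_intCast hd (by omega) (by omega), abs_lt]
        omega
    · left
      rw [hwin]
      rcases hs.succ_mem q hq with h | ⟨j, hj, hj', h⟩
      · rw [h]; simp
      · rw [h]; exact if_pos (mem_window hd _ hj')
  · obtain ⟨T, hT, hph⟩ := hs.phase_error
    refine ⟨T + 1, by have := sum_flag_advance_lt hd y hu i; omega, ?_⟩
    have hη : 0 ≤ 2 * ε / m ^ 2 := by positivity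
    intro q hq
    by_cases hold : s.flag q = 0
    · have h1 : (s.advance y i).phase q = s.phase q := by
        simp only [SyncState.advance]
        rw [if_neg (by rw [hold]; simp)]
      rw [h1]
      refine (hph q hold).trans ?_
      have : ‖x q‖ * (T * (2 * ε / m ^ 2)) ≤ ‖x q‖ * ((T + 1 : ℕ) * (2 * ε / m ^ 2)) := by
        push_cast; nlinarith [norm_nonneg (x q), mul_nonneg (norm_nonneg (x q)) hη]
      linarith
    · have hq' : |(q - s.ref).valMinAbs| < (δ : ℤ) := by
        rw [hwin] at hq; by_contra hc; rw [if_neg hc] at hq; exact hold hq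
      have hflag : s.flag q = 1 := by have := hs.flag_le q; omega
      have h1 : (s.advance y i).phase q =
          s.phase s.ref + Complex.arg (y (productIndex q s.ref)) := by
        simp only [SyncState.advance]
        rw [if_pos ⟨hq', hflag⟩, hconj s.ref q hq', half_arg_sub_argLower_conj]
      rw [h1]
      have hr := hs.le_norm_ref
      have hrp : 0 < ‖x s.ref‖ := hm.trans_le hr
      have h2 := phase_error_step (norm_pos_iff.mp hrp) (hy s.ref q hq') (hph s.ref hs.flag_ref)
      have h3 : Complex.exp (Complex.I * ((θ + (s.phase s.ref +
          Complex.arg (y (productIndex q s.ref))) : ℝ) : ℂ)) =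
          Complex.exp (Complex.I * ((θ + s.phase s.ref : ℝ) : ℂ)) *
            Complex.exp (Complex.arg (y (productIndex q s.ref)) * Complex.I) := by
        rw [← Complex.exp_add]; congr 1; push_cast; ring
      rw [h3]
      refine h2.trans ?_
      have h4 : 2 * ε / ‖x s.ref‖ ≤ 2 * ε / m := by gcongr
      -- The relative error at the reference: T units of 2ε/m², and (2ε/m)/|x_j| is at most one
      -- more.
      have h5 : (‖x s.ref‖ * (T * (2 * ε / m ^ 2)) + 2 * ε / m) / ‖x s.ref‖ ≤
          (T + 1 : ℕ) * (2 * ε / m ^ 2) := by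
        rw [add_div, mul_div_cancel_left₀ _ hrp.ne']
        have : 2 * ε / m / ‖x s.ref‖ ≤ 2 * ε / m / m := by gcongr
        have h6 : 2 * ε / m / m = 2 * ε / m ^ 2 := by field_simp
        push_cast
        linarith
      have h7 := mul_le_mul_of_nonneg_left h5 (norm_nonneg (x q))
      linarith

lemma PhaseInvariant.of_syncLoop (hd : 2 * δ - 1 ≤ d) {x : EuclideanSpace ℂ (ZMod d)} {θ ε m : ℝ}
    (hm : 0 < m) (hε : 0 ≤ ε) {y : ZMod d × Fin (2 * δ - 1) → ℂ}
    (hy : ∀ u v : ZMod d, |(v - u).valMinAbs| < (δ : ℤ) →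
      ‖y (productIndex v u) - conj (x u) * x v‖ ≤ ε)
    (hconj : ∀ u v : ZMod d, |(v - u).valMinAbs| < (δ : ℤ) →
      y (productIndex u v) = conj (y (productIndex v u)))
    (hlarge : ∀ (u : ZMod d) (i : ℕ), 0 < i → i < δ → (∀ i' : ℕ, 0 < i' → i' < δ →
      ‖y (productIndex (u + (i' : ZMod d)) (u + (i' : ZMod d)))‖ ≤
        ‖y (productIndex (u + (i : ZMod d)) (u + (i : ZMod d)))‖) → m ≤ ‖x (u + (i : ZMod d))‖)
    {s s' : SyncState d} (h : SyncLoop y s s') (hs : PhaseInvariant δ x θ ε m s) :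
    PhaseInvariant δ x θ ε m s' ∧ ¬ s'.Unfinished δ := by
  induction h with
  | done s h => exact ⟨hs, h⟩
  | step s s' i hu hi hi' hmax _ ih =>
    exact ih (hs.advance hd hm hε hy hconj hu hi hi' (hlarge _ i hi hi' hmax))

/-- The loop condition inspects only the entries in front of the reference. A marked entry can have
an unmarked successor only there, so on exit marks propagate around the whole cycle. -/
lemma PhaseInvariant.flag_eq_zero {x : EuclideanSpace ℂ (ZMod d)} {θ ε m : ℝ} {s : SyncState d}
    (hs : PhaseInvariant δ x θ ε m s) (hu : ¬ s.Unfinished δ) (q : ZMod d) : s.flag q = 0 := by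
  have h : ∀ k : ℕ, s.flag (s.ref + (k : ZMod d)) = 0 := by
    intro k
    induction k with
    | zero => simpa using hs.flag_ref
    | succ k ih =>
      rw [Nat.cast_succ, ← add_assoc]
      rcases hs.succ_mem _ ih with h | ⟨i, hi, hi', h⟩
      · exact h
      · rw [h]; exact flag_eq_zero_of_not_unfinished hu hi hi'
  have := h (q - s.ref).val
  rwa [ZMod.natCast_zmod_val, add_sub_cancel] at this

/-! ### Error bounds for flat vectors -/

/-- The block following the one that contains u + 1 lies entirely within the next δ - 1 entries
after u, since two blocks have at most 2(m + 1) ≤ δ - 1 entries. -/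
lemma IsFlat.exists_large {x : EuclideanSpace ℂ (ZMod d)} (hδ : 3 ≤ δ)
    (h : IsFlat ((δ - 3) / 2) x) (u : ZMod d) :
    ∃ i : ℕ, 0 < i ∧ i < δ ∧ ‖x‖ / (2 * √(d : ℝ)) ≤ ‖x (u + (i : ZMod d))‖ := by
  obtain ⟨-, -, N, c, -, hcN, hstep, hblock⟩ := h
  set m := (δ - 3) / 2 with hm
  -- The position of u + 1 within the period that starts at c 0. The first block boundary beyond it
  -- ends the block containing it.
  set u0 := c 0 + (u + 1 - (c 0 : ZMod d)).val with hu0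
  have hu0' : ((u0 : ℕ) : ZMod d) = u + 1 := by
    rw [hu0]; push_cast; rw [ZMod.natCast_zmod_val]; ring
  have hlt : u0 < c N := by rw [hcN, hu0]; have := ZMod.val_lt (u + 1 - (c 0 : ZMod d)); omega
  have hex : ∃ t, u0 < c t := ⟨N, hlt⟩
  classical
  obtain ⟨t, ht⟩ : ∃ t, Nat.find hex = t + 1 := by
    refine Nat.exists_eq_succ_of_ne_zero fun h0 => ?_
    have := Nat.find_spec hex
    rw [h0] at this; omega
  have h1 : u0 < c (t + 1) := ht ▸ Nat.find_spec hex
  have h2 : ¬ u0 < c t := Nat.find_min hex (by omega)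
  have h3 : t + 1 ≤ N := ht ▸ Nat.find_min' hex hlt
  have key : ∀ p : ℕ, u0 < p → p < u0 + 2 * m + 2 → ‖x‖ / (2 * √(d : ℝ)) ≤ ‖x (p : ZMod d)‖ →
      ∃ i : ℕ, 0 < i ∧ i < δ ∧ ‖x‖ / (2 * √(d : ℝ)) ≤ ‖x (u + (i : ZMod d))‖ := by
    intro p hp hp' hx
    refine ⟨p - u0 + 1, by omega, by omega, ?_⟩
    have : u + ((p - u0 + 1 : ℕ) : ZMod d) = p := by
      rw [Nat.cast_add, Nat.cast_sub hp.le, hu0']; push_cast; ring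
    rwa [this]
  have h4 := hstep t (by omega)
  rcases Nat.lt_or_ge (t + 1) N with h5 | h5
  · obtain ⟨p, hp, hp', hx⟩ := hblock (t + 1) h5
    have h6 := hstep (t + 1) h5
    exact key p (by omega) (by omega) hx
  -- After the last block comes block 0 of the next period, hence the position p + d.
  · have hN : t + 1 = N := by omega
    obtain ⟨p, hp, hp', hx⟩ := hblock 0 (by omega)
    have h6 := hstep 0 (by omega)
    rw [hN, hcN] at h1 h4
    refine key (p + d) (by omega) (by simp only [zero_add] at *; omega) ?_
    simpa using hx

/-- Since A - t² = (√A - t)(√A + t) and |√A - t| ≤ √A + t. The error of the magnitudes is thus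
controlled without a lower bound for t. -/
lemma sq_sqrt_sub_le {A t : ℝ} (hA : 0 ≤ A) (ht : 0 ≤ t) : |√A - t| ^ 2 ≤ |A - t ^ 2| := by
  have h : A - t ^ 2 = (√A - t) * (√A + t) := by
    have := Real.sq_sqrt hA; linear_combination -this
  rw [h, abs_mul, sq]
  refine mul_le_mul_of_nonneg_left ?_ (abs_nonneg _)
  have := Real.sqrt_nonneg A
  rw [abs_le, abs_of_nonneg (by linarith : 0 ≤ √A + t)]
  constructor <;> linarith

lemma exists_phase (z : ℂ) : ∃ θ ∈ Set.Icc (0 : ℝ) (2 * Real.pi),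
    z = ‖z‖ * Complex.exp (Complex.I * (θ : ℂ)) := by
  have hz := (Complex.norm_mul_exp_arg_mul_I z).symm
  have h1 := Complex.neg_pi_lt_arg z
  have h2 := Complex.arg_le_pi z
  rcases le_or_gt 0 (Complex.arg z) with h | h
  · exact ⟨Complex.arg z, ⟨h, by linarith⟩, by rw [mul_comm Complex.I]; exact hz⟩
  · refine ⟨Complex.arg z + 2 * Real.pi, ⟨by linarith, by linarith⟩, ?_⟩
    push_cast
    rw [mul_add, Complex.exp_add, mul_comm Complex.I (2 * _), Complex.exp_two_pi_mul_I, mul_one,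
      mul_comm Complex.I]
    exact hz


lemma inverseBound_le (hδ : 2 ≤ δ) : inverseBound δ ≤ 8 * Real.exp 3 * ((δ : ℝ) - 1) := by
  have h : damping δ ≤ 4 * ((δ : ℝ) - 1) := by
    have : (2 : ℝ) ≤ δ := by exact_mod_cast hδ
    exact max_le (by linarith) (by linarith)
  rw [inverseBound]
  nlinarith [Real.exp_pos 3]

/-- The error of greedy angular synchronization from perturbed products. -/
lemma sum_error_le (hd : 2 * δ - 1 ≤ d) (hδ : 3 ≤ δ) {x x' : EuclideanSpace ℂ (ZMod d)} {ε : ℝ}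
    (hε : 0 ≤ ε) (hx : 0 < ‖x‖) (hflat : IsFlat ((δ - 3) / 2) x)
    {b : Fin (2 * δ - 1) × ZMod d → ℝ}
    (hy : ∀ u v : ZMod d, |(v - u).valMinAbs| < (δ : ℤ) →
      ‖liftedEstimate b (productIndex v u) - conj (x u) * x v‖ ≤ ε)
    (hsmall : 16 * (d : ℝ) ^ 2 * ε ≤ ‖x‖ ^ 2) (hout : IsOutput b x') :
    ∃ θ ∈ Set.Icc (0 : ℝ) (2 * Real.pi),
      ‖x - Complex.exp (Complex.I * (θ : ℂ)) • x'‖ ^ 2 ≤ 900 * (d : ℝ) ^ 2 * ε := by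
  obtain ⟨a, s, ha, hloop, hx'⟩ := hout
  set y : ZMod d × Fin (2 * δ - 1) → ℂ := liftedEstimate b with hydef
  have hd1 : (1 : ℝ) ≤ d := by exact_mod_cast NeZero.one_le
  have hd0 : (0 : ℝ) < d := by linarith
  have hdiag : ∀ u : ZMod d, |‖y (productIndex u u)‖ - ‖x u‖ ^ 2| ≤ ε := by
    intro u
    have h := hy u u (zero_mem_window u)
    rw [Complex.conj_mul'] at h
    have h2 := (abs_norm_sub_norm_le _ _).trans h
    rwa [norm_pow, Complex.norm_real, norm_norm] at h2
  -- The flatness threshold squared is 2m². Comparing estimated instead of true squared magnitudes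
  -- loses up to 2ε ≤ m², so a greedy choice still has squared magnitude at least m².
  set m : ℝ := ‖x‖ / √(8 * d) with hm
  have hm0 : 0 < m := by positivity
  have hm2 : m ^ 2 = ‖x‖ ^ 2 / (8 * d) := by
    rw [hm, div_pow, Real.sq_sqrt (by positivity)]
  have hεm : 2 * ε ≤ m ^ 2 := by
    rw [hm2, le_div_iff₀ (by positivity)]
    have : (d : ℝ) * ε ≤ d ^ 2 * ε := by nlinarith [mul_nonneg hd0.le hε]
    linarith
  have hlarge : ∀ u v : ZMod d, ‖x‖ / (2 * √(d : ℝ)) ≤ ‖x v‖ →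
      ‖y (productIndex v v)‖ ≤ ‖y (productIndex u u)‖ → m ≤ ‖x u‖ := by
    intro u v h1 h2
    have h3 := pow_le_pow_left₀ (by positivity) h1 2
    rw [div_pow, mul_pow, Real.sq_sqrt hd0.le] at h3
    have h4 : ‖x‖ ^ 2 / (2 ^ 2 * d) = 2 * m ^ 2 := by rw [hm2]; field_simp; norm_num
    rw [h4] at h3
    have h5 := abs_le.mp (hdiag u)
    have h6 := abs_le.mp (hdiag v)
    exact le_of_sq_le_sq (by linarith [h5.1, h5.2, h6.1, h6.2]) (norm_nonneg _)
  -- The starting entry gets the phase 0, so the global phase is that of x a, and the phase error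
  -- there vanishes.
  obtain ⟨θ, hθ, hxa⟩ := exists_phase (x a)
  obtain ⟨hinv, hu⟩ := PhaseInvariant.of_syncLoop (x := x) (θ := θ) (ε := ε) hd hm0 hε hy
    (fun u v h => liftedEstimate_conj hd b h)
    (by
      intro u i _ _ hmax
      obtain ⟨i', h0, h1, h2⟩ := hflat.exists_large hδ u
      exact hlarge _ _ h2 (hmax i' h0 h1)) hloop
    { flag_le := fun q => by simp only [SyncState.init]; split_ifs <;> simp
      flag_ref := by simp [SyncState.init]
      succ_mem := by
        intro q hq
        have : q = a := by
          by_contra hc; simp [SyncState.init, hc] at hq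
        subst this
        right
        exact ⟨1, one_pos, by omega, by simp [SyncState.init]⟩
      le_norm_ref := by
        obtain ⟨i', h0, h1, h2⟩ := hflat.exists_large hδ a
        exact hlarge _ _ h2 (ha _)
      phase_error := by
        refine ⟨0, ?_, ?_⟩
        · calc 0 + ∑ q, (SyncState.init a).flag q ≤ ∑ q : ZMod d, 1 := by
                rw [zero_add]
                exact Finset.sum_le_sum fun q _ => by simp only [SyncState.init]; split_ifs <;> simp
            _ = d := by simp [ZMod.card]
        · intro q hq
          have : q = a := by
            by_contra hc; simp [SyncState.init, hc] at hq
          subst this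
          simp only [SyncState.init, add_zero]
          rw [← hxa, sub_self, norm_zero]
          positivity }
  obtain ⟨T, hT, hph⟩ := hinv.phase_error
  refine ⟨θ, hθ, ?_⟩
  set η := 2 * ε / m ^ 2 with hη
  have hη0 : 0 ≤ η := by positivity
  have hTd : (T : ℝ) ≤ d := by exact_mod_cast (by omega : T ≤ d)
  -- Three contributions, combined by (U + V + P)² ≤ 3(U² + V² + P²): the error of the magnitude and
  -- the two parts of the phase error, with T replaced by d.
  have hterm : ∀ q, ‖(x - Complex.exp (Complex.I * (θ : ℂ)) • x') q‖ ^ 2 ≤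
      3 * (ε + ‖x q‖ ^ 2 * (d * η) ^ 2 + (2 * ε / m) ^ 2) := by
    intro q
    set A := ‖y (productIndex q q)‖ with hA
    have h1 := hph q (hinv.flag_eq_zero hu q)
    set e := Complex.exp (Complex.I * ((θ + s.phase q : ℝ) : ℂ)) with he
    have he1 : ‖e‖ = 1 := by rw [he, mul_comm]; exact Complex.norm_exp_ofReal_mul_I _
    have h2 : (x - Complex.exp (Complex.I * (θ : ℂ)) • x') q =
        (x q - ‖x q‖ * e) - ((√A - ‖x q‖ : ℝ) : ℂ) * e := by
      rw [PiLp.sub_apply, PiLp.smul_apply, hx' q, smul_eq_mul, he]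
      push_cast
      rw [mul_add, Complex.exp_add]; ring
    have h3 : ‖((√A - ‖x q‖ : ℝ) : ℂ) * e‖ ^ 2 ≤ ε := by
      rw [norm_mul, he1, mul_one, Complex.norm_real, Real.norm_eq_abs]
      exact (sq_sqrt_sub_le (norm_nonneg _) (norm_nonneg _)).trans (hdiag q)
    have h4 : ‖x q - ‖x q‖ * e‖ ≤ ‖x q‖ * (d * η) + 2 * ε / m := by
      refine h1.trans (add_le_add ?_ le_rfl)
      gcongr
    rw [h2]
    have h5 := norm_sub_le (x q - ‖x q‖ * e) (((√A - ‖x q‖ : ℝ) : ℂ) * e)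
    set P := ‖((√A - ‖x q‖ : ℝ) : ℂ) * e‖
    set U := ‖x q‖ * (d * η) with hU
    set V := 2 * ε / m
    have h6 : ‖(x q - ‖x q‖ * e) - ((√A - ‖x q‖ : ℝ) : ℂ) * e‖ ≤ U + V + P := by linarith
    have h7 := pow_le_pow_left₀ (norm_nonneg _) h6 2
    rw [← mul_pow, ← hU]
    nlinarith [sq_nonneg (U - V), sq_nonneg (U - P), sq_nonneg (V - P)]
  rw [EuclideanSpace.norm_sq_eq]
  refine (Finset.sum_le_sum fun q _ => hterm q).trans ?_
  rw [← Finset.mul_sum, Finset.sum_add_distrib, Finset.sum_add_distrib, ← Finset.sum_mul,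
    ← EuclideanSpace.norm_sq_eq]
  simp only [Finset.sum_const, Finset.card_univ, ZMod.card, nsmul_eq_mul]
  have hX : 0 < ‖x‖ ^ 2 := by positivity
  have hρ : (d : ℝ) ^ 2 * ε / ‖x‖ ^ 2 ≤ 1 / 16 := by
    rw [div_le_iff₀ hX]; linarith
  -- The phase errors are quadratic in ε; one factor is absorbed by d²ε/‖x‖² ≤ 1/16. In total 3(1 +
  -- 16 + 2)d²ε remains, so the constant 900 is generous.
  have e1 : ‖x‖ ^ 2 * (d * η) ^ 2 = 256 * d ^ 2 * ε * ((d : ℝ) ^ 2 * ε / ‖x‖ ^ 2) := by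
    rw [hη, hm2]; field_simp; ring
  have e2 : (d : ℝ) * (2 * ε / m) ^ 2 = 32 * ε * ((d : ℝ) ^ 2 * ε / ‖x‖ ^ 2) := by
    rw [div_pow, hm2]; field_simp; ring
  rw [e1, e2]
  have h8 : 256 * (d : ℝ) ^ 2 * ε * ((d : ℝ) ^ 2 * ε / ‖x‖ ^ 2) ≤ 256 * d ^ 2 * ε * (1 / 16) :=
    mul_le_mul_of_nonneg_left hρ (by positivity)
  have h9 : 32 * ε * ((d : ℝ) ^ 2 * ε / ‖x‖ ^ 2) ≤ 32 * ε * (1 / 16) :=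
    mul_le_mul_of_nonneg_left hρ (by positivity)
  have h10 : (d : ℝ) * ε ≤ d ^ 2 * ε := by nlinarith [mul_nonneg hd0.le hε]
  have h11 : ε ≤ d ^ 2 * ε := by nlinarith [mul_nonneg hd0.le hε]
  nlinarith

/-- Stable recovery of flat vectors, up to a global phase. -/
theorem recovery_error (hd : 2 * δ - 1 ≤ d) (x : EuclideanSpace ℂ (ZMod d))
    (n : EuclideanSpace ℝ (Fin (2 * δ - 1) × ZMod d)) (hflat : IsFlat ((δ - 3) / 2) x)
    (hn : 128 * Real.exp 3 * ((δ : ℝ) - 1) * (d : ℝ) ^ 2 * ‖n‖ ≤ ‖x‖ ^ 2)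
    (x' : EuclideanSpace ℂ (ZMod d)) (hout : IsOutput (measurements x n) x') :
    ∃ θ ∈ Set.Icc (0 : ℝ) (2 * Real.pi),
      IsMinOn (fun t : ℝ => ‖x - Complex.exp (Complex.I * (t : ℂ)) • x'‖ ^ 2)
        (Set.Icc 0 (2 * Real.pi)) θ ∧
      ‖x - Complex.exp (Complex.I * (θ : ℂ)) • x'‖ ^ 2 ≤
        7200 * Real.exp 3 * (d : ℝ) ^ 2 * ((δ : ℝ) - 1) * ‖n‖ := by
  have hδ : 5 ≤ δ := by have := hflat.1; omega
  have hδ1 : (0 : ℝ) < (δ : ℝ) - 1 := by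
    have : (5 : ℝ) ≤ δ := by exact_mod_cast hδ
    linarith
  have hd0 : (0 : ℝ) < d := by exact_mod_cast NeZero.pos d
  have hB := inverseBound_le (δ := δ) (by omega)
  have hex : ∃ θ ∈ Set.Icc (0 : ℝ) (2 * Real.pi),
      ‖x - Complex.exp (Complex.I * (θ : ℂ)) • x'‖ ^ 2 ≤
        900 * (d : ℝ) ^ 2 * (inverseBound δ * ‖n‖) := by
    -- For x = 0 the noise condition forces n = 0; the estimated products on the diagonal are then
    -- exactly 0, and so is every output.
    rcases (norm_nonneg x).eq_or_lt with h0 | h0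
    · have hn0 : ‖n‖ = 0 := by
        rw [← h0] at hn
        have : 0 < 128 * Real.exp 3 * ((δ : ℝ) - 1) * (d : ℝ) ^ 2 := by positivity
        nlinarith [norm_nonneg n]
      refine ⟨0, ⟨le_rfl, by positivity⟩, ?_⟩
      obtain ⟨a, s, -, -, hx'⟩ := hout
      have hx0 : x = 0 := norm_eq_zero.mp h0.symm
      have : x' = 0 := by
        ext j
        have h := norm_liftedEstimate_sub_le hd x n (zero_mem_window (δ := δ) j)
        rw [hn0, mul_zero] at h
        have h2 := norm_le_zero_iff.mp h
        rw [sub_eq_zero, hx0] at h2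
        rw [hx' j, hx0, h2]; simp
      rw [hx0, this, hn0]; simp
    · refine sum_error_le hd (by omega) (mul_nonneg (inverseBound_pos δ).le (norm_nonneg _)) h0
        hflat (fun u v h => norm_liftedEstimate_sub_le hd x n h) (le_trans ?_ hn) hout
      have : inverseBound δ * ‖n‖ ≤ 8 * Real.exp 3 * ((δ : ℝ) - 1) * ‖n‖ :=
        mul_le_mul_of_nonneg_right hB (norm_nonneg _)
      calc 16 * (d : ℝ) ^ 2 * (inverseBound δ * ‖n‖)
          ≤ 16 * (d : ℝ) ^ 2 * (8 * Real.exp 3 * ((δ : ℝ) - 1) * ‖n‖) := by gcongr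
        _ = _ := by ring
  -- The angle found need not be optimal; the minimum exists by compactness and is no larger.
  obtain ⟨θ₀, hθ₀, hle⟩ := hex
  obtain ⟨θ, hθ, hmin⟩ := isCompact_Icc.exists_isMinOn (s := Set.Icc (0 : ℝ) (2 * Real.pi))
    ⟨θ₀, hθ₀⟩ (f := fun t : ℝ => ‖x - Complex.exp (Complex.I * (t : ℂ)) • x'‖ ^ 2)
    (by fun_prop)
  refine ⟨θ, hθ, hmin, (hmin hθ₀).trans (hle.trans ?_)⟩
  calc 900 * (d : ℝ) ^ 2 * (inverseBound δ * ‖n‖)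
      ≤ 900 * (d : ℝ) ^ 2 * (8 * Real.exp 3 * ((δ : ℝ) - 1) * ‖n‖) := by gcongr
    _ = _ := by ring

end BlockPR
end

noncomputable section
open scoped ComplexConjugate
open Matrix
namespace BlockPR

/-! ### Reasoning about programs -/

instance : Coe IndexExpr NumExpr := ⟨NumExpr.ofIndex⟩
instance : Add IndexExpr := ⟨IndexExpr.add⟩
instance : Sub IndexExpr := ⟨IndexExpr.sub⟩
instance : Mul IndexExpr := ⟨IndexExpr.mul⟩
instance : Div IndexExpr := ⟨IndexExpr.div⟩
instance : Mod IndexExpr := ⟨IndexExpr.mod⟩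
instance (n : ℕ) : OfNat IndexExpr n := ⟨IndexExpr.lit n⟩
instance : Add NumExpr := ⟨NumExpr.add⟩
instance : Sub NumExpr := ⟨NumExpr.sub⟩
instance : Mul NumExpr := ⟨NumExpr.mul⟩
instance : Div NumExpr := ⟨NumExpr.div⟩
instance (n : ℕ) : OfNat NumExpr n := ⟨NumExpr.ofIndex (IndexExpr.lit n)⟩

infixr:60 " ;; " => Program.seq

section eval
variable (σ : Store)

@[simp] lemma IndexExpr.eval_lit (n : ℕ) : (IndexExpr.lit n).eval σ = n := rfl
@[simp] lemma IndexExpr.eval_ofNat (n : ℕ) :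
    IndexExpr.eval σ (ofNat(n) : IndexExpr) = n := rfl
@[simp] lemma IndexExpr.eval_var (v : ℕ) : (IndexExpr.var v).eval σ = σ.reg v := rfl
@[simp] lemma IndexExpr.eval_add (e f : IndexExpr) : (e + f).eval σ = e.eval σ + f.eval σ := rfl
@[simp] lemma IndexExpr.eval_sub (e f : IndexExpr) : (e - f).eval σ = e.eval σ - f.eval σ := rfl
@[simp] lemma IndexExpr.eval_mul (e f : IndexExpr) : (e * f).eval σ = e.eval σ * f.eval σ := rfl
@[simp] lemma IndexExpr.eval_div (e f : IndexExpr) : (e / f).eval σ = e.eval σ / f.eval σ := rfl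
@[simp] lemma IndexExpr.eval_mod (e f : IndexExpr) : (e % f).eval σ = e.eval σ % f.eval σ := rfl
@[simp] lemma NumExpr.eval_ofNat (n : ℕ) :
    NumExpr.eval σ (ofNat(n) : NumExpr) = (n : ℂ) := rfl
@[simp] lemma NumExpr.eval_ofIndex (e : IndexExpr) :
    (NumExpr.ofIndex e).eval σ = (e.eval σ : ℂ) := rfl
@[simp] lemma NumExpr.eval_pi : NumExpr.pi.eval σ = (Real.pi : ℂ) := rfl
@[simp] lemma NumExpr.eval_I : NumExpr.I.eval σ = Complex.I := rfl
@[simp] lemma NumExpr.eval_read (r : ℕ) (e : IndexExpr) :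
    (NumExpr.read r e).eval σ = σ.mem r (e.eval σ) := rfl
@[simp] lemma NumExpr.eval_add (e f : NumExpr) : (e + f).eval σ = e.eval σ + f.eval σ := rfl
@[simp] lemma NumExpr.eval_sub (e f : NumExpr) : (e - f).eval σ = e.eval σ - f.eval σ := rfl
@[simp] lemma NumExpr.eval_mul (e f : NumExpr) : (e * f).eval σ = e.eval σ * f.eval σ := rfl
@[simp] lemma NumExpr.eval_div (e f : NumExpr) : (e / f).eval σ = e.eval σ / f.eval σ := rfl
@[simp] lemma NumExpr.eval_cconj (e : NumExpr) : e.cconj.eval σ = conj (e.eval σ) := rfl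
@[simp] lemma NumExpr.eval_abs (e : NumExpr) : e.abs.eval σ = (‖e.eval σ‖ : ℂ) := rfl
@[simp] lemma NumExpr.eval_arg (e : NumExpr) : e.arg.eval σ = (Complex.arg (e.eval σ) : ℂ) := rfl
@[simp] lemma NumExpr.eval_sqrt (e : NumExpr) :
    e.sqrt.eval σ = ((√(e.eval σ).re : ℝ) : ℂ) := rfl
@[simp] lemma NumExpr.eval_exp (e : NumExpr) : e.exp.eval σ = Complex.exp (e.eval σ) := rfl

@[simp] lemma Store.reg_setReg (v n w : ℕ) :
    (σ.setReg v n).reg w = if w = v then n else σ.reg w := by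
  simp [Store.setReg, Function.update_apply]
@[simp] lemma Store.mem_setReg (v n : ℕ) : (σ.setReg v n).mem = σ.mem := rfl
@[simp] lemma Store.reg_setMem (r t : ℕ) (z : ℂ) : (σ.setMem r t z).reg = σ.reg := rfl
@[simp] lemma Store.mem_setMem (r t : ℕ) (z : ℂ) (r' t' : ℕ) :
    (σ.setMem r t z).mem r' t' = if r' = r ∧ t' = t then z else σ.mem r' t' := by
  by_cases h : r' = r
  · subst h; simp [Store.setMem, Function.update_apply]
  · simp [Store.setMem, h]

end eval

/-- The final store of a program. -/
def Program.exec (p : Program) (σ : Store) : Store := (p.run σ).1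

lemma exec_setIndex (σ : Store) (v : ℕ) (e : IndexExpr) :
    (Program.setIndex v e).exec σ = σ.setReg v (e.eval σ) := rfl

lemma exec_write (σ : Store) (r : ℕ) (e : IndexExpr) (u : NumExpr) :
    (Program.write r e u).exec σ = σ.setMem r (e.eval σ) (u.eval σ) := rfl

lemma exec_seq (σ : Store) (p q : Program) : (p ;; q).exec σ = q.exec (p.exec σ) := rfl

lemma exec_skip (σ : Store) : Program.skip.exec σ = σ := rfl

lemma exec_ite_pos {σ : Store} {t : Test} (h : t.Holds σ) (p q : Program) :
    (Program.ite t p q).exec σ = p.exec σ := by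
  simp [Program.exec, Program.run, h]

lemma exec_ite_neg {σ : Store} {t : Test} (h : ¬ t.Holds σ) (p q : Program) :
    (Program.ite t p q).exec σ = q.exec σ := by
  simp [Program.exec, Program.run, h]

/-- The registers that a program assigns to. -/
def Program.regs : Program → List ℕ
  | skip => []
  | setIndex v _ => [v]
  | write _ _ _ => []
  | seq p q => p.regs ++ q.regs
  | ite _ p q => p.regs ++ q.regs
  | loop v _ p => v :: p.regs

/-- The arrays that a program writes to. -/
def Program.arrs : Program → List ℕ
  | skip => []
  | setIndex _ _ => []
  | write r _ _ => [r]
  | seq p q => p.arrs ++ q.arrs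
  | ite _ p q => p.arrs ++ q.arrs
  | loop _ _ p => p.arrs

/-- Two stores agree outside the given registers and arrays. -/
structure AgreeOff (W A : List ℕ) (σ τ : Store) : Prop where
  reg : ∀ v, v ∉ W → τ.reg v = σ.reg v
  mem : ∀ r, r ∉ A → τ.mem r = σ.mem r

lemma AgreeOff.refl (W A : List ℕ) (σ : Store) : AgreeOff W A σ σ :=
  ⟨fun _ _ => rfl, fun _ _ => rfl⟩

lemma AgreeOff.trans {W A W' A' W'' A'' : List ℕ} {σ τ υ : Store} (h : AgreeOff W A σ τ)
    (h' : AgreeOff W' A' τ υ) (hW : W ⊆ W'') (hA : A ⊆ A'') (hW' : W' ⊆ W'') (hA' : A' ⊆ A'') :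
    AgreeOff W'' A'' σ υ :=
  ⟨fun v hv => (h'.reg v fun hc => hv (hW' hc)).trans (h.reg v fun hc => hv (hW hc)),
    fun r hr => (h'.mem r fun hc => hr (hA' hc)).trans (h.mem r fun hc => hr (hA hc))⟩

lemma agreeOff_setReg (σ : Store) (v n : ℕ) (A : List ℕ) : AgreeOff [v] A σ (σ.setReg v n) :=
  ⟨fun w hw => by simp at hw; simp [hw], fun _ _ => rfl⟩

lemma exec_loop_induction {σ : Store} {v : ℕ} {e : IndexExpr} {p : Program}
    (I : ℕ → Store → Prop) (h0 : I 0 σ)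
    (hstep : ∀ n < e.eval σ, ∀ τ, I n τ → I (n + 1) (p.exec (τ.setReg v n))) :
    I (e.eval σ) ((Program.loop v e p).exec σ) := by
  have h : ∀ N ≤ e.eval σ, I N (iterate (fun n τ => p.run (τ.setReg v n)) σ N).1 := by
    intro N hN
    induction N with
    | zero => exact h0
    | succ N ih => exact hstep N hN _ (ih (by omega))
  exact h _ le_rfl

/-- The frame property: the footprint of a program is a list computed from its syntax, so that for
concrete programs preservation of a register or array is decidable. -/
lemma exec_agreeOff (p : Program) (σ : Store) : AgreeOff p.regs p.arrs σ (p.exec σ) := by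
  induction p generalizing σ with
  | skip => exact AgreeOff.refl _ _ _
  | setIndex v e => exact agreeOff_setReg _ _ _ _
  | write r e u =>
    refine ⟨fun _ _ => rfl, fun r' hr' => ?_⟩
    ext t
    simp only [Program.arrs, List.mem_singleton] at hr'
    simp [exec_write, hr']
  | seq p q hp hq =>
    exact (hp σ).trans (hq _) (by simp [Program.regs]) (by simp [Program.arrs])
      (by simp [Program.regs]) (by simp [Program.arrs])
  | ite t p q hp hq =>
    by_cases h : t.Holds σ
    · rw [exec_ite_pos h]
      exact (AgreeOff.refl [] [] σ).trans (hp σ) (by simp) (by simp) (by simp [Program.regs])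
        (by simp [Program.arrs])
    · rw [exec_ite_neg h]
      exact (AgreeOff.refl [] [] σ).trans (hq σ) (by simp) (by simp) (by simp [Program.regs])
        (by simp [Program.arrs])
  | loop v e p hp =>
    refine exec_loop_induction (fun _ τ => AgreeOff (v :: p.regs) p.arrs σ τ)
      (AgreeOff.refl _ _ _) fun n _ τ hτ => ?_
    exact hτ.trans ((agreeOff_setReg τ v n []).trans (hp _) (W'' := v :: p.regs) (A'' := p.arrs)
      (by simp) (by simp) (by simp) (by simp)) (by simp) (by simp) (by simp) (by simp)

/-- The induction rule for loops, in which everything that the loop does not modify is known. -/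
lemma exec_loop_rule {σ : Store} {v : ℕ} {e : IndexExpr} {p : Program} {N : ℕ}
    (hN : e.eval σ = N) (I : ℕ → Store → Prop) (h0 : I 0 σ)
    (hstep : ∀ n < N, ∀ τ, AgreeOff (v :: p.regs) p.arrs σ τ → I n τ →
      I (n + 1) (p.exec (τ.setReg v n))) :
    I N ((Program.loop v e p).exec σ) := by
  subst hN
  refine (exec_loop_induction (fun n τ => AgreeOff (v :: p.regs) p.arrs σ τ ∧ I n τ)
    ⟨AgreeOff.refl _ _ _, h0⟩ fun n hn τ hτ => ⟨?_, hstep n hn τ hτ.1 hτ.2⟩).2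
  exact hτ.1.trans ((agreeOff_setReg τ v n []).trans (exec_agreeOff p _) (W'' := v :: p.regs)
    (A'' := p.arrs) (by simp) (by simp) (by simp) (by simp)) (by simp) (by simp) (by simp) (by simp)

/-- A loop that writes each time to a different cell of one array. -/
lemma exec_loop_scatter {σ : Store} {v r : ℕ} {e g : IndexExpr} {u : NumExpr} {N : ℕ}
    (hN : e.eval σ = N) (a : ℕ → ℕ) (f : ℕ → ℂ)
    (hinj : ∀ m < N, ∀ n < N, a m = a n → m = n)
    (hstep : ∀ n < N, ∀ τ, AgreeOff [v] [r] σ τ → τ.mem r (a n) = σ.mem r (a n) → τ.reg v = n →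
      g.eval τ = a n ∧ u.eval τ = f n) :
    (∀ n < N, ((Program.loop v e (.write r g u)).exec σ).mem r (a n) = f n) ∧
      ∀ t, (∀ n < N, a n ≠ t) →
        ((Program.loop v e (.write r g u)).exec σ).mem r t = σ.mem r t := by
  have h := exec_loop_rule (v := v) (p := .write r g u) hN
    (fun n τ => (∀ m < n, τ.mem r (a m) = f m) ∧
      ∀ t, (∀ m < n, a m ≠ t) → τ.mem r t = σ.mem r t)
    ⟨fun m hm => absurd hm (by omega), fun t _ => rfl⟩ (fun n hn τ hτ hI => by
      have hmem : (τ.setReg v n).mem r (a n) = σ.mem r (a n) :=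
        hI.2 (a n) fun m hm hc => by have := hinj m (by omega) n hn hc; omega
      obtain ⟨h1, h2⟩ := hstep n hn (τ.setReg v n)
        (AgreeOff.trans (W := [v]) (A := [r]) hτ (agreeOff_setReg τ v n [])
          (fun _ h => h) (fun _ h => h) (by simp) (by simp)) hmem (by simp)
      rw [exec_write, h1, h2]
      constructor
      · intro m hm
        rw [Store.mem_setMem]
        by_cases hmn : m = n
        · subst hmn; simp
        · rw [if_neg (fun hc => hmn (hinj m (by omega) n hn hc.2)), Store.mem_setReg]
          exact hI.1 m (by omega)
      · intro t ht
        rw [Store.mem_setMem, if_neg (fun hc => ht n (by omega) hc.2.symm), Store.mem_setReg]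
        exact hI.2 t fun m hm => ht m (by omega))
  exact h

/-- A loop that writes to the cells of one array in turn. -/
lemma exec_loop_fill {σ : Store} {v r : ℕ} {e : IndexExpr} {u : NumExpr} {N : ℕ}
    (hN : e.eval σ = N) (f : ℕ → ℂ)
    (hstep : ∀ n < N, ∀ τ, AgreeOff [v] [r] σ τ → τ.mem r n = σ.mem r n → τ.reg v = n →
      u.eval τ = f n) :
    (∀ n < N, ((Program.loop v e (.write r (.var v) u)).exec σ).mem r n = f n) ∧
      ∀ t, N ≤ t → ((Program.loop v e (.write r (.var v) u)).exec σ).mem r t = σ.mem r t := by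
  obtain ⟨h1, h2⟩ := exec_loop_scatter (g := .var v) (u := u) hN id f (fun _ _ _ _ h => h)
    (fun n hn τ hτ hm hv => ⟨hv, hstep n hn τ hτ hm hv⟩)
  exact ⟨h1, fun t ht => h2 t fun n hn hc => by simp at hc; omega⟩

/-! ### The fast Fourier transform -/

/-- The partial transforms: entry `(r, k)` after the stages that build up the length `h`. -/
def partialDft (x : ℕ → ℂ) (g h r k : ℕ) : ℂ :=
  ∑ t ∈ Finset.range h, x (r + g * t) * conj (char h t k)

lemma char_mod (n a b : ℕ) : char n a (b % n) = char n a b := by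
  rcases Nat.eq_zero_or_pos n with rfl | hn
  · simp
  have hn' : (n : ℂ) ≠ 0 := by exact_mod_cast hn.ne'
  unfold char
  rw [Complex.exp_eq_exp_iff_exists_int]
  refine ⟨-(a * (b / n : ℕ) : ℕ), ?_⟩
  have h : (b : ℂ) = (b % n : ℕ) + n * (b / n : ℕ) := by exact_mod_cast (Nat.mod_add_div b n).symm
  generalize b % n = e at *
  generalize b / n = f at *
  rw [h]; push_cast; field_simp; ring

lemma sum_range_two_mul (f : ℕ → ℂ) (h : ℕ) :
    ∑ t ∈ Finset.range (2 * h), f t = ∑ u ∈ Finset.range h, (f (2 * u) + f (2 * u + 1)) := by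
  induction h with
  | zero => simp
  | succ h ih =>
    rw [show 2 * (h + 1) = 2 * h + 1 + 1 by ring, Finset.sum_range_succ, Finset.sum_range_succ, ih,
      Finset.sum_range_succ]
    ring

/-- Decimation in time: even and odd terms of a progression of step g are progressions of step 2g,
starting at r and r + g. -/
lemma partialDft_two_mul (x : ℕ → ℂ) (g h r k : ℕ) :
    partialDft x g (2 * h) r k = partialDft x (2 * g) h r (k % h) +
      conj (char (2 * h) 1 k) * partialDft x (2 * g) h (r + g) (k % h) := by
  unfold partialDft
  rw [sum_range_two_mul, Finset.sum_add_distrib, Finset.mul_sum]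
  have h1 : ∀ u, char (2 * h) (2 * u) k = char h u k := by
    intro u; unfold char; congr 1; push_cast
    rw [show (2 : ℂ) * Real.pi * Complex.I * (2 * u) * k = 2 * (2 * Real.pi * Complex.I * u * k) by
      ring, mul_div_mul_left _ _ two_ne_zero]
  have h2 : ∀ u, char (2 * h) (2 * u + 1) k = char (2 * h) (2 * u) k * char (2 * h) 1 k := by
    intro u; unfold char; rw [← Complex.exp_add]; congr 1; push_cast; ring
  congr 1 <;> refine Finset.sum_congr rfl fun u _ => ?_
  · rw [char_mod, h1]; ring_nf
  · rw [char_mod, h2, h1, map_mul, show r + g * (2 * u + 1) = r + g + 2 * g * u by ring]; ring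

/-- One stage of the transform: from array `3` to array `4`. -/
def fftStage : Program :=
  .loop 9 (.var 3) (.write 4 (.var 9)
    (.read 3 (.var 9 / (2 * .var 7) * .var 7 + .var 9 % (2 * .var 7) % .var 7) +
      .exp (0 - .pi * .I * ((.var 9 % (2 * .var 7) : IndexExpr) : NumExpr) /
        ((.var 7 : IndexExpr) : NumExpr)) *
      .read 3 ((.var 9 / (2 * .var 7) + .var 3 / (2 * .var 7)) * .var 7 +
        .var 9 % (2 * .var 7) % .var 7)))

/-- The discrete Fourier transform, in place, of the first cells of the array `3`. Their number,
a power of two, is in the register `3`, and its logarithm is in the register `4`. -/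
def fft : Program :=
  .setIndex 7 1 ;; .loop 8 (.var 4) (fftStage ;;
    .loop 9 (.var 3) (.write 3 (.var 9) (.read 4 (.var 9))) ;; .setIndex 7 (2 * .var 7))

/-- A stage merges the rows r and r + g, among 2g rows of length h, into the row r of length 2h.
Since it writes into another array, the output comes in natural order without bit reversal. -/
lemma fftStage_spec {σ : Store} {h g : ℕ} (hh : 0 < h) (h7 : σ.reg 7 = h)
    (h3 : σ.reg 3 = 2 * g * h) (x : ℕ → ℂ)
    (hx : ∀ r < 2 * g, ∀ k < h, σ.mem 3 (r * h + k) = partialDft x (2 * g) h r k) :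
    ∀ r < g, ∀ k < 2 * h,
      (fftStage.exec σ).mem 4 (r * (2 * h) + k) = partialDft x g (2 * h) r k := by
  have key := (exec_loop_fill (σ := σ) (v := 9) (r := 4) (e := .var 3) (N := 2 * g * h)
    (u := .read 3 (.var 9 / (2 * .var 7) * .var 7 + .var 9 % (2 * .var 7) % .var 7) +
      .exp (0 - .pi * .I * ((.var 9 % (2 * .var 7) : IndexExpr) : NumExpr) /
        ((.var 7 : IndexExpr) : NumExpr)) *
      .read 3 ((.var 9 / (2 * .var 7) + .var 3 / (2 * .var 7)) * .var 7 +
        .var 9 % (2 * .var 7) % .var 7)) h3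
    (fun i => partialDft x g (2 * h) (i / (2 * h)) (i % (2 * h))) (by
      intro n hn τ hτ _ hv
      have e7 : τ.reg 7 = h := by rw [hτ.reg 7 (by decide), h7]
      have e3 : τ.reg 3 = 2 * g * h := by rw [hτ.reg 3 (by decide), h3]
      have em : τ.mem 3 = σ.mem 3 := hτ.mem 3 (by decide)
      have hr : n / (2 * h) < g := by
        rw [Nat.div_lt_iff_lt_mul (by omega)]; linarith
      have hg : 2 * g * h / (2 * h) = g := by
        rw [show 2 * g * h = g * (2 * h) by ring]; exact Nat.mul_div_cancel _ (by omega)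
      have hk : n % (2 * h) % h < h := Nat.mod_lt _ hh
      simp only [NumExpr.eval_add, NumExpr.eval_mul, NumExpr.eval_read, NumExpr.eval_exp,
        NumExpr.eval_sub, NumExpr.eval_div, NumExpr.eval_ofNat, NumExpr.eval_pi, NumExpr.eval_I,
        NumExpr.eval_ofIndex, IndexExpr.eval_add, IndexExpr.eval_mul, IndexExpr.eval_div,
        IndexExpr.eval_mod, IndexExpr.eval_var, IndexExpr.eval_ofNat, e7, e3, em, hv, hg]
      rw [partialDft_two_mul, hx _ (by omega) _ hk, hx _ (by omega) _ hk, conj_char]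
      have hh' : (h : ℂ) ≠ 0 := by exact_mod_cast hh.ne'
      congr 3
      push_cast
      field_simp
      ring)).1
  intro r hr k hk
  have h1 : r * (2 * h) + k < 2 * g * h := by nlinarith
  have := key _ h1
  rw [fftStage, this]
  congr 1
  · rw [mul_comm, Nat.mul_add_div (by omega), Nat.div_eq_of_lt hk, add_zero]
  · rw [mul_comm, Nat.mul_add_mod, Nat.mod_eq_of_lt hk]

lemma fft_spec {σ : Store} {m : ℕ} (h3 : σ.reg 3 = 2 ^ m) (h4 : σ.reg 4 = m) (x : ℕ → ℂ)
    (hx : ∀ t < 2 ^ m, σ.mem 3 t = x t) :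
    ∀ k < 2 ^ m, (fft.exec σ).mem 3 k = ∑ t ∈ Finset.range (2 ^ m), x t * conj (char (2 ^ m) t k) := by
  rw [fft, exec_seq, exec_setIndex, IndexExpr.eval_ofNat]
  have key := exec_loop_rule (σ := σ.setReg 7 1) (v := 8) (e := .var 4) (N := m)
    (p := fftStage ;; .loop 9 (.var 3) (.write 3 (.var 9) (.read 4 (.var 9))) ;;
      .setIndex 7 (2 * .var 7)) (by simp [h4])
    -- After s stages there are 2^(m-s) rows of length 2^s; at s = 0 the rows of length one are the
    -- data themselves.
    (fun s τ => τ.reg 7 = 2 ^ s ∧ ∀ r < 2 ^ (m - s), ∀ k < 2 ^ s,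
      τ.mem 3 (r * 2 ^ s + k) = partialDft x (2 ^ (m - s)) (2 ^ s) r k)
    (by
      refine ⟨by simp, fun r hr k hk => ?_⟩
      have hk0 : k = 0 := by simpa using hk
      subst hk0
      simp only [Nat.sub_zero] at hr
      simp [partialDft, char, hx r hr])
    (by
      intro s hs τ hτ ⟨e7, hI⟩
      have hms : m - s = (m - (s + 1)) + 1 := by omega
      set τ' := τ.setReg 8 s with hτ'
      have e3 : τ'.reg 3 = 2 * 2 ^ (m - (s + 1)) * 2 ^ s := by
        have : τ.reg 3 = 2 ^ m := by rw [hτ.reg 3 (by decide)]; simp [h3]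
        simp only [hτ', Store.reg_setReg]
        rw [if_neg (by decide), this, ← pow_succ', ← pow_add]
        congr 1; omega
      have e7' : τ'.reg 7 = 2 ^ s := by simp [hτ', e7]
      have h1 := fftStage_spec (σ := τ') (h := 2 ^ s) (g := 2 ^ (m - (s + 1))) (by positivity) e7'
        e3 x (by
          intro r hr k hk
          rw [hms, pow_succ', ] at hI
          exact hI r hr k hk)
      have h2 := exec_agreeOff fftStage τ'
      rw [exec_seq, exec_seq, exec_setIndex]
      set τ₁ := fftStage.exec τ' with hτ₁
      have e3₁ : τ₁.reg 3 = 2 * 2 ^ (m - (s + 1)) * 2 ^ s := by rw [h2.reg 3 (by decide), e3]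
      have h3' := (exec_loop_fill (σ := τ₁) (v := 9) (r := 3) (e := .var 3)
        (u := .read 4 (.var 9)) e3₁ (fun i => τ₁.mem 4 i) (by
          intro n _ υ hυ _ hv
          simp [hv, hυ.mem 4 (by decide)])).1
      have h4' := exec_agreeOff (.loop 9 (.var 3) (.write 3 (.var 9) (.read 4 (.var 9)))) τ₁
      refine ⟨?_, fun r hr k hk => ?_⟩
      · have : τ₁.reg 7 = 2 ^ s := by rw [h2.reg 7 (by decide), e7']
        simp only [Store.reg_setReg, if_true, IndexExpr.eval_mul, IndexExpr.eval_ofNat,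
          IndexExpr.eval_var]
        rw [h4'.reg 7 (by decide), this, pow_succ']
      · rw [Store.mem_setReg, h3', pow_succ' 2 s]
        · exact h1 r hr k (by rwa [pow_succ'] at hk)
        · rw [pow_succ'] at hk ⊢
          nlinarith)
  intro k hk
  have := key.2 0 (by simp) k hk
  simp only [Nat.sub_self, pow_zero, zero_mul, zero_add] at this
  rw [this, partialDft]
  simp

end BlockPR
end

noncomputable section
open scoped ComplexConjugate
open Matrix
namespace BlockPR

/-! ### Transforms of arbitrary length -/

/-- The chirp `exp (πi n² / N)`. -/
def chirp (N n : ℕ) : ℂ := Complex.exp (Real.pi * Complex.I * ((n * n : ℕ) : ℂ) / N)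

lemma chirp_eq_ofReal (N n : ℕ) :
    chirp N n = Complex.exp ((Real.pi * (n * n : ℕ) / N : ℝ) * Complex.I) := by
  unfold chirp; congr 1; push_cast; ring

lemma chirp_mul_conj_self (N n : ℕ) : chirp N n * conj (chirp N n) = 1 := by
  rw [Complex.mul_conj', chirp_eq_ofReal, Complex.norm_exp_ofReal_mul_I]; simp

lemma chirp_add (N m n : ℕ) : chirp N (m + n) = chirp N m * chirp N n * char N m n := by
  unfold chirp char; rw [← Complex.exp_add, ← Complex.exp_add]; congr 1; push_cast; ring

/-- By 2nj = (n + j)² - n² - j² a transform of arbitrary length N is a correlation with a chirp,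
computed by transforms of length P. The outer transform is again the forward one: together with the
conjugated inner factor it selects m = n + j. -/
lemma bluestein {N P : ℕ} (hP : 2 * N ≤ P) (b : ℕ → ℂ) {j : ℕ} (hj : j < N) :
    conj (chirp N j) * (∑ f ∈ Finset.range P,
      ((∑ n ∈ Finset.range P, (if n < N then b n * conj (chirp N n) else 0) *
          conj (char P n f)) *
        ∑ m ∈ Finset.range P, chirp N m * char P m f) * conj (char P f j)) / P =
      ∑ i ∈ Finset.range N, char N j i * b i := by
  have hP0 : (P : ℂ) ≠ 0 := by exact_mod_cast (by omega : P ≠ 0)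
  have h1 : ∀ n f, char P n f * char P f j = char P f (n + j) := by
    intro n f; rw [char_comm P n f]; unfold char; rw [← Complex.exp_add]
    congr 1; push_cast; ring
  have h2 : ∑ f ∈ Finset.range P,
      ((∑ n ∈ Finset.range P, (if n < N then b n * conj (chirp N n) else 0) *
          conj (char P n f)) *
        ∑ m ∈ Finset.range P, chirp N m * char P m f) * conj (char P f j) =
      ∑ n ∈ Finset.range P, (if n < N then P * (b n * conj (chirp N n) * chirp N (n + j))
        else 0) := by
    simp only [Finset.sum_mul_sum]
    simp only [Finset.sum_mul]
    rw [Finset.sum_comm]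
    refine Finset.sum_congr rfl fun n hn => ?_
    split_ifs with hnN
    · rw [Finset.sum_comm]
      have h3 : ∀ m ∈ Finset.range P, ∑ f ∈ Finset.range P,
          b n * conj (chirp N n) * conj (char P n f) * (chirp N m * char P m f) *
            conj (char P f j) =
          if m = n + j then P * (b n * conj (chirp N n) * chirp N (n + j)) else 0 := by
        intro m hm
        -- Here n + j < 2N ≤ P, so the cyclic correlation does not wrap around.
        have h4 := sum_char_mul_conj (n := P) (j := m) (k := n + j) (Finset.mem_range.mp hm)
          (by omega)
        calc _ = b n * conj (chirp N n) * chirp N m *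
              ∑ f ∈ Finset.range P, char P f m * conj (char P f (n + j)) := by
              rw [Finset.mul_sum]
              refine Finset.sum_congr rfl fun f _ => ?_
              rw [← h1, map_mul, char_comm P m f]; ring
          _ = _ := by
              rw [h4]; split_ifs with h5
              · rw [h5]; ring
              · rw [mul_zero]
      rw [Finset.sum_congr rfl h3, Finset.sum_ite_eq',
        if_pos (Finset.mem_range.mpr (by omega))]
    · simp
  rw [h2, ← Finset.sum_filter]
  have h3 : (Finset.range P).filter (fun n => n < N) = Finset.range N := by
    ext n; simp; omega
  rw [h3, mul_div_assoc, Finset.sum_div, Finset.mul_sum]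
  refine Finset.sum_congr rfl fun n _ => ?_
  rw [chirp_add, mul_div_cancel_left₀ _ hP0, char_comm N n j]
  have e1 := chirp_mul_conj_self N j
  have e2 := chirp_mul_conj_self N n
  linear_combination (b n * char N j n) * (e1 + chirp N j * conj (chirp N j) * e2)

/-- The chirp as an expression; the length `N` is in the register `2`. -/
def chirpExpr (e : IndexExpr) : NumExpr :=
  .exp (.pi * .I * ((e * e : IndexExpr) : NumExpr) / ((.var 2 : IndexExpr) : NumExpr))

lemma eval_chirpExpr (σ : Store) (e : IndexExpr) :
    (chirpExpr e).eval σ = chirp (σ.reg 2) (e.eval σ) := rfl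

/-- Computes the transform of the chirp into the array `5`. -/
def prepareChirp : Program :=
  .loop 9 (.var 3) (.write 3 (.var 9) (.cconj (chirpExpr (.var 9)))) ;;
  fft ;;
  .loop 9 (.var 3) (.write 5 (.var 9) (.cconj (.read 3 (.var 9))))

/-- Loads the column with the number in the register `10` of the array `0` for the transform. -/
def loadColumn : Program :=
  .loop 9 (.var 3) (.write 3 (.var 9) 0) ;;
  .loop 9 (.var 2) (.write 3 (.var 9)
    (.read 0 (.var 9 * .var 0 + .var 10) * .cconj (chirpExpr (.var 9))))

/-- Multiplies by the transform of the chirp. -/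
def multiplyChirp : Program :=
  .loop 9 (.var 3) (.write 3 (.var 9) (.read 3 (.var 9) * .read 5 (.var 9)))

/-- Stores the transform of a column into the array `6`. -/
def storeColumn : Program :=
  .loop 9 (.var 2) (.write 6 (.var 9 * .var 0 + .var 10)
    (.cconj (chirpExpr (.var 9)) * .read 3 (.var 9) / ((.var 3 : IndexExpr) : NumExpr) /
      .sqrt ((.var 2 : IndexExpr) : NumExpr)))

/-- The transform of one column. -/
def transformColumn : Program :=
  loadColumn ;; fft ;; multiplyChirp ;; fft ;; storeColumn

/-- The inverse discrete Fourier transforms of all columns of the array `0`. -/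
def transformColumns : Program :=
  prepareChirp ;; .loop 10 (.var 0) transformColumn

/-- Conjugating before and after lets the forward transform produce the transform with the opposite
sign. It is computed once and shared by all columns. -/
lemma prepareChirp_spec {σ : Store} {m : ℕ} (h3 : σ.reg 3 = 2 ^ m) (h4 : σ.reg 4 = m) :
    ∀ f < 2 ^ m, (prepareChirp.exec σ).mem 5 f =
      ∑ n ∈ Finset.range (2 ^ m), chirp (σ.reg 2) n * char (2 ^ m) n f := by
  rw [prepareChirp, exec_seq, exec_seq]
  set p := Program.loop 9 (.var 3) (.write 3 (.var 9) (.cconj (chirpExpr (.var 9)))) with hp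
  have h1 := (exec_loop_fill (σ := σ) (v := 9) (r := 3) (e := .var 3)
    (u := .cconj (chirpExpr (.var 9))) h3 (fun n => conj (chirp (σ.reg 2) n)) (by
      intro n _ τ hτ _ hv
      simp [eval_chirpExpr, hv, hτ.reg 2 (by decide)])).1
  rw [← hp] at h1
  have hF := exec_agreeOff p σ
  set τ := p.exec σ
  have h2 := fft_spec (σ := τ) (by rw [hF.reg 3 (by decide), h3])
    (by rw [hF.reg 4 (by decide), h4]) _ h1
  have hF2 := exec_agreeOff fft τ
  set υ := fft.exec τ
  have h5 := (exec_loop_fill (σ := υ) (v := 9) (r := 5) (e := .var 3) (N := 2 ^ m)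
    (u := .cconj (.read 3 (.var 9)))
    (by simp [hF2.reg 3 (by decide), hF.reg 3 (by decide), h3])
    (fun n => conj (υ.mem 3 n)) (by
      intro n _ τ hτ _ hv
      simp [hv, hτ.mem 3 (by decide)])).1
  intro f hf
  rw [h5 f hf, h2 f hf, map_sum]
  simp

lemma loadColumn_spec {σ : Store} {m : ℕ} (h3 : σ.reg 3 = 2 ^ m) :
    ∀ n < 2 ^ m, (loadColumn.exec σ).mem 3 n = if n < σ.reg 2 then
      σ.mem 0 (n * σ.reg 0 + σ.reg 10) * conj (chirp (σ.reg 2) n) else 0 := by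
  rw [loadColumn, exec_seq]
  set p := Program.loop 9 (.var 3) (.write 3 (.var 9) 0) with hp
  have h1 := (exec_loop_fill (σ := σ) (v := 9) (r := 3) (e := .var 3)
    (u := 0) h3 (fun n => 0) (by intro n _ τ hτ _ hv; simp)).1
  rw [← hp] at h1
  have hF := exec_agreeOff p σ
  set τ := p.exec σ
  have h2 := exec_loop_fill (σ := τ) (v := 9) (r := 3) (e := .var 2) (N := σ.reg 2)
    (u := .read 0 (.var 9 * .var 0 + .var 10) * .cconj (chirpExpr (.var 9)))
    (by simp [hF.reg 2 (by decide)])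
    (fun n => σ.mem 0 (n * σ.reg 0 + σ.reg 10) * conj (chirp (σ.reg 2) n)) (by
      intro n _ υ hυ _ hv
      simp [eval_chirpExpr, hv, hυ.reg 2 (by decide), hF.reg 2 (by decide),
        hυ.reg 0 (by decide), hF.reg 0 (by decide), hυ.reg 10 (by decide), hF.reg 10 (by decide),
        hυ.mem 0 (by decide), hF.mem 0 (by decide)])
  intro n hn
  split_ifs with h
  · exact h2.1 n h
  · rw [h2.2 n (by omega)]; exact h1 n hn

lemma transformColumn_spec {σ : Store} {m : ℕ} (h3 : σ.reg 3 = 2 ^ m) (h4 : σ.reg 4 = m)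
    (hm : 2 * σ.reg 2 ≤ 2 ^ m) (h10 : σ.reg 10 < σ.reg 0)
    (h5 : ∀ f < 2 ^ m, σ.mem 5 f =
      ∑ n ∈ Finset.range (2 ^ m), chirp (σ.reg 2) n * char (2 ^ m) n f) :
    (∀ j < σ.reg 2, (transformColumn.exec σ).mem 6 (j * σ.reg 0 + σ.reg 10) =
      ((1 / √(σ.reg 2 : ℝ) : ℝ) : ℂ) * ∑ i ∈ Finset.range (σ.reg 2),
        char (σ.reg 2) j i * σ.mem 0 (i * σ.reg 0 + σ.reg 10)) ∧
    ∀ t, (∀ j < σ.reg 2, j * σ.reg 0 + σ.reg 10 ≠ t) →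
      (transformColumn.exec σ).mem 6 t = σ.mem 6 t := by
  rw [transformColumn, exec_seq, exec_seq, exec_seq, exec_seq]
  have e1 := loadColumn_spec h3
  have f1 := exec_agreeOff loadColumn σ
  set σ₁ := loadColumn.exec σ
  have e2 := fft_spec (σ := σ₁) (by rw [f1.reg 3 (by decide), h3])
    (by rw [f1.reg 4 (by decide), h4]) _ e1
  have f2 := f1.trans (exec_agreeOff fft σ₁) (W'' := [7, 8, 9]) (A'' := [3, 4])
    (by decide) (by decide) (by decide) (by decide)
  set σ₂ := fft.exec σ₁
  have e3 := (exec_loop_fill (σ := σ₂) (v := 9) (r := 3) (e := .var 3)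
    (u := .read 3 (.var 9) * .read 5 (.var 9)) (N := 2 ^ m)
    (by simp [f2.reg 3 (by decide), h3]) (fun n => σ₂.mem 3 n * σ.mem 5 n) (by
      intro n _ υ hυ hn hv
      simp [hv, hn, hυ.mem 5 (by decide), f2.mem 5 (by decide)])).1
  have f3 := f2.trans (exec_agreeOff multiplyChirp σ₂) (W'' := [7, 8, 9]) (A'' := [3, 4])
    (by decide) (by decide) (by decide) (by decide)
  rw [← multiplyChirp] at e3
  set σ₃ := multiplyChirp.exec σ₂
  have e4 := fft_spec (σ := σ₃) (by rw [f3.reg 3 (by decide), h3])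
    (by rw [f3.reg 4 (by decide), h4]) _ e3
  have f4 := f3.trans (exec_agreeOff fft σ₃) (W'' := [7, 8, 9]) (A'' := [3, 4])
    (by decide) (by decide) (by decide) (by decide)
  set σ₄ := fft.exec σ₃
  have e5 := exec_loop_scatter (σ := σ₄) (v := 9) (r := 6) (e := .var 2)
    (g := .var 9 * .var 0 + .var 10)
    (u := .cconj (chirpExpr (.var 9)) * .read 3 (.var 9) / ((.var 3 : IndexExpr) : NumExpr) /
      .sqrt ((.var 2 : IndexExpr) : NumExpr)) (N := σ.reg 2)
    (by simp [f4.reg 2 (by decide)]) (fun j => j * σ.reg 0 + σ.reg 10)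
    (fun j => conj (chirp (σ.reg 2) j) * σ₄.mem 3 j / (2 ^ m : ℕ) / (√(σ.reg 2 : ℝ) : ℝ))
    (by
      intro a _ b _ hab
      have : a * σ.reg 0 = b * σ.reg 0 := by simpa using hab
      exact Nat.eq_of_mul_eq_mul_right (by omega) this)
    (by
      intro n _ υ hυ _ hv
      simp [eval_chirpExpr, hv, hυ.reg 2 (by decide), f4.reg 2 (by decide), hυ.reg 3 (by decide),
        f4.reg 3 (by decide), h3, hυ.reg 0 (by decide), f4.reg 0 (by decide),
        hυ.reg 10 (by decide), f4.reg 10 (by decide), hυ.mem 3 (by decide)])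
  constructor
  · intro j hj
    rw [storeColumn, e5.1 j hj, e4 j (by omega),
      ← bluestein hm (fun i => σ.mem 0 (i * σ.reg 0 + σ.reg 10)) hj]
    have : ∀ f ∈ Finset.range (2 ^ m), σ₂.mem 3 f * σ.mem 5 f * conj (char (2 ^ m) f j) =
        ((∑ n ∈ Finset.range (2 ^ m), (if n < σ.reg 2 then
          σ.mem 0 (n * σ.reg 0 + σ.reg 10) * conj (chirp (σ.reg 2) n) else 0) *
          conj (char (2 ^ m) n f)) *
        ∑ n ∈ Finset.range (2 ^ m), chirp (σ.reg 2) n * char (2 ^ m) n f) *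
          conj (char (2 ^ m) f j) := by
      intro f hf
      rw [e2 f (Finset.mem_range.mp hf), h5 f (Finset.mem_range.mp hf)]
    rw [Finset.sum_congr rfl this]
    push_cast
    ring
  · intro t ht
    rw [storeColumn, e5.2 t ht, f4.mem 6 (by decide)]

lemma transformColumns_spec {σ : Store} {m : ℕ} (h3 : σ.reg 3 = 2 ^ m) (h4 : σ.reg 4 = m)
    (hm : 2 * σ.reg 2 ≤ 2 ^ m) :
    ∀ j < σ.reg 2, ∀ r < σ.reg 0, (transformColumns.exec σ).mem 6 (j * σ.reg 0 + r) =
      ((1 / √(σ.reg 2 : ℝ) : ℝ) : ℂ) * ∑ i ∈ Finset.range (σ.reg 2),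
        char (σ.reg 2) j i * σ.mem 0 (i * σ.reg 0 + r) := by
  rw [transformColumns, exec_seq]
  have e1 := prepareChirp_spec h3 h4
  have f1 := exec_agreeOff prepareChirp σ
  set σ₁ := prepareChirp.exec σ
  have key := exec_loop_rule (σ := σ₁) (v := 10) (e := .var 0) (p := transformColumn)
    (N := σ.reg 0) (by simp [f1.reg 0 (by decide)])
    (fun n τ => ∀ j < σ.reg 2, ∀ r < n, τ.mem 6 (j * σ.reg 0 + r) =
      ((1 / √(σ.reg 2 : ℝ) : ℝ) : ℂ) * ∑ i ∈ Finset.range (σ.reg 2),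
        char (σ.reg 2) j i * σ.mem 0 (i * σ.reg 0 + r))
    (fun j _ r hr => absurd hr (by omega)) (by
      intro n hn τ hτ hI
      have g := f1.trans (hτ.trans (agreeOff_setReg τ 10 n []) (W'' := [7, 8, 9, 10])
        (A'' := [3, 4, 6]) (by decide) (by decide) (by decide) (by decide))
        (W'' := [7, 8, 9, 10]) (A'' := [3, 4, 5, 6]) (by decide) (by decide) (by decide) (by decide)
      have g5 : (τ.setReg 10 n).mem 5 = σ₁.mem 5 := hτ.mem 5 (by decide)
      have g10 : (τ.setReg 10 n).reg 10 = n := by simp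
      have g6 : (τ.setReg 10 n).mem 6 = τ.mem 6 := rfl
      set υ := τ.setReg 10 n
      have h := transformColumn_spec (σ := υ) (m := m) (by rw [g.reg 3 (by decide), h3])
        (by rw [g.reg 4 (by decide), h4]) (by rw [g.reg 2 (by decide)]; exact hm)
        (by rw [g10, g.reg 0 (by decide)]; exact hn)
        (by rw [g5, g.reg 2 (by decide)]; exact e1)
      rw [g10, g.reg 0 (by decide), g.reg 2 (by decide), g.mem 0 (by decide), g6] at h
      intro j hj r hr
      rcases Nat.lt_succ_iff_lt_or_eq.mp hr with hr' | rfl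
      · rw [h.2, hI j hj r hr']
        intro j' hj' hc
        have h1 : (j' * σ.reg 0 + n) % σ.reg 0 = (j * σ.reg 0 + r) % σ.reg 0 := by rw [hc]
        rw [Nat.mul_add_mod', Nat.mul_add_mod', Nat.mod_eq_of_lt hn,
          Nat.mod_eq_of_lt (by omega)] at h1
        omega
      · exact h.1 j hj)
  exact key

end BlockPR
end

noncomputable section
open scoped ComplexConjugate
open Matrix
namespace BlockPR

/-! ### Solution of the circulant systems -/

/-- A truncated Neumann series for the operator `1 - Q S`, where `S` is the shift by `L`. -/
def neumann {d : ℕ} (U : ZMod d → ℂ) (Q : ℂ) (L : ZMod d) (n : ℕ) (x : ZMod d) : ℂ :=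
  ∑ k ∈ Finset.range n, Q ^ k * U (x + k * L)

lemma neumann_add {d : ℕ} (U : ZMod d → ℂ) (Q : ℂ) (L : ZMod d) (m n : ℕ) (x : ZMod d) :
    neumann U Q L (m + n) x = neumann U Q L m x + Q ^ m * neumann U Q L n (x + m * L) := by
  unfold neumann
  rw [Finset.sum_range_add, Finset.mul_sum]
  congr 1
  refine Finset.sum_congr rfl fun k _ => ?_
  rw [pow_add, mul_assoc]; push_cast; rw [add_mul, add_assoc]

/-- A series with twice as many terms costs one further shift and product; the binary digit b
accounts for an extra initial term. -/
lemma neumann_double {d : ℕ} (U : ZMod d → ℂ) (Q : ℂ) (L : ZMod d) {b : ℕ} (hb : b < 2) (n : ℕ)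
    (x : ZMod d) :
    neumann U Q L (2 * n + b) x = b * U x + Q ^ b * (neumann U Q L n (x + b * L) +
      Q ^ n * neumann U Q L n (x + (b + n) * L)) := by
  rw [show 2 * n + b = b + (n + n) by ring, neumann_add, neumann_add]
  congr 1
  · interval_cases b <;> simp [neumann]
  · congr 4; ring

/-- The partial sums telescope. For n = d the shift n L vanishes in ℤ/d, so the truncated series
yields (1 - Q^d) y without truncation error. -/
lemma neumann_of_eq {d : ℕ} {U y : ZMod d → ℂ} {Q : ℂ} {L : ZMod d}
    (h : ∀ x, U x = y x - Q * y (x + L)) (n : ℕ) (x : ZMod d) :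
    neumann U Q L n x = y x - Q ^ n * y (x + n * L) := by
  induction n with
  | zero => simp [neumann]
  | succ n ih =>
    rw [neumann, Finset.sum_range_succ, ← neumann, ih, h]
    rw [show x + ((n + 1 : ℕ) : ZMod d) * L = x + n * L + L by push_cast; ring]
    ring

/-- The power with exponent `e` of the ratio; the damping parameter is in the array `10`. -/
def ratioPow (e : IndexExpr) : NumExpr :=
  .exp ((0 - 2 * (e : NumExpr)) / .read 10 0)

lemma eval_ratioPow {σ : Store} {δ : ℕ} (h : σ.mem 10 0 = damping δ) (e : IndexExpr) :
    (ratioPow e).eval σ = (ratio δ : ℂ) ^ (e.eval σ) := by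
  simp only [ratioPow, NumExpr.eval_exp, NumExpr.eval_div, NumExpr.eval_sub, NumExpr.eval_mul,
    NumExpr.eval_ofNat, NumExpr.eval_ofIndex, NumExpr.eval_read, IndexExpr.eval_ofNat, h, ratio]
  push_cast
  rw [← Complex.exp_nat_mul]
  congr 1; ring

/-- Sets the registers `11`, `12`, `13` to the absolute offset, the first block and the number of
blocks for the position in the register `10`. -/
def setOffsets : Program :=
  .ite (.indexLe (.var 10 + 1) (.var 1))
    (.setIndex 11 (.var 10) ;; .setIndex 12 0)
    (.setIndex 11 (2 * .var 1 - 1 - .var 10) ;; .setIndex 12 (2 * .var 1 - 2 - .var 10)) ;;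
  .setIndex 13 (.var 1 - .var 11)

/-- The right-hand side of the reduced circulant system. -/
def reduceSystem : Program :=
  .loop 9 (.var 0) (.write 7 (.var 9)
    ((.read 6 (.var 10 * .var 0 + (.var 9 + (.var 0 - .var 12)) % .var 0) -
      ratioPow 1 * .read 6 (.var 10 * .var 0 + (.var 9 + (.var 0 - .var 12) + 1) % .var 0)) /
      .exp ((0 - ((2 + .var 11 : IndexExpr) : NumExpr)) / .read 10 0)))

/-- One doubling step of the Neumann series. -/
def doubleSeries : Program :=
  .setIndex 14 (.var 14 / 2) ;; .setIndex 16 (.var 0 / .var 14 - 2 * .var 15) ;;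
  .loop 9 (.var 0) (.write 9 (.var 9)
    (((.var 16 : IndexExpr) : NumExpr) * .read 7 (.var 9) + ratioPow (.var 13 * .var 16) *
      (.read 8 ((.var 9 + .var 16 * .var 13) % .var 0) + ratioPow (.var 13 * .var 15) *
        .read 8 ((.var 9 + (.var 16 + .var 15) * .var 13) % .var 0)))) ;;
  .loop 9 (.var 0) (.write 8 (.var 9) (.read 9 (.var 9))) ;;
  .setIndex 15 (2 * .var 15 + .var 16)

/-- The Neumann series with `d` terms, in the array `8`. -/
def sumSeries : Program :=
  .loop 9 (.var 0) (.write 8 (.var 9) 0) ;; .setIndex 14 (.var 5) ;; .setIndex 15 0 ;;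
  .loop 8 (.var 6) doubleSeries

/-- Stores the solution of a circulant system into the array `2`. -/
def storeSolution : Program :=
  .loop 9 (.var 0) (.write 2 (.var 10 * .var 0 + .var 9)
    (.read 8 (.var 9) / (1 - ratioPow (.var 13 * .var 0))))

/-- Solves the circulant system for the position in the register `10`. -/
def solveSystem : Program :=
  setOffsets ;; reduceSystem ;; sumSeries ;; storeSolution

/-- Solves all circulant systems. -/
def solveSystems : Program := .loop 10 (.var 2) solveSystem

lemma setOffsets_spec {σ : Store} {δ j : ℕ} (h1 : σ.reg 1 = δ) (h10 : σ.reg 10 = j) :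
    (setOffsets.exec σ).reg 11 = offset δ j ∧ (setOffsets.exec σ).reg 12 = blockShift δ j ∧
      (setOffsets.exec σ).reg 13 = δ - offset δ j := by
  rw [setOffsets, exec_seq, exec_setIndex]
  by_cases h : (Test.indexLe (.var 10 + 1) (.var 1)).Holds σ
  · rw [exec_ite_pos h]
    have h' : j < δ := by simpa [Test.Holds, h1, h10] using h
    simp [exec_seq, exec_setIndex, h10, h1, offset, blockShift, h']
  · rw [exec_ite_neg h]
    have h' : ¬ j < δ := by simpa [Test.Holds, h1, h10] using h
    simp [exec_seq, exec_setIndex, h10, h1, offset, blockShift, h']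

lemma natCast_mod_eq {d : ℕ} (n : ℕ) : ((n % d : ℕ) : ZMod d) = n := ZMod.natCast_mod n d

lemma reduceSystem_spec {σ : Store} {d δ j s : ℕ} (hd : 0 < d) (hs : s ≤ d) (h0 : σ.reg 0 = d)
    (h10 : σ.reg 10 = j) (h11 : σ.reg 11 = offset δ j) (h12 : σ.reg 12 = s)
    (ha : σ.mem 10 0 = damping δ) (W : ZMod d → ℂ)
    (hW : ∀ r < d, σ.mem 6 (j * d + r) = W (r : ZMod d)) :
    ∀ r < d, (reduceSystem.exec σ).mem 7 r =
      (W ((r : ZMod d) - s) - ratio δ * W ((r : ZMod d) - s + 1)) / leading δ j := by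
  refine (exec_loop_fill (σ := σ) (v := 9) (r := 7) (e := .var 0) h0
    (fun r => (W ((r : ZMod d) - s) - ratio δ * W ((r : ZMod d) - s + 1)) / leading δ j) ?_).1
  intro r hr τ hτ _ hv
  have g0 : τ.reg 0 = d := by rw [hτ.reg 0 (by decide), h0]
  have g10 : τ.reg 10 = j := by rw [hτ.reg 10 (by decide), h10]
  have g11 : τ.reg 11 = offset δ j := by rw [hτ.reg 11 (by decide), h11]
  have g12 : τ.reg 12 = s := by rw [hτ.reg 12 (by decide), h12]
  have ga : τ.mem 10 0 = damping δ := by rw [hτ.mem 10 (by decide), ha]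
  have gm : τ.mem 6 = σ.mem 6 := hτ.mem 6 (by decide)
  have hq := eval_ratioPow ga 1
  simp only [IndexExpr.eval_ofNat, pow_one] at hq
  have hc : Complex.exp ((0 - ((2 + offset δ j : ℕ) : ℂ)) / damping δ) = leading δ j := by
    rw [leading]; push_cast; congr 1; ring
  simp only [NumExpr.eval_div, NumExpr.eval_sub, NumExpr.eval_mul, NumExpr.eval_read,
    NumExpr.eval_exp, NumExpr.eval_ofIndex, NumExpr.eval_ofNat, IndexExpr.eval_add,
    IndexExpr.eval_sub, IndexExpr.eval_mul, IndexExpr.eval_mod, IndexExpr.eval_var,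
    IndexExpr.eval_ofNat, hq, g0, g10, g11, g12, ga, gm, hv, Nat.cast_zero]
  rw [hc, hW _ (Nat.mod_lt _ hd), hW _ (Nat.mod_lt _ hd), natCast_mod_eq, natCast_mod_eq]
  -- Indices are natural numbers with truncated subtraction, so going back by s is going forward by
  -- d - s.
  have e : ((r + (d - s) : ℕ) : ZMod d) = (r : ZMod d) - s := by
    rw [Nat.cast_add, Nat.cast_sub hs]; simp [sub_eq_add_neg]
  rw [Nat.cast_add _ 1, e, Nat.cast_one]

/-- One more binary digit of d is read from the top: the number of terms passes from d / 2^(k+1) to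
d / 2^k. A second array is needed since the old series is read at shifted places. -/
lemma doubleSeries_spec {σ : Store} {d δ L n k : ℕ} (hd : 0 < d) (hk : n = d / 2 ^ (k + 1))
    (h0 : σ.reg 0 = d) (h13 : σ.reg 13 = L) (h14 : σ.reg 14 = 2 ^ (k + 1)) (h15 : σ.reg 15 = n)
    (ha : σ.mem 10 0 = damping δ) (U : ZMod d → ℂ)
    (h7 : ∀ r < d, σ.mem 7 r = U (r : ZMod d))
    (h8 : ∀ r < d, σ.mem 8 r = neumann U ((ratio δ : ℂ) ^ L) L n (r : ZMod d)) :
    (doubleSeries.exec σ).reg 14 = 2 ^ k ∧ (doubleSeries.exec σ).reg 15 = d / 2 ^ k ∧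
      ∀ r < d, (doubleSeries.exec σ).mem 8 r =
        neumann U ((ratio δ : ℂ) ^ L) L (d / 2 ^ k) (r : ZMod d) := by
  have hn : n = d / 2 ^ k / 2 := by rw [hk, pow_succ, Nat.div_div_eq_div_mul]
  set b := d / 2 ^ k - 2 * n with hb
  have hb2 : b < 2 := by omega
  have hnb : d / 2 ^ k = 2 * n + b := by omega
  rw [doubleSeries, exec_seq, exec_seq, exec_seq, exec_seq, exec_setIndex, exec_setIndex]
  have e14 : IndexExpr.eval σ (.var 14 / 2) = 2 ^ k := by
    simp [h14, pow_succ]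
  set σ₁ := (σ.setReg 14 (IndexExpr.eval σ (.var 14 / 2))) with hσ₁
  have e16 : IndexExpr.eval σ₁ (.var 0 / .var 14 - 2 * .var 15) = b := by
    simp [hσ₁, h0, h14, h15, hb, pow_succ]
  set σ₂ := σ₁.setReg 16 (IndexExpr.eval σ₁ (.var 0 / .var 14 - 2 * .var 15)) with hσ₂
  have g0 : σ₂.reg 0 = d := by simp [hσ₂, hσ₁, h0]
  have g13 : σ₂.reg 13 = L := by simp [hσ₂, hσ₁, h13]
  have g15 : σ₂.reg 15 = n := by simp [hσ₂, hσ₁, h15]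
  have g16 : σ₂.reg 16 = b := by rw [hσ₂, e16]; simp
  have g14 : σ₂.reg 14 = 2 ^ k := by rw [hσ₂, e16, hσ₁, e14]; simp
  have gm : σ₂.mem = σ.mem := rfl
  have f1 := (exec_loop_fill (σ := σ₂) (v := 9) (r := 9) (e := .var 0)
    (u := ((.var 16 : IndexExpr) : NumExpr) * .read 7 (.var 9) + ratioPow (.var 13 * .var 16) *
      (.read 8 ((.var 9 + .var 16 * .var 13) % .var 0) + ratioPow (.var 13 * .var 15) *
        .read 8 ((.var 9 + (.var 16 + .var 15) * .var 13) % .var 0))) g0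
    (fun r => neumann U ((ratio δ : ℂ) ^ L) L (d / 2 ^ k) (r : ZMod d)) (by
      intro r hr τ hτ _ hv
      have ga : τ.mem 10 0 = damping δ := by rw [hτ.mem 10 (by decide), gm, ha]
      simp only [NumExpr.eval_add, NumExpr.eval_mul, NumExpr.eval_read, NumExpr.eval_ofIndex,
        IndexExpr.eval_add, IndexExpr.eval_mul, IndexExpr.eval_mod, IndexExpr.eval_var,
        eval_ratioPow ga, hτ.reg 0 (by decide), hτ.reg 13 (by decide), hτ.reg 15 (by decide),
        hτ.reg 16 (by decide), hτ.mem 7 (by decide), hτ.mem 8 (by decide), g0, g13, g15, g16, gm,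
        hv]
      rw [h7 r hr, h8 _ (Nat.mod_lt _ hd), h8 _ (Nat.mod_lt _ hd), natCast_mod_eq, natCast_mod_eq,
        hnb, neumann_double U _ _ hb2, ← pow_mul, ← pow_mul]
      push_cast
      rfl)).1
  have a1 := exec_agreeOff (.loop 9 (.var 0) (.write 9 (.var 9)
    (((.var 16 : IndexExpr) : NumExpr) * .read 7 (.var 9) + ratioPow (.var 13 * .var 16) *
      (.read 8 ((.var 9 + .var 16 * .var 13) % .var 0) + ratioPow (.var 13 * .var 15) *
        .read 8 ((.var 9 + (.var 16 + .var 15) * .var 13) % .var 0))))) σ₂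
  set σ₃ := Program.exec (.loop 9 (.var 0) (.write 9 (.var 9)
    (((.var 16 : IndexExpr) : NumExpr) * .read 7 (.var 9) + ratioPow (.var 13 * .var 16) *
      (.read 8 ((.var 9 + .var 16 * .var 13) % .var 0) + ratioPow (.var 13 * .var 15) *
        .read 8 ((.var 9 + (.var 16 + .var 15) * .var 13) % .var 0))))) σ₂
  have f2 := (exec_loop_fill (σ := σ₃) (v := 9) (r := 8) (e := .var 0)
    (u := .read 9 (.var 9)) (N := d) (by simp [a1.reg 0 (by simp [Program.regs]), g0])
    (fun r => σ₃.mem 9 r) (by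
      intro r hr τ hτ _ hv
      simp [hv, hτ.mem 9 (by decide)])).1
  have a2 := exec_agreeOff (.loop 9 (.var 0) (.write 8 (.var 9) (.read 9 (.var 9)))) σ₃
  rw [exec_setIndex]
  refine ⟨?_, ?_, ?_⟩
  · simp only [Store.reg_setReg]
    rw [if_neg (by decide), a2.reg 14 (by decide), a1.reg 14 (by simp [Program.regs]), g14]
  · simp only [Store.reg_setReg, if_true, IndexExpr.eval_add, IndexExpr.eval_mul,
      IndexExpr.eval_ofNat, IndexExpr.eval_var]
    rw [a2.reg 15 (by decide), a1.reg 15 (by simp [Program.regs]), g15,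
      a2.reg 16 (by decide), a1.reg 16 (by simp [Program.regs]), g16, hnb]
  · intro r hr
    rw [Store.mem_setReg, f2 r hr, f1 r hr]

lemma sumSeries_spec {σ : Store} {d δ L m : ℕ} (hm : d < 2 ^ m) (hd : 0 < d) (h0 : σ.reg 0 = d)
    (h5 : σ.reg 5 = 2 ^ m) (h6 : σ.reg 6 = m) (h13 : σ.reg 13 = L) (ha : σ.mem 10 0 = damping δ)
    (U : ZMod d → ℂ) (h7 : ∀ r < d, σ.mem 7 r = U (r : ZMod d)) :
    ∀ r < d, (sumSeries.exec σ).mem 8 r = neumann U ((ratio δ : ℂ) ^ L) L d (r : ZMod d) := by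
  rw [sumSeries, exec_seq, exec_seq, exec_seq, exec_setIndex, exec_setIndex]
  have f1 := (exec_loop_fill (σ := σ) (v := 9) (r := 8) (e := .var 0) (u := 0) h0
    (fun _ => 0) (by intro r hr τ hτ _ hv; simp)).1
  have a1 := exec_agreeOff (.loop 9 (.var 0) (.write 8 (.var 9) 0)) σ
  set σ₁ := Program.exec (.loop 9 (.var 0) (.write 8 (.var 9) 0)) σ
  set σ₂ := Store.setReg σ₁ 14 (IndexExpr.eval σ₁ (.var 5))
  set σ₃ := Store.setReg σ₂ 15 (IndexExpr.eval σ₂ 0) with hσ₃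
  have b1 : AgreeOff [9, 14, 15] [8] σ σ₃ :=
    (a1.trans (agreeOff_setReg σ₁ 14 _ []) (W'' := [9, 14, 15]) (A'' := [8])
      (by decide) (by decide) (by decide) (by decide)).trans (agreeOff_setReg σ₂ 15 _ [])
      (by decide) (by decide) (by decide) (by decide)
  have key := exec_loop_rule (σ := σ₃) (v := 8) (e := .var 6) (p := doubleSeries) (N := m)
    (by simp [b1.reg 6 (by decide), h6])
    (fun i τ => τ.reg 14 = 2 ^ (m - i) ∧ τ.reg 15 = d / 2 ^ (m - i) ∧
      ∀ r < d, τ.mem 8 r = neumann U ((ratio δ : ℂ) ^ L) L (d / 2 ^ (m - i)) (r : ZMod d))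
    (by
      refine ⟨?_, ?_, ?_⟩
      · have : σ₃.reg 14 = σ₁.reg 5 := by simp [hσ₃, σ₂]
        rw [this, a1.reg 5 (by decide), h5, Nat.sub_zero]
      · simp [hσ₃, Nat.div_eq_of_lt hm]
      · intro r hr
        rw [Nat.sub_zero, Nat.div_eq_of_lt hm, hσ₃, Store.mem_setReg, Store.mem_setReg, f1 r hr]
        simp [neumann])
    (by
      intro i hi τ hτ ⟨e14, e15, e8⟩
      have b2 := b1.trans (hτ.trans (agreeOff_setReg τ 8 i []) (W'' := [8, 9, 14, 15, 16])
        (A'' := [8, 9]) (by decide) (by decide) (by decide) (by decide))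
        (W'' := [8, 9, 14, 15, 16]) (A'' := [8, 9]) (by decide) (by decide) (by decide) (by decide)
      have hmi : m - i = m - (i + 1) + 1 := by omega
      rw [hmi] at e14 e15 e8
      refine doubleSeries_spec (σ := τ.setReg 8 i) (k := m - (i + 1)) hd rfl ?_ ?_ ?_ ?_ ?_ U ?_ ?_
      · rw [b2.reg 0 (by decide), h0]
      · rw [b2.reg 13 (by decide), h13]
      · simpa using e14
      · simpa using e15
      · rw [b2.mem 10 (by decide), ha]
      · rw [b2.mem 7 (by decide)]; exact h7
      · simpa using e8)
  have := key.2.2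
  simpa using this

lemma solveSystem_spec {σ : Store} {d δ m : ℕ} [NeZero d] [NeZero δ] (hd : 2 * δ - 1 ≤ d)
    (hm : d < 2 ^ m) (h0 : σ.reg 0 = d) (h1 : σ.reg 1 = δ) (h5 : σ.reg 5 = 2 ^ m)
    (h6 : σ.reg 6 = m) (ha : σ.mem 10 0 = damping δ) (y : ZMod d × Fin (2 * δ - 1) → ℂ)
    (j : Fin (2 * δ - 1)) (h10 : σ.reg 10 = j)
    (hW : ∀ r < d, σ.mem 6 (j * d + r) = windowSum y (r : ZMod d) j) :
    (∀ r < d, (solveSystem.exec σ).mem 2 (j * d + r) = y ((r : ZMod d), j)) ∧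
    ∀ t, (∀ r < d, j * d + r ≠ t) → (solveSystem.exec σ).mem 2 t = σ.mem 2 t := by
  have hd0 : 0 < d := NeZero.pos d
  have hδ0 : 0 < δ := NeZero.pos δ
  have hs : blockShift δ j ≤ d := by unfold blockShift; split_ifs <;> omega
  rw [solveSystem, exec_seq, exec_seq, exec_seq]
  obtain ⟨e11, e12, e13⟩ := setOffsets_spec h1 h10
  have a1 := exec_agreeOff setOffsets σ
  set σ₁ := setOffsets.exec σ
  have f2 := reduceSystem_spec (σ := σ₁) (d := d) (δ := δ) (j := j) hd0 hs
    (by rw [a1.reg 0 (by decide), h0]) (by rw [a1.reg 10 (by decide), h10]) e11 e12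
    (by rw [a1.mem 10 (by decide), ha]) (fun r => windowSum y r j)
    (by rw [a1.mem 6 (by decide)]; exact hW)
  have a2' := exec_agreeOff reduceSystem σ₁
  have a2 := a1.trans a2' (W'' := [9, 11, 12, 13]) (A'' := [7])
    (by decide) (by decide) (by decide) (by decide)
  set σ₂ := reduceSystem.exec σ₁
  set U : ZMod d → ℂ := fun r => (windowSum y (r - (blockShift δ j : ℕ)) j -
    ratio δ * windowSum y (r - (blockShift δ j : ℕ) + 1) j) / leading δ j with hU
  have g13 : σ₂.reg 13 = δ - offset δ j := by rw [a2'.reg 13 (by decide), e13]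
  have f3 := sumSeries_spec (σ := σ₂) hm hd0 (by rw [a2.reg 0 (by decide), h0])
    (by rw [a2.reg 5 (by decide), h5]) (by rw [a2.reg 6 (by decide), h6]) g13
    (by rw [a2.mem 10 (by decide), ha]) U f2
  have a3' := exec_agreeOff sumSeries σ₂
  have a3 := a2.trans a3' (W'' := [8, 9, 11, 12, 13, 14, 15, 16]) (A'' := [7, 8, 9])
    (by decide) (by decide) (by decide) (by decide)
  set σ₃ := sumSeries.exec σ₂
  set Q : ℂ := (ratio δ : ℂ) ^ (δ - offset δ j) with hQ
  have hUy : ∀ x, U x = y (x, j) - Q * y (x + ((δ - offset δ j : ℕ) : ZMod d), j) := by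
    intro x
    have h := windowSum_sub y (x - (blockShift δ j : ℕ)) j
    have hc : (leading δ j : ℂ) ≠ 0 := by exact_mod_cast (leading_pos δ j).ne'
    rw [hU]
    simp only
    rw [h, mul_div_cancel_left₀ _ hc]
    simp [hQ]
  have hQd : (1 - Q ^ d) ≠ 0 := by
    have h1 := ratio_pow_lt_one j.2
    have h2 : (ratio δ ^ (δ - offset δ j)) ^ d < 1 :=
      pow_lt_one₀ (pow_nonneg (ratio_pos δ).le _) h1 hd0.ne'
    have h3 : Q ^ d = (((ratio δ ^ (δ - offset δ j)) ^ d : ℝ) : ℂ) := by rw [hQ]; push_cast; rfl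
    rw [h3]
    have : (1 : ℝ) - (ratio δ ^ (δ - offset δ j)) ^ d ≠ 0 := by linarith
    exact_mod_cast this
  have f4 := exec_loop_scatter (σ := σ₃) (v := 9) (r := 2) (e := .var 0) (N := d)
    (g := .var 10 * .var 0 + .var 9)
    (u := .read 8 (.var 9) / (1 - ratioPow (.var 13 * .var 0)))
    (by simp [a3.reg 0 (by decide), h0]) (fun r => j * d + r) (fun r => y ((r : ZMod d), j))
    (by intro a _ b _ hab; simpa using hab)
    (by
      intro r hr τ hτ _ hv
      have ga : τ.mem 10 0 = damping δ := by rw [hτ.mem 10 (by decide), a3.mem 10 (by decide), ha]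
      have g0 : τ.reg 0 = d := by rw [hτ.reg 0 (by decide), a3.reg 0 (by decide), h0]
      have g13' : τ.reg 13 = δ - offset δ j := by
        rw [hτ.reg 13 (by decide), a3'.reg 13 (by decide), g13]
      refine ⟨by simp [hv, g0, hτ.reg 10 (by decide), a3.reg 10 (by decide), h10], ?_⟩
      simp only [NumExpr.eval_div, NumExpr.eval_sub, NumExpr.eval_read, NumExpr.eval_ofNat,
        eval_ratioPow ga, IndexExpr.eval_mul, IndexExpr.eval_var, g0, g13', hv,
        hτ.mem 8 (by decide)]
      -- The shift by d L is zero, and dividing by 1 - Q^d ≠ 0 leaves y.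
      rw [f3 r hr, neumann_of_eq hUy d, pow_mul, ← hQ]
      simp only [CharP.cast_eq_zero, zero_mul, add_zero, Nat.cast_one]
      field_simp)
  refine ⟨f4.1, fun t ht => ?_⟩
  rw [storeSolution, f4.2 t ht, a3.mem 2 (by decide)]

lemma solveSystems_spec {σ : Store} {d δ m : ℕ} [NeZero d] [NeZero δ] (hd : 2 * δ - 1 ≤ d)
    (hm : d < 2 ^ m) (h0 : σ.reg 0 = d) (h1 : σ.reg 1 = δ) (h2 : σ.reg 2 = 2 * δ - 1)
    (h5 : σ.reg 5 = 2 ^ m) (h6 : σ.reg 6 = m) (ha : σ.mem 10 0 = damping δ)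
    (y : ZMod d × Fin (2 * δ - 1) → ℂ)
    (hW : ∀ j : Fin (2 * δ - 1), ∀ r < d, σ.mem 6 (j * d + r) = windowSum y (r : ZMod d) j) :
    ∀ j : Fin (2 * δ - 1), ∀ r < d,
      (solveSystems.exec σ).mem 2 (j * d + r) = y ((r : ZMod d), j) := by
  have key := exec_loop_rule (σ := σ) (v := 10) (e := .var 2) (p := solveSystem) h2
    (fun n τ => ∀ j : Fin (2 * δ - 1), (j : ℕ) < n → ∀ r < d,
      τ.mem 2 (j * d + r) = y ((r : ZMod d), j))
    (fun j hj => absurd hj (by omega)) (by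
      intro n hn τ hτ hI
      have g := hτ.trans (agreeOff_setReg τ 10 n []) (W'' := [8, 9, 10, 11, 12, 13, 14, 15, 16])
        (A'' := [2, 7, 8, 9]) (by decide) (by decide) (by decide) (by decide)
      have h := solveSystem_spec (σ := τ.setReg 10 n) hd hm (by rw [g.reg 0 (by decide), h0])
        (by rw [g.reg 1 (by decide), h1]) (by rw [g.reg 5 (by decide), h5])
        (by rw [g.reg 6 (by decide), h6]) (by rw [g.mem 10 (by decide), ha]) y ⟨n, hn⟩ (by simp)
        (by rw [g.mem 6 (by decide)]; exact hW ⟨n, hn⟩)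
      intro j hj r hr
      rcases Nat.lt_succ_iff_lt_or_eq.mp hj with hj' | hj'
      · rw [h.2, Store.mem_setReg, hI j hj' r hr]
        intro r' hr' hc
        simp only at hc
        have h1 : (n * d + r') / d = (j * d + r) / d := by rw [hc]
        rw [mul_comm n, mul_comm (j : ℕ), Nat.mul_add_div (NeZero.pos d),
          Nat.mul_add_div (NeZero.pos d), Nat.div_eq_of_lt hr, Nat.div_eq_of_lt hr'] at h1
        omega
      · obtain rfl : j = ⟨n, hn⟩ := Fin.ext hj'
        exact h.1 r hr)
  exact fun j => key j j.2

end BlockPR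
end

noncomputable section
open scoped ComplexConjugate
open Matrix
namespace BlockPR

/-! ### The synchronization program -/

/-- Replaces the reference entry, in the register `17`, by one of the entries that follow it, whose
number is the value of `e`, with the largest estimated magnitude. -/
def chooseNext (e : IndexExpr) : Program :=
  .setIndex 19 0 ;;
  .loop 9 e (.ite (.numLe (.abs (.read 2 ((.var 17 + 1 + .var 19) % .var 0)))
    (.abs (.read 2 ((.var 17 + 1 + .var 9) % .var 0)))) (.setIndex 19 (.var 9)) .skip) ;;
  .setIndex 17 ((.var 17 + 1 + .var 19) % .var 0)

/-- Tests whether some entry after the reference entry has no phase yet. -/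
def findUnset : Program :=
  .setIndex 18 0 ;;
  .loop 9 (.var 1 - 1) (.ite (.numLe 1 (.read 12 ((.var 17 + 1 + .var 9) % .var 0)))
    (.setIndex 18 1) .skip)

/-- Sets the registers `21` and `22` to the positions of the products of the reference entry and
the entry with the number `t` of its window, in both orders. -/
def setPositions : Program :=
  .ite (.indexLe (.var 1) (.var 9 + 1))
    (.setIndex 21 ((.var 9 + 1 - .var 1) * .var 0 + .var 17) ;;
      .setIndex 22 ((2 * .var 1 - 1 - (.var 9 + 1 - .var 1)) * .var 0 +
        (.var 20 + (.var 0 - 1)) % .var 0))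
    (.setIndex 21 ((2 * .var 1 - 1 - (.var 1 - 1 - .var 9)) * .var 0 +
        (.var 17 + (.var 0 - 1)) % .var 0) ;;
      .setIndex 22 ((.var 1 - 1 - .var 9) * .var 0 + .var 20))

/-- Sets the phase of one entry of the window, unless it has been set before. -/
def setEntry : Program :=
  .setIndex 20 ((.var 17 + (.var 0 + 1 - .var 1 + .var 9)) % .var 0) ;;
  .ite (.numLe 1 (.read 12 (.var 20)))
    (setPositions ;;
      .write 11 (.var 20) (.read 11 (.var 17) + 1 / 2 *
        (.arg (.read 2 (.var 21)) - (0 - .arg (.cconj (.read 2 (.var 22)))))) ;;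
      .write 12 (.var 20) 0)
    .skip

/-- Sets the phases of all entries of the window. -/
def setWindow : Program := .loop 9 (.var 2) setEntry

/-- One pass of the synchronization loop. -/
def syncPass : Program :=
  findUnset ;; .ite (.indexLe 1 (.var 18)) (setWindow ;; chooseNext (.var 1 - 1)) .skip

/-- The choice of the first reference entry, and the initial phases and flags. -/
def initSync : Program :=
  .setIndex 17 0 ;; chooseNext (.var 0) ;;
  .loop 9 (.var 0) (.write 11 (.var 9) 0) ;; .loop 9 (.var 0) (.write 12 (.var 9) 1) ;;
  .write 12 (.var 17) 0

/-- Greedy angular synchronization. -/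
def synchronize : Program := initSync ;; .loop 8 (.var 0) syncPass

/-- Assembles the output from the magnitudes and the phases. -/
def assemble : Program :=
  .loop 9 (.var 0) (.write 1 (.var 9)
    (.sqrt (.abs (.read 2 (.var 9))) * .exp (.I * .read 11 (.var 9))))

variable {d δ : ℕ} [NeZero d] [NeZero δ]

/-- The estimated products `y` are stored in the array `2`. -/
structure Stores (y : ZMod d × Fin (2 * δ - 1) → ℂ) (σ : Store) : Prop where
  reg_zero : σ.reg 0 = d
  reg_one : σ.reg 1 = δ
  reg_two : σ.reg 2 = 2 * δ - 1
  mem_two : ∀ (j : Fin (2 * δ - 1)) (p : ZMod d), σ.mem 2 (j * d + p.val) = y (p, j)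

/-- The variables of the synchronization are stored in the register `17` and the arrays `11` and
`12`. -/
structure Represents (s : SyncState d) (σ : Store) : Prop where
  ref : σ.reg 17 = s.ref.val
  phase : ∀ q, σ.mem 11 q.val = (s.phase q : ℂ)
  flag : ∀ q, σ.mem 12 q.val = (s.flag q : ℂ)
  flag_le : ∀ q, s.flag q ≤ 1
  flag_ref : s.flag s.ref = 0

lemma Stores.of_agreeOff {y : ZMod d × Fin (2 * δ - 1) → ℂ} {σ τ : Store} {W A : List ℕ}
    (h : Stores y σ) (hA : AgreeOff W A σ τ) (h0 : 0 ∉ W) (h1 : 1 ∉ W) (h2 : 2 ∉ W)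
    (hm : 2 ∉ A) : Stores y τ :=
  ⟨(hA.reg 0 h0).trans h.reg_zero, (hA.reg 1 h1).trans h.reg_one, (hA.reg 2 h2).trans h.reg_two,
    by rw [hA.mem 2 hm]; exact h.mem_two⟩

lemma Represents.of_agreeOff {s : SyncState d} {σ τ : Store} {W A : List ℕ}
    (h : Represents s σ) (hA : AgreeOff W A σ τ) (h17 : 17 ∉ W) (h11 : 11 ∉ A) (h12 : 12 ∉ A) :
    Represents s τ :=
  ⟨(hA.reg 17 h17).trans h.ref, by rw [hA.mem 11 h11]; exact h.phase,
    by rw [hA.mem 12 h12]; exact h.flag, h.flag_le, h.flag_ref⟩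

lemma val_add_natCast (q : ZMod d) (n : ℕ) : (q + (n : ZMod d)).val = (q.val + n) % d := by
  rw [ZMod.val_add, ZMod.val_natCast, Nat.add_mod_mod]

lemma Stores.mem_productIndex_self (hd : 2 * δ - 1 ≤ d) {y : ZMod d × Fin (2 * δ - 1) → ℂ}
    {σ : Store} (h : Stores y σ) (q : ZMod d) : σ.mem 2 q.val = y (productIndex q q) := by
  have h1 := productIndex_add_nonneg (δ := δ) hd q (j := 0) (NeZero.pos δ)
  rw [Nat.cast_zero, add_zero] at h1
  have hδ := NeZero.pos δ
  rw [h1, ← h.mem_two]; simp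

/-- One search serves twice: over δ - 1 entries for the next reference, and over d entries, that is
the whole cycle, for the initial one. -/
lemma chooseNext_spec (hd : 2 * δ - 1 ≤ d) {y : ZMod d × Fin (2 * δ - 1) → ℂ} {σ : Store}
    (h : Stores y σ) {r : ZMod d} (hr : σ.reg 17 = r.val) {e : IndexExpr} {n : ℕ} (hn : 0 < n)
    (he : e.eval (σ.setReg 19 0) = n) :
    ∃ i < n, ((chooseNext e).exec σ).reg 17 = (r + ((i + 1 : ℕ) : ZMod d)).val ∧ ∀ i' < n,
      ‖y (productIndex (r + ((i' + 1 : ℕ) : ZMod d)) (r + ((i' + 1 : ℕ) : ZMod d)))‖ ≤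
        ‖y (productIndex (r + ((i + 1 : ℕ) : ZMod d)) (r + ((i + 1 : ℕ) : ZMod d)))‖ := by
  have hval : ∀ i : ℕ, (r.val + 1 + i) % d = (r + ((i + 1 : ℕ) : ZMod d)).val := by
    intro i; rw [val_add_natCast, add_assoc, add_comm 1 i]
  rw [chooseNext, exec_seq, exec_seq, exec_setIndex, exec_setIndex, IndexExpr.eval_ofNat]
  set p := Program.ite (.numLe (.abs (.read 2 ((.var 17 + 1 + .var 19) % .var 0)))
    (.abs (.read 2 ((.var 17 + 1 + .var 9) % .var 0)))) (.setIndex 19 (.var 9)) .skip with hp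
  have key := exec_loop_rule (σ := σ.setReg 19 0) (v := 9) (e := e) (p := p) he
    (fun m τ => τ.reg 19 < n ∧ ∀ i' < m,
      ‖y (productIndex (r + ((i' + 1 : ℕ) : ZMod d)) (r + ((i' + 1 : ℕ) : ZMod d)))‖ ≤
        ‖y (productIndex (r + ((τ.reg 19 + 1 : ℕ) : ZMod d))
          (r + ((τ.reg 19 + 1 : ℕ) : ZMod d)))‖)
    ⟨by simpa using hn, fun i' hi' => absurd hi' (by omega)⟩ (by
      intro m hm τ hτ ⟨h1, h2⟩
      have g : AgreeOff [9, 19] [] σ (τ.setReg 9 m) :=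
        ((agreeOff_setReg σ 19 0 []).trans hτ (W'' := [9, 19]) (A'' := [])
          (by decide) (by decide) (by rw [hp]; simp [Program.regs])
          (by rw [hp]; simp [Program.arrs])).trans
          (agreeOff_setReg τ 9 m []) (by decide) (by decide) (by decide) (by decide)
      have hS := h.of_agreeOff g (by decide) (by decide) (by decide) (by decide)
      have g17 : (τ.setReg 9 m).reg 17 = r.val := by rw [g.reg 17 (by decide), hr]
      have g19 : (τ.setReg 9 m).reg 19 = τ.reg 19 := by simp
      have g9 : (τ.setReg 9 m).reg 9 = m := by simp
      set υ := τ.setReg 9 m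
      have hT : (Test.numLe (.abs (.read 2 ((.var 17 + 1 + .var 19) % .var 0)))
          (.abs (.read 2 ((.var 17 + 1 + .var 9) % .var 0)))).Holds υ ↔
          ‖y (productIndex (r + ((τ.reg 19 + 1 : ℕ) : ZMod d))
            (r + ((τ.reg 19 + 1 : ℕ) : ZMod d)))‖ ≤
          ‖y (productIndex (r + ((m + 1 : ℕ) : ZMod d)) (r + ((m + 1 : ℕ) : ZMod d)))‖ := by
        simp only [Test.Holds, NumExpr.eval_abs, NumExpr.eval_read, IndexExpr.eval_mod,
          IndexExpr.eval_add, IndexExpr.eval_var, IndexExpr.eval_ofNat, g17, g19, g9,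
          hS.reg_zero, hval, hS.mem_productIndex_self hd, Complex.ofReal_re]
      by_cases hc : (Test.numLe (.abs (.read 2 ((.var 17 + 1 + .var 19) % .var 0)))
          (.abs (.read 2 ((.var 17 + 1 + .var 9) % .var 0)))).Holds υ
      · rw [hp, exec_ite_pos hc, exec_setIndex]
        rw [hT] at hc
        simp only [IndexExpr.eval_var, Store.reg_setReg, g9, if_true]
        refine ⟨hm, fun i' hi' => ?_⟩
        rcases Nat.lt_succ_iff_lt_or_eq.mp hi' with h3 | rfl
        · exact (h2 i' h3).trans hc
        · exact le_rfl
      · rw [hp, exec_ite_neg hc, exec_skip]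
        rw [hT, not_le] at hc
        rw [g19]
        refine ⟨h1, fun i' hi' => ?_⟩
        rcases Nat.lt_succ_iff_lt_or_eq.mp hi' with h3 | rfl
        · exact h2 i' h3
        · exact hc.le)
  have g := (agreeOff_setReg σ 19 0 []).trans (exec_agreeOff (.loop 9 e p) (σ.setReg 19 0))
    (W'' := [9, 19]) (A'' := []) (by decide) (by decide) (by rw [hp]; simp [Program.regs])
    (by rw [hp]; simp [Program.arrs])
  refine ⟨_, key.1, ?_, key.2⟩
  simp only [Store.reg_setReg, if_true, IndexExpr.eval_mod, IndexExpr.eval_add,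
    IndexExpr.eval_var, IndexExpr.eval_ofNat]
  rw [g.reg 17 (by decide), g.reg 0 (by decide), hr, h.reg_zero, hval]

lemma findUnset_spec {y : ZMod d × Fin (2 * δ - 1) → ℂ} {s : SyncState d} {σ : Store}
    (h : Stores y σ) (hs : Represents s σ) :
    1 ≤ (findUnset.exec σ).reg 18 ↔ s.Unfinished δ := by
  have hval : ∀ i : ℕ, (s.ref.val + 1 + i) % d = (s.ref + ((i + 1 : ℕ) : ZMod d)).val := by
    intro i; rw [val_add_natCast, add_assoc, add_comm 1 i]
  rw [findUnset, exec_seq, exec_setIndex, IndexExpr.eval_ofNat]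
  set t : Test := .numLe 1 (.read 12 ((.var 17 + 1 + .var 9) % .var 0)) with ht
  have key := exec_loop_rule (σ := σ.setReg 18 0) (v := 9) (e := .var 1 - 1)
    (p := .ite t (.setIndex 18 1) .skip) (N := δ - 1) (by simp [h.reg_one])
    (fun m τ => 1 ≤ τ.reg 18 ↔ ∃ i < m, 0 < s.flag (s.ref + ((i + 1 : ℕ) : ZMod d)))
    (by simp) (by
      intro m hm τ hτ hI
      have g : AgreeOff [9, 18] [] σ (τ.setReg 9 m) :=
        ((agreeOff_setReg σ 18 0 []).trans hτ (W'' := [9, 18]) (A'' := [])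
          (by decide) (by decide) (by simp [Program.regs]) (by simp [Program.arrs])).trans
          (agreeOff_setReg τ 9 m []) (by decide) (by decide) (by decide) (by decide)
      have hS := h.of_agreeOff g (by decide) (by decide) (by decide) (by decide)
      have hR := hs.of_agreeOff g (by decide) (by decide) (by decide)
      have hT : t.Holds (τ.setReg 9 m) ↔ 0 < s.flag (s.ref + ((m + 1 : ℕ) : ZMod d)) := by
        have g9 : (τ.setReg 9 m).reg 9 = m := by simp
        rw [ht]
        simp only [Test.Holds, NumExpr.eval_read, IndexExpr.eval_mod, NumExpr.eval_ofNat,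
          IndexExpr.eval_add, IndexExpr.eval_var, IndexExpr.eval_ofNat, g9, hR.ref,
          hS.reg_zero, hval, hR.flag]
        rw [Complex.natCast_re, Complex.natCast_re, Nat.cast_le]
        exact Nat.succ_le_iff
      have hex : (∃ i < m + 1, 0 < s.flag (s.ref + ((i + 1 : ℕ) : ZMod d))) ↔
          (∃ i < m, 0 < s.flag (s.ref + ((i + 1 : ℕ) : ZMod d))) ∨
            0 < s.flag (s.ref + ((m + 1 : ℕ) : ZMod d)) := by
        constructor
        · rintro ⟨i, hi, h'⟩
          rcases Nat.lt_succ_iff_lt_or_eq.mp hi with h3 | rfl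
          · exact Or.inl ⟨i, h3, h'⟩
          · exact Or.inr h'
        · rintro (⟨i, hi, h'⟩ | h')
          · exact ⟨i, by omega, h'⟩
          · exact ⟨m, by omega, h'⟩
      rw [hex]
      by_cases hc : t.Holds (τ.setReg 9 m)
      · rw [exec_ite_pos hc, exec_setIndex]
        exact ⟨fun _ => Or.inr (hT.mp hc), fun _ => by simp⟩
      · rw [exec_ite_neg hc, exec_skip]
        simp only [Store.reg_setReg]
        rw [if_neg (by decide), hI]
        rw [hT] at hc
        exact (or_iff_left hc).symm)
  rw [key]
  constructor
  · rintro ⟨i, hi, h'⟩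
    by_contra hc
    rw [flag_eq_zero_of_not_unfinished hc (Nat.succ_pos i) (by omega)] at h'
    exact lt_irrefl _ h'
  · intro hu
    obtain ⟨i, h0, h1, h2⟩ := exists_flag_of_unfinished hu
    exact ⟨i - 1, by omega, by rwa [Nat.sub_add_cancel h0]⟩

/-- The entry with the number `t` of the window around `r`. -/
def windowEntry (δ : ℕ) (r : ZMod d) (t : ℕ) : ZMod d := r + ((d + 1 - δ + t : ℕ) : ZMod d)

lemma windowEntry_of_le (hd : 2 * δ - 1 ≤ d) (r : ZMod d) {t : ℕ} (ht : δ ≤ t + 1) :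
    windowEntry δ r t = r + ((t + 1 - δ : ℕ) : ZMod d) := by
  have hδ := NeZero.pos δ
  rw [windowEntry, show d + 1 - δ + t = d + (t + 1 - δ) by omega, Nat.cast_add]
  simp

lemma windowEntry_of_lt (hd : 2 * δ - 1 ≤ d) (r : ZMod d) {t : ℕ} (ht : t + 1 < δ) :
    windowEntry δ r t = r - ((δ - 1 - t : ℕ) : ZMod d) := by
  rw [windowEntry, show d + 1 - δ + t = d - (δ - 1 - t) by omega, Nat.cast_sub (by omega)]
  simp [sub_eq_add_neg]

lemma exists_windowEntry_iff (hd : 2 * δ - 1 ≤ d) (r q : ZMod d) :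
    (∃ t < 2 * δ - 1, q = windowEntry δ r t) ↔ |(q - r).valMinAbs| < (δ : ℤ) := by
  constructor
  · rintro ⟨t, ht, rfl⟩
    rcases le_or_gt δ (t + 1) with h | h
    · rw [windowEntry_of_le hd r h]
      exact mem_window hd r (by omega)
    · rw [windowEntry_of_lt hd r h, abs_valMinAbs_sub_comm]
      have := mem_window hd (r - ((δ - 1 - t : ℕ) : ZMod d)) (i := δ - 1 - t) (by omega)
      rwa [sub_add_cancel] at this
  · intro h
    rcases exists_offset r q h with ⟨j, hj, rfl⟩ | ⟨j, hj, hj', rfl⟩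
    · refine ⟨j + δ - 1, by omega, ?_⟩
      rw [windowEntry_of_le hd r (by omega)]
      congr 2; omega
    · refine ⟨δ - 1 - j, by omega, ?_⟩
      rw [windowEntry_of_lt hd r (by omega)]
      congr 2; omega

/-- The reference itself must be excluded: at offset 0 the rule for reversed products would point to
position 2δ-1, outside the block. It is always marked, so the program never asks for it. -/
lemma setPositions_spec (hd : 2 * δ - 1 ≤ d) {y : ZMod d × Fin (2 * δ - 1) → ℂ} {σ : Store}
    (h : Stores y σ) {r : ZMod d} (hr : σ.reg 17 = r.val) {t : ℕ} (h9 : σ.reg 9 = t)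
    (ht : t < 2 * δ - 1) (h20 : σ.reg 20 = (windowEntry δ r t).val) (hne : windowEntry δ r t ≠ r) :
    σ.mem 2 ((setPositions.exec σ).reg 21) = y (productIndex (windowEntry δ r t) r) ∧
      σ.mem 2 ((setPositions.exec σ).reg 22) = y (productIndex r (windowEntry δ r t)) := by
  have hδ := NeZero.pos δ
  have hd0 := NeZero.pos d
  have hpred : ∀ q : ZMod d, (q.val + (d - 1)) % d = (q - 1).val := by
    intro q
    rw [← val_add_natCast, Nat.cast_sub (by omega)]
    simp [sub_eq_add_neg]
  rw [setPositions]
  by_cases hc : (Test.indexLe (.var 1) (.var 9 + 1)).Holds σ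
  · rw [exec_ite_pos hc]
    have hc' : δ ≤ t + 1 := by simpa [Test.Holds, h.reg_one, h9] using hc
    have hq := windowEntry_of_le hd r hc'
    set q := windowEntry δ r t
    have h0 : 0 < t + 1 - δ := by
      rw [Nat.pos_iff_ne_zero]
      intro h0
      rw [h0] at hq
      exact hne (by simpa using hq)
    have hr' : r = q - ((t + 1 - δ : ℕ) : ZMod d) := by rw [hq]; ring
    have e1 := productIndex_add_nonneg hd r (j := t + 1 - δ) (by omega)
    have e2 := productIndex_sub_pos hd q (j := t + 1 - δ) h0 (by omega)
    rw [← hq] at e1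
    rw [← hr'] at e2
    rw [e1, e2]
    simp only [exec_seq, exec_setIndex, IndexExpr.eval_add, IndexExpr.eval_sub,
      IndexExpr.eval_mul, IndexExpr.eval_mod, IndexExpr.eval_var, IndexExpr.eval_ofNat,
      Store.reg_setReg, Nat.reduceEqDiff, if_false, if_true, h9, hr, h20, h.reg_zero, h.reg_one,
      hpred]
    exact ⟨h.mem_two ⟨t + 1 - δ, by omega⟩ _, h.mem_two ⟨2 * δ - 1 - (t + 1 - δ), by omega⟩ _⟩
  · rw [exec_ite_neg hc]
    have hc' : t + 1 < δ := by
      have : ¬ δ ≤ t + 1 := by simpa [Test.Holds, h.reg_one, h9] using hc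
      omega
    have hq := windowEntry_of_lt hd r hc'
    set q := windowEntry δ r t
    have hr' : r = q + ((δ - 1 - t : ℕ) : ZMod d) := by rw [hq]; ring
    have e1 := productIndex_sub_pos hd r (j := δ - 1 - t) (by omega) (by omega)
    have e2 := productIndex_add_nonneg hd q (j := δ - 1 - t) (by omega)
    rw [← hq] at e1
    rw [← hr'] at e2
    rw [e1, e2]
    simp only [exec_seq, exec_setIndex, IndexExpr.eval_add, IndexExpr.eval_sub,
      IndexExpr.eval_mul, IndexExpr.eval_mod, IndexExpr.eval_var, IndexExpr.eval_ofNat,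
      Store.reg_setReg, Nat.reduceEqDiff, if_false, if_true, h9, hr, h20, h.reg_zero, h.reg_one,
      hpred]
    exact ⟨h.mem_two ⟨2 * δ - 1 - (δ - 1 - t), by omega⟩ _, h.mem_two ⟨δ - 1 - t, by omega⟩ _⟩

end BlockPR
end

noncomputable section
open scoped ComplexConjugate
open Matrix
namespace BlockPR
variable {d δ : ℕ} [NeZero d] [NeZero δ]

/-! ### Correctness of the synchronization program -/

/-- The phase that an entry gets from the reference entry. -/
def newPhase (y : ZMod d × Fin (2 * δ - 1) → ℂ) (s : SyncState d) (q : ZMod d) : ℝ :=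
  s.phase s.ref +
    (1 / 2) * (Complex.arg (y (productIndex q s.ref)) - argLower (y (productIndex s.ref q)))

open Classical in
/-- The phase and the flag arrays after the entries in `S` of the window have been treated. -/
structure PartlySet (y : ZMod d × Fin (2 * δ - 1) → ℂ) (s : SyncState d) (S : Set (ZMod d))
    (σ : Store) : Prop where
  phase : ∀ q, σ.mem 11 q.val =
    ((if q ∈ S ∧ s.flag q = 1 then newPhase y s q else s.phase q : ℝ) : ℂ)
  flag : ∀ q, σ.mem 12 q.val = ((if q ∈ S then 0 else s.flag q : ℕ) : ℂ)

lemma PartlySet.of_mem_eq {y : ZMod d × Fin (2 * δ - 1) → ℂ} {s : SyncState d}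
    {S : Set (ZMod d)} {σ τ : Store} (h : PartlySet y s S σ) (h11 : τ.mem 11 = σ.mem 11)
    (h12 : τ.mem 12 = σ.mem 12) : PartlySet y s S τ :=
  ⟨by rw [h11]; exact h.phase, by rw [h12]; exact h.flag⟩

lemma setEntry_spec (hd : 2 * δ - 1 ≤ d) {y : ZMod d × Fin (2 * δ - 1) → ℂ} {σ : Store}
    (h : Stores y σ) {s : SyncState d} (hle : ∀ q, s.flag q ≤ 1) (href : s.flag s.ref = 0)
    (hr : σ.reg 17 = s.ref.val) {t : ℕ} (h9 : σ.reg 9 = t) (ht : t < 2 * δ - 1)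
    {S : Set (ZMod d)} (hS : PartlySet y s S σ) :
    PartlySet y s (insert (windowEntry δ s.ref t) S) (setEntry.exec σ) := by
  classical
  rw [setEntry, exec_seq, exec_setIndex]
  have e20 : IndexExpr.eval σ ((.var 17 + (.var 0 + 1 - .var 1 + .var 9)) % .var 0) =
      (windowEntry δ s.ref t).val := by
    simp [hr, h.reg_zero, h.reg_one, h9, windowEntry, ZMod.val_add, ZMod.val_natCast]
  set q := windowEntry δ s.ref t with hq
  rw [e20]
  set σ₁ := σ.setReg 20 q.val
  have a1 : AgreeOff [20] [] σ σ₁ := agreeOff_setReg σ 20 _ []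
  have hS₁ : PartlySet y s S σ₁ := hS.of_mem_eq rfl rfl
  have hT : (Test.numLe 1 (.read 12 (.var 20))).Holds σ₁ ↔ ¬ (q ∈ S ∨ s.flag q = 0) := by
    have : σ₁.reg 20 = q.val := by simp [σ₁]
    simp only [Test.Holds, NumExpr.eval_ofNat, NumExpr.eval_read, IndexExpr.eval_var, this,
      hS₁.flag]
    rw [Complex.natCast_re, Complex.natCast_re, Nat.cast_le]
    split_ifs with hc
    · simp [hc]
    · simp only [hc, false_or]; omega
  by_cases hc : (Test.numLe 1 (.read 12 (.var 20))).Holds σ₁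
  · rw [exec_ite_pos hc]
    rw [hT, not_or] at hc
    obtain ⟨hqS, hqf⟩ := hc
    have hflag : s.flag q = 1 := by have := hle q; omega
    have hne : q ≠ s.ref := fun hc => hqf (by rw [hc]; exact href)
    obtain ⟨p1, p2⟩ := setPositions_spec hd
      (h.of_agreeOff a1 (by decide) (by decide) (by decide) (by decide))
      (r := s.ref) (by rw [a1.reg 17 (by decide), hr]) (t := t) (by rw [a1.reg 9 (by decide), h9])
      ht (by simp [σ₁, hq]) hne
    rw [exec_seq, exec_seq]
    have a2 := exec_agreeOff setPositions σ₁
    set σ₂ := setPositions.exec σ₁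
    have g20 : σ₂.reg 20 = q.val := by rw [a2.reg 20 (by decide)]; simp [σ₁]
    have g17 : σ₂.reg 17 = s.ref.val := by
      rw [a2.reg 17 (by decide), a1.reg 17 (by decide), hr]
    have hval : NumExpr.eval σ₂ (.read 11 (.var 17) + 1 / 2 *
        (.arg (.read 2 (.var 21)) - (0 - .arg (.cconj (.read 2 (.var 22)))))) =
        (newPhase y s q : ℂ) := by
      simp only [NumExpr.eval_add, NumExpr.eval_mul, NumExpr.eval_div, NumExpr.eval_sub,
        NumExpr.eval_arg, NumExpr.eval_cconj, NumExpr.eval_read, NumExpr.eval_ofNat,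
        IndexExpr.eval_var, g17, a2.mem 2 (by decide), p1, p2, a2.mem 11 (by decide), hS₁.phase]
      -- The phase of the reference is still the old one, since marked entries are not rewritten
      -- during the pass.
      rw [if_neg (by simp [href]), newPhase, argLower]
      push_cast; ring
    rw [exec_write, exec_write, hval]
    simp only [IndexExpr.eval_var, Store.reg_setMem, g20, NumExpr.eval_ofNat]
    constructor
    · intro q'
      rw [Store.mem_setMem, if_neg (by simp), Store.mem_setMem]
      by_cases hq' : q' = q
      · subst hq'; simp [hflag]
      · rw [if_neg (fun hc => hq' (ZMod.val_injective d hc.2)), a2.mem 11 (by decide), hS₁.phase]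
        simp [hq']
    · intro q'
      rw [Store.mem_setMem]
      by_cases hq' : q' = q
      · subst hq'; simp
      · rw [if_neg (fun hc => hq' (ZMod.val_injective d hc.2)), Store.mem_setMem, if_neg (by simp),
          a2.mem 12 (by decide), hS₁.flag]
        simp [hq']
  · rw [exec_ite_neg hc, exec_skip]
    rw [hT, not_not] at hc
    constructor
    · intro q'
      rw [hS₁.phase]
      by_cases hq' : q' = q
      · subst hq'
        rcases hc with hc | hc
        · simp [hc]
        · simp [hc]
      · simp [hq']
    · intro q'
      rw [hS₁.flag]
      by_cases hq' : q' = q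
      · subst hq'
        rcases hc with hc | hc <;> simp [hc]
      · simp [hq']

/-- Treating the entries one by one agrees with the simultaneous update, as new phases depend only
on the reference. The step i is arbitrary because it affects neither phases nor flags; it is chosen
afterwards. -/
lemma setWindow_spec (hd : 2 * δ - 1 ≤ d) {y : ZMod d × Fin (2 * δ - 1) → ℂ} {σ : Store}
    (h : Stores y σ) {s : SyncState d} (hs : Represents s σ) (i : ℕ) :
    (∀ q, (setWindow.exec σ).mem 11 q.val = ((s.advance y i).phase q : ℂ)) ∧
      ∀ q, (setWindow.exec σ).mem 12 q.val = ((s.advance y i).flag q : ℂ) := by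
  classical
  have key := exec_loop_rule (σ := σ) (v := 9) (e := .var 2) (p := setEntry) h.reg_two
    (fun n τ => PartlySet y s {q | ∃ t < n, q = windowEntry δ s.ref t} τ)
    ⟨by simp [hs.phase], by simp [hs.flag]⟩ (by
      intro n hn τ hτ hI
      have g := hτ.trans (agreeOff_setReg τ 9 n []) (W'' := [9, 20, 21, 22])
        (A'' := [11, 12]) (by decide) (by decide) (by decide) (by decide)
      have h1 := setEntry_spec hd (h.of_agreeOff g (by decide) (by decide) (by decide) (by decide))
        hs.flag_le hs.flag_ref (by rw [g.reg 17 (by decide), hs.ref]) (t := n) (by simp) hn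
        (hI.of_mem_eq rfl rfl : PartlySet y s _ (τ.setReg 9 n))
      convert h1 using 1
      ext q
      simp only [Set.mem_ofPred_eq, Set.mem_insert_iff]
      constructor
      · rintro ⟨t, ht, rfl⟩
        rcases Nat.lt_succ_iff_lt_or_eq.mp ht with h3 | rfl
        · exact Or.inr ⟨t, h3, rfl⟩
        · exact Or.inl rfl
      · rintro (rfl | ⟨t, ht, rfl⟩)
        · exact ⟨n, by omega, rfl⟩
        · exact ⟨t, by omega, rfl⟩)
  have hiff := exists_windowEntry_iff (δ := δ) hd s.ref
  constructor
  · intro q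
    rw [setWindow, key.phase]
    simp only [Set.mem_ofPred_eq, hiff, SyncState.advance, newPhase]
  · intro q
    rw [setWindow, key.flag]
    simp only [Set.mem_ofPred_eq, hiff, SyncState.advance]

lemma syncPass_spec (hd : 2 * δ - 1 ≤ d) {y : ZMod d × Fin (2 * δ - 1) → ℂ} {σ : Store}
    (h : Stores y σ) {s : SyncState d} (hs : Represents s σ) :
    (¬ s.Unfinished δ → Represents s (syncPass.exec σ)) ∧
    (s.Unfinished δ → ∃ i, 0 < i ∧ i < δ ∧ (∀ i' : ℕ, 0 < i' → i' < δ →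
      ‖y (productIndex (s.ref + (i' : ZMod d)) (s.ref + (i' : ZMod d)))‖ ≤
        ‖y (productIndex (s.ref + (i : ZMod d)) (s.ref + (i : ZMod d)))‖) ∧
      Represents (s.advance y i) (syncPass.exec σ)) := by
  rw [syncPass, exec_seq]
  have hf := findUnset_spec h hs
  have a1 := exec_agreeOff findUnset σ
  have hs₁ := hs.of_agreeOff a1 (by decide) (by decide) (by decide)
  have h₁ := h.of_agreeOff a1 (by decide) (by decide) (by decide) (by decide)
  set σ₁ := findUnset.exec σ
  have hT : (Test.indexLe 1 (.var 18)).Holds σ₁ ↔ s.Unfinished δ := hf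
  constructor
  · intro hu
    rw [exec_ite_neg (by rwa [hT]), exec_skip]
    exact hs₁
  · intro hu
    rw [exec_ite_pos (by rwa [hT]), exec_seq]
    obtain ⟨i₀, hi₀, hi₀', -⟩ := exists_flag_of_unfinished hu
    have a2 := exec_agreeOff setWindow σ₁
    have h₂ := h₁.of_agreeOff a2 (by decide) (by decide) (by decide) (by decide)
    have hw := setWindow_spec hd h₁ hs₁
    set σ₂ := setWindow.exec σ₁
    obtain ⟨i, hi, e17, hmax⟩ := chooseNext_spec hd h₂ (r := s.ref)
      (by rw [a2.reg 17 (by decide), hs₁.ref]) (e := .var 1 - 1) (n := δ - 1) (by omega)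
      (by simp [h₂.reg_one])
    have a3 := exec_agreeOff (chooseNext (.var 1 - 1)) σ₂
    refine ⟨i + 1, by omega, by omega, ?_, ?_⟩
    · intro i' h0 h1
      have := hmax (i' - 1) (by omega)
      rwa [Nat.sub_add_cancel h0] at this
    · refine ⟨e17, ?_, ?_, ?_, ?_⟩
      · rw [a3.mem 11 (by decide)]; exact (hw (i + 1)).1
      · rw [a3.mem 12 (by decide)]; exact (hw (i + 1)).2
      · intro q; simp only [SyncState.advance]; split_ifs
        · exact zero_le_one
        · exact hs.flag_le q
      · simp only [SyncState.advance]
        exact if_pos (mem_window hd _ (by omega))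

lemma initSync_spec (hd : 2 * δ - 1 ≤ d) {y : ZMod d × Fin (2 * δ - 1) → ℂ} {σ : Store}
    (h : Stores y σ) :
    ∃ a : ZMod d, (∀ j, ‖y (productIndex j j)‖ ≤ ‖y (productIndex a a)‖) ∧
      Represents (SyncState.init a) (initSync.exec σ) := by
  rw [initSync, exec_seq, exec_seq, exec_seq, exec_seq, exec_setIndex, IndexExpr.eval_ofNat]
  have h₁ := h.of_agreeOff (agreeOff_setReg σ 17 0 []) (by decide) (by decide) (by decide)
    (by decide)
  have e17 : (σ.setReg 17 0).reg 17 = (0 : ZMod d).val := by simp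
  set σ₁ := σ.setReg 17 0
  have hd0 := NeZero.pos d
  obtain ⟨i, hi, e, hmax⟩ := chooseNext_spec hd h₁ (r := 0) e17 (e := .var 0) (n := d) hd0
    (by simp [h₁.reg_zero])
  set a : ZMod d := 0 + ((i + 1 : ℕ) : ZMod d) with ha
  refine ⟨a, ?_, ?_⟩
  · intro j
    have := hmax ((j - 1).val) (ZMod.val_lt _)
    rwa [Nat.cast_add, ZMod.natCast_zmod_val, Nat.cast_one, sub_add_cancel, zero_add] at this
  · have a2 := exec_agreeOff (chooseNext (.var 0)) σ₁
    set σ₂ := (chooseNext (.var 0)).exec σ₁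
    have e0 : σ₂.reg 0 = d := by rw [a2.reg 0 (by decide), h₁.reg_zero]
    have f3 := (exec_loop_fill (σ := σ₂) (v := 9) (r := 11) (e := .var 0) (u := 0) e0
      (fun _ => 0) (by intro r hr τ hτ _ hv; simp)).1
    have a3 := exec_agreeOff (.loop 9 (.var 0) (.write 11 (.var 9) 0)) σ₂
    set σ₃ := Program.exec (.loop 9 (.var 0) (.write 11 (.var 9) 0)) σ₂
    have f4 := (exec_loop_fill (σ := σ₃) (v := 9) (r := 12) (e := .var 0) (u := 1) (N := d)
      (by simp [a3.reg 0 (by decide), e0]) (fun _ => 1) (by intro r hr τ hτ _ hv; simp)).1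
    have a4 := exec_agreeOff (.loop 9 (.var 0) (.write 12 (.var 9) 1)) σ₃
    set σ₄ := Program.exec (.loop 9 (.var 0) (.write 12 (.var 9) 1)) σ₃
    have e17' : σ₄.reg 17 = a.val := by
      rw [a4.reg 17 (by decide), a3.reg 17 (by decide), e]
    rw [exec_write]
    refine ⟨?_, ?_, ?_, ?_, ?_⟩
    · rw [Store.reg_setMem, e17']; rfl
    · intro q
      rw [Store.mem_setMem, if_neg (by simp), a4.mem 11 (by decide), f3 _ (ZMod.val_lt q)]
      simp [SyncState.init]
    · intro q
      rw [Store.mem_setMem, IndexExpr.eval_var, e17']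
      by_cases hq : q = a
      · subst hq; simp [SyncState.init]
      · rw [if_neg (fun hc => hq (ZMod.val_injective d hc.2)), f4 _ (ZMod.val_lt q)]
        simp [SyncState.init, hq]
    · intro q; simp only [SyncState.init]; split_ifs <;> simp
    · simp [SyncState.init]

lemma synchronize_spec (hd : 2 * δ - 1 ≤ d) {y : ZMod d × Fin (2 * δ - 1) → ℂ} {σ : Store}
    (h : Stores y σ) :
    ∃ (a : ZMod d) (s : SyncState d), (∀ j, ‖y (productIndex j j)‖ ≤ ‖y (productIndex a a)‖) ∧
      SyncLoop y (SyncState.init a) s ∧ Represents s (synchronize.exec σ) := by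
  rw [synchronize, exec_seq]
  obtain ⟨a, ha, hinit⟩ := initSync_spec hd h
  have h₁ := h.of_agreeOff (exec_agreeOff initSync σ) (by decide) (by decide) (by decide)
    (by decide)
  set σ₁ := initSync.exec σ
  have key := exec_loop_rule (σ := σ₁) (v := 8) (e := .var 0) (p := syncPass) h₁.reg_zero
    -- The history is kept as a continuation: whatever the loop can reach from s it can reach from
    -- the start. The count is claimed only while the loop is unfinished, since later passes change
    -- nothing of the state; after d passes it leaves no unmarked entry.
    (fun n τ => ∃ s : SyncState d, Represents s τ ∧
      (∀ s', SyncLoop y s s' → SyncLoop y (SyncState.init a) s') ∧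
      (s.Unfinished δ → n + ∑ q, s.flag q ≤ d))
    ⟨SyncState.init a, hinit, fun _ h => h, fun _ => by
      calc 0 + ∑ q, (SyncState.init a).flag q ≤ ∑ q : ZMod d, 1 := by
            rw [zero_add]; exact Finset.sum_le_sum fun q _ => hinit.flag_le q
        _ = d := by simp [ZMod.card]⟩ (by
      rintro n hn τ hτ ⟨s, hs, hloop, hcount⟩
      have g := hτ.trans (agreeOff_setReg τ 8 n []) (W'' := [8, 9, 17, 18, 19, 20, 21, 22])
        (A'' := [11, 12]) (by decide) (by decide) (by decide) (by decide)
      have hS := h₁.of_agreeOff g (by decide) (by decide) (by decide) (by decide)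
      have hR := hs.of_agreeOff (agreeOff_setReg τ 8 n []) (by decide) (by decide) (by decide)
      obtain ⟨p1, p2⟩ := syncPass_spec hd hS hR
      by_cases hu : s.Unfinished δ
      · obtain ⟨i, hi, hi', hmax, hR'⟩ := p2 hu
        refine ⟨s.advance y i, hR', fun s' h' => hloop s' (.step s s' i hu hi hi' hmax h'),
          fun _ => ?_⟩
        have := sum_flag_advance_lt hd y hu i
        have := hcount hu
        omega
      · exact ⟨s, p1 hu, hloop, fun hc => absurd hc hu⟩)
  obtain ⟨s, hs, hloop, hcount⟩ := key
  refine ⟨a, s, ha, hloop s (.done s fun hu => ?_), hs⟩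
  obtain ⟨i, -, -, hi⟩ := exists_flag_of_unfinished hu
  have h0 : ∑ q, s.flag q = 0 := by have := hcount hu; omega
  rw [Finset.sum_eq_zero_iff] at h0
  have := h0 (s.ref + (i : ZMod d)) (Finset.mem_univ _)
  omega

lemma assemble_spec (hd : 2 * δ - 1 ≤ d) {y : ZMod d × Fin (2 * δ - 1) → ℂ} {σ : Store}
    (h : Stores y σ) {s : SyncState d} (hs : Represents s σ) (q : ZMod d) :
    (assemble.exec σ).mem 1 q.val =
      (√‖y (productIndex q q)‖ : ℝ) * Complex.exp (Complex.I * (s.phase q : ℂ)) := by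
  have key := (exec_loop_fill (σ := σ) (v := 9) (r := 1) (e := .var 0)
    (u := .sqrt (.abs (.read 2 (.var 9))) * .exp (.I * .read 11 (.var 9))) h.reg_zero
    (fun n => (√‖y (productIndex (n : ZMod d) (n : ZMod d))‖ : ℝ) *
      Complex.exp (Complex.I * (s.phase (n : ZMod d) : ℂ))) (by
      intro n hn τ hτ _ hv
      have hS := h.of_agreeOff hτ (by decide) (by decide) (by decide) (by decide)
      have hR := hs.of_agreeOff hτ (by decide) (by decide) (by decide)
      have hnv : (n : ZMod d).val = n := by rw [ZMod.val_natCast, Nat.mod_eq_of_lt hn]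
      have e1 := hS.mem_productIndex_self hd (n : ZMod d)
      have e2 := hR.phase (n : ZMod d)
      rw [hnv] at e1 e2
      simp only [NumExpr.eval_mul, NumExpr.eval_sqrt, NumExpr.eval_abs, NumExpr.eval_read,
        NumExpr.eval_exp, NumExpr.eval_I, IndexExpr.eval_var, hv, e1, e2, Complex.ofReal_re])).1
  have := key q.val (ZMod.val_lt q)
  rw [assemble, this, ZMod.natCast_zmod_val]

end BlockPR
end

noncomputable section
open scoped ComplexConjugate
open Matrix
namespace BlockPR

/-! ### The recovery program -/

/-- Sets the register `vP` to a power of two that is larger than the value of `e`, and the register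
`vM` to its logarithm. -/
def powerOfTwo (vP vM : ℕ) (e : IndexExpr) : Program :=
  .setIndex vP 1 ;; .setIndex vM 0 ;;
  .loop 8 (.var 0) (.ite (.indexLe (.var vP) e)
    (.setIndex vP (2 * .var vP) ;; .setIndex vM (.var vM + 1)) .skip)

/-- Stores the damping parameter in the array `10`. -/
def storeDamping : Program :=
  .ite (.indexLe (.var 1) 9) (.write 10 0 4)
    (.write 10 0 (((.var 1 - 1 : IndexExpr) : NumExpr) / 2))

/-- Computes the parameters of the recovery program. -/
def setup : Program :=
  .setIndex 2 (2 * .var 1 - 1) ;; powerOfTwo 3 4 (2 * .var 2) ;; powerOfTwo 5 6 (.var 0) ;;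
  storeDamping

/-- The recovery program after the computation of its parameters. -/
def recoverBody : Program :=
  transformColumns ;; solveSystems ;; synchronize ;; assemble

/-- The recovery program. -/
def recover : Program := setup ;; recoverBody

/-- Bounded loops cannot stop early, so the doubling is attempted d times and skipped once the power
exceeds E; E < 2^d makes this enough. The upper bound 2E is needed for the operation count. -/
lemma powerOfTwo_spec {σ : Store} {vP vM : ℕ} {e : IndexExpr} (h1 : vP ≠ vM) (h2 : vP ≠ 8)
    (h3 : vM ≠ 8) (hP : vP ≠ 0) (hM : vM ≠ 0) {E : ℕ} (hE : 1 ≤ E)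
    (he : ∀ τ, AgreeOff [vP, vM, 8] [] σ τ → e.eval τ = E) (hlt : E < 2 ^ σ.reg 0) :
    ∃ m, ((powerOfTwo vP vM e).exec σ).reg vP = 2 ^ m ∧
      ((powerOfTwo vP vM e).exec σ).reg vM = m ∧ E < 2 ^ m ∧ 2 ^ m ≤ 2 * E := by
  rw [powerOfTwo, exec_seq, exec_seq, exec_setIndex, exec_setIndex]
  simp only [IndexExpr.eval_ofNat]
  set σ₁ := (σ.setReg vP 1).setReg vM 0 with hσ₁
  have a1 : AgreeOff [vP, vM, 8] [] σ σ₁ :=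
    (agreeOff_setReg σ vP 1 []).trans (agreeOff_setReg _ vM 0 []) (by simp) (by simp) (by simp)
      (by simp)
  set p := Program.ite (.indexLe (.var vP) e)
    (.setIndex vP (2 * .var vP) ;; .setIndex vM (.var vM + 1)) .skip with hp
  have key := exec_loop_rule (σ := σ₁) (v := 8) (e := .var 0) (p := p) (N := σ.reg 0)
    (by simp [a1.reg 0 (by simp [hP.symm, hM.symm])])
    (fun n τ => ∃ m, τ.reg vP = 2 ^ m ∧ τ.reg vM = m ∧ 2 ^ m ≤ 2 * E ∧ (E < 2 ^ m ∨ m = n))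
    ⟨0, by simp [hσ₁, h1], by simp [hσ₁], by simp; omega, Or.inr rfl⟩ (by
      rintro n hn τ hτ ⟨m, e1, e2, e3, e4⟩
      have a2 : AgreeOff [vP, vM, 8] [] σ (τ.setReg 8 n) :=
        (a1.trans hτ (W'' := [vP, vM, 8]) (A'' := []) (by simp) (by simp)
          (by rw [hp]; simp [Program.regs]) (by rw [hp]; simp [Program.arrs])).trans
          (agreeOff_setReg τ 8 n []) (by simp) (by simp) (by simp) (by simp)
      have hT : (Test.indexLe (.var vP) e).Holds (τ.setReg 8 n) ↔ 2 ^ m ≤ E := by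
        simp [Test.Holds, he _ a2, h2, e1]
      by_cases hc : (Test.indexLe (.var vP) e).Holds (τ.setReg 8 n)
      · rw [hp, exec_ite_pos hc, exec_seq, exec_setIndex, exec_setIndex]
        rw [hT] at hc
        refine ⟨m + 1, ?_, ?_, ?_, ?_⟩
        · simp [h1, h2, e1, pow_succ']
        · simp [h1.symm, h3, e2]
        · rw [pow_succ]; omega
        · rcases e4 with h4 | rfl
          · omega
          · exact Or.inr rfl
      · rw [hp, exec_ite_neg hc, exec_skip]
        rw [hT, not_le] at hc
        exact ⟨m, by simp [h2, e1], by simp [h3, e2], e3, Or.inl hc⟩)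
  obtain ⟨m, e1, e2, e3, e4⟩ := key
  refine ⟨m, e1, e2, ?_, e3⟩
  rcases e4 with h4 | rfl
  · exact h4
  · exact hlt

/-- The parameters of the recovery program have been computed. -/
structure Prepared (d δ : ℕ) (σ : Store) : Prop where
  reg_zero : σ.reg 0 = d
  reg_one : σ.reg 1 = δ
  reg_two : σ.reg 2 = 2 * δ - 1
  length : ∃ m, σ.reg 3 = 2 ^ m ∧ σ.reg 4 = m ∧ 2 * (2 * δ - 1) < 2 ^ m ∧
    2 ^ m ≤ 2 * (2 * (2 * δ - 1))
  steps : ∃ m, σ.reg 5 = 2 ^ m ∧ σ.reg 6 = m ∧ d < 2 ^ m ∧ 2 ^ m ≤ 2 * d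
  damping : σ.mem 10 0 = damping δ

/-- Guarantees that d doublings exceed 2(2δ - 1) ≤ 2d; at d = 2 the strict inequality fails. -/
lemma two_mul_lt_two_pow {d : ℕ} (hd : 2 < d) : 2 * d < 2 ^ d := by
  induction d, hd using Nat.le_induction with
  | base => norm_num
  | succ n hn ih => rw [pow_succ]; omega

lemma damping_of_le {δ : ℕ} (h : δ ≤ 9) : damping δ = 4 := by
  have : (δ : ℝ) ≤ 9 := by exact_mod_cast h
  exact max_eq_left (by linarith)

lemma damping_of_lt {δ : ℕ} (h : 9 < δ) : damping δ = ((δ : ℝ) - 1) / 2 := by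
  have : (9 : ℝ) < δ := by exact_mod_cast h
  exact max_eq_right (by linarith)

lemma setup_spec {σ : Store} {d δ : ℕ} (hd : 2 < d) (hδ : 0 < δ) (hδd : 2 * δ - 1 ≤ d)
    (h0 : σ.reg 0 = d) (h1 : σ.reg 1 = δ) :
    Prepared d δ (setup.exec σ) := by
  have hpow := two_mul_lt_two_pow hd
  rw [setup, exec_seq, exec_seq, exec_seq, exec_setIndex]
  have e2 : IndexExpr.eval σ (2 * .var 1 - 1) = 2 * δ - 1 := by simp [h1]
  rw [e2]
  have a1 := agreeOff_setReg σ 2 (2 * δ - 1) []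
  have e2' : (σ.setReg 2 (2 * δ - 1)).reg 2 = 2 * δ - 1 := by simp
  set σ₁ := σ.setReg 2 (2 * δ - 1)
  have e0 : σ₁.reg 0 = d := by rw [a1.reg 0 (by decide), h0]
  obtain ⟨m, m1, m2, m3, m4⟩ := powerOfTwo_spec (σ := σ₁) (vP := 3) (vM := 4) (e := 2 * .var 2)
    (by decide) (by decide) (by decide) (by decide) (by decide) (E := 2 * (2 * δ - 1)) (by omega)
    (by intro τ hτ; simp [hτ.reg 2 (by decide), e2']) (by rw [e0]; omega)
  have a2' := exec_agreeOff (powerOfTwo 3 4 (2 * .var 2)) σ₁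
  have a2 := a1.trans a2' (W'' := [2, 3, 4, 8]) (A'' := []) (by decide) (by decide) (by decide)
    (by decide)
  set σ₂ := (powerOfTwo 3 4 (2 * .var 2)).exec σ₁
  have e0' : σ₂.reg 0 = d := by rw [a2.reg 0 (by decide), h0]
  obtain ⟨n, n1, n2, n3, n4⟩ := powerOfTwo_spec (σ := σ₂) (vP := 5) (vM := 6) (e := .var 0)
    (by decide) (by decide) (by decide) (by decide) (by decide) (E := d) (by omega)
    (by intro τ hτ; simp [hτ.reg 0 (by decide), e0']) (by rw [e0']; omega)
  have a3' := exec_agreeOff (powerOfTwo 5 6 (.var 0)) σ₂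
  have a3 := a2.trans a3' (W'' := [2, 3, 4, 5, 6, 8]) (A'' := []) (by decide) (by decide)
    (by decide) (by decide)
  set σ₃ := (powerOfTwo 5 6 (.var 0)).exec σ₂
  have a4 := exec_agreeOff storeDamping σ₃
  refine ⟨?_, ?_, ?_, ⟨m, ?_, ?_, m3, m4⟩, ⟨n, ?_, ?_, n3, n4⟩, ?_⟩
  · rw [a4.reg 0 (by decide), a3.reg 0 (by decide), h0]
  · rw [a4.reg 1 (by decide), a3.reg 1 (by decide), h1]
  · rw [a4.reg 2 (by decide), a3'.reg 2 (by decide), a2'.reg 2 (by decide), e2']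
  · rw [a4.reg 3 (by decide), a3'.reg 3 (by decide), m1]
  · rw [a4.reg 4 (by decide), a3'.reg 4 (by decide), m2]
  · rw [a4.reg 5 (by decide), n1]
  · rw [a4.reg 6 (by decide), n2]
  · have g1 : σ₃.reg 1 = δ := by rw [a3.reg 1 (by decide), h1]
    rw [storeDamping]
    by_cases hc : (Test.indexLe (.var 1) 9).Holds σ₃
    · have hc' : δ ≤ 9 := by simpa [Test.Holds, g1] using hc
      rw [exec_ite_pos hc, exec_write, damping_of_le hc']
      simp
    · have hc' : 9 < δ := by simpa [Test.Holds, g1] using hc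
      rw [exec_ite_neg hc, exec_write, damping_of_lt hc']
      simp [g1, Nat.cast_sub hδ]

variable {d δ : ℕ} [NeZero d] [NeZero δ]

lemma inputStore_mem (b : Fin (2 * δ - 1) × ZMod d → ℝ) (i : Fin (2 * δ - 1)) {r : ℕ}
    (hr : r < d) : (inputStore b).mem 0 (i * d + r) = ((b (i, (r : ZMod d)) : ℝ) : ℂ) := by
  have h : (i : ℕ) * d + r < d * (2 * δ - 1) := by
    have := i.2
    calc (i : ℕ) * d + r < i * d + d := by omega
      _ = d * (i + 1) := by ring
      _ ≤ d * (2 * δ - 1) := Nat.mul_le_mul_left _ this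
  have h2 : ((i : ℕ) * d + r) / d = i := by
    rw [mul_comm, Nat.mul_add_div (NeZero.pos d), Nat.div_eq_of_lt hr, add_zero]
  simp only [inputStore, if_true, dif_pos h]
  have e1 : (⟨((i : ℕ) * d + r) / d, Nat.div_lt_of_lt_mul h⟩ : Fin (2 * δ - 1)) = i := Fin.ext h2
  have e2 : (((i : ℕ) * d + r : ℕ) : ZMod d) = r := by push_cast; simp
  rw [e1, e2]

lemma exec_transformColumns_stores (hδd : 2 * δ - 1 ≤ d) (b : Fin (2 * δ - 1) × ZMod d → ℝ)
    {σ : Store} (hp : Prepared d δ σ) (hb : σ.mem 0 = (inputStore b).mem 0) :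
    ∀ j : Fin (2 * δ - 1), ∀ r < d, (transformColumns.exec σ).mem 6 (j * d + r) =
      windowSum (liftedEstimate b) (r : ZMod d) j := by
  obtain ⟨m, m1, m2, m3, m4⟩ := hp.length
  have e1 := transformColumns_spec m1 m2 (by rw [hp.reg_two]; exact m3.le)
  rw [hp.reg_two, hp.reg_zero, hb] at e1
  intro j r hr
  rw [e1 j j.2 r hr, windowSum_eq hδd, ← Fin.sum_univ_eq_sum_range
    (fun i => char (2 * δ - 1) j i * (inputStore b).mem 0 (i * d + r))]
  congr 1
  refine Finset.sum_congr rfl fun i _ => ?_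
  rw [inputStore_mem b i hr, liftedMatrix_mulVec_liftedEstimate hδd]

lemma stores_solveSystems (hδd : 2 * δ - 1 ≤ d) (b : Fin (2 * δ - 1) × ZMod d → ℝ)
    {σ : Store} (hp : Prepared d δ σ) (hb : σ.mem 0 = (inputStore b).mem 0) :
    Stores (liftedEstimate b) (solveSystems.exec (transformColumns.exec σ)) := by
  have hW := exec_transformColumns_stores hδd b hp hb
  obtain ⟨n, n1, n2, n3, n4⟩ := hp.steps
  have a2 := exec_agreeOff transformColumns σ
  generalize transformColumns.exec σ = τ at *
  have e0 : τ.reg 0 = d := by rw [a2.reg 0 (by decide), hp.reg_zero]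
  have e1 : τ.reg 1 = δ := by rw [a2.reg 1 (by decide), hp.reg_one]
  have e2 : τ.reg 2 = 2 * δ - 1 := by rw [a2.reg 2 (by decide), hp.reg_two]
  have h2 := solveSystems_spec (σ := τ) hδd n3 e0 e1 e2
    (by rw [a2.reg 5 (by decide), n1]) (by rw [a2.reg 6 (by decide), n2])
    (by rw [a2.mem 10 (by decide), hp.damping]) (liftedEstimate b) hW
  have a3 := exec_agreeOff solveSystems τ
  refine ⟨?_, ?_, ?_, fun j p => ?_⟩
  · rw [a3.reg 0 (by decide), e0]
  · rw [a3.reg 1 (by decide), e1]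
  · rw [a3.reg 2 (by decide), e2]
  · rw [h2 j p.val (ZMod.val_lt p), ZMod.natCast_zmod_val]

lemma output_apply (p : Program) (b : Fin (2 * δ - 1) × ZMod d → ℝ) (j : ZMod d) :
    p.output b j = (p.exec (inputStore b)).mem 1 j.val := rfl

lemma recover_output (b : Fin (2 * δ - 1) × ZMod d → ℝ) (j : ZMod d) :
    recover.output b j = (assemble.exec (synchronize.exec (solveSystems.exec
      (transformColumns.exec (setup.exec (inputStore b)))))).mem 1 j.val := by
  rw [output_apply, recover, exec_seq, recoverBody, exec_seq, exec_seq, exec_seq]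

theorem isOutput_recover (hd : 2 < d) (hδd : 2 * δ - 1 ≤ d)
    (b : Fin (2 * δ - 1) × ZMod d → ℝ) : IsOutput b (recover.output b) := by
  have hp := setup_spec (σ := inputStore b) hd (NeZero.pos δ) hδd (by simp [inputStore])
    (by simp [inputStore])
  have hS := stores_solveSystems hδd b hp ((exec_agreeOff setup (inputStore b)).mem 0 (by decide))
  have hout := recover_output b
  generalize solveSystems.exec (transformColumns.exec (setup.exec (inputStore b))) = σ at *
  obtain ⟨a, s, ha, hloop, hs⟩ := synchronize_spec hδd hS
  have hS' := hS.of_agreeOff (exec_agreeOff synchronize σ) (by decide) (by decide) (by decide)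
    (by decide)
  exact ⟨a, s, ha, hloop, fun j => (hout j).trans (assemble_spec hδd hS' hs j)⟩

/-! ### Operation counts -/

lemma IndexExpr.cost_sub (e f : IndexExpr) : (e - f).cost = e.cost + f.cost + 1 := rfl
lemma IndexExpr.cost_div (e f : IndexExpr) : (e / f).cost = e.cost + f.cost + 1 := rfl
lemma NumExpr.cost_sub (e f : NumExpr) : (e - f).cost = e.cost + f.cost + 1 := rfl
lemma NumExpr.cost_div (e f : NumExpr) : (e / f).cost = e.cost + f.cost + 1 := rfl

/-- A bound for the number of operations, from bounds `β` for the numbers of iterations. -/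
def Program.costBound (β : IndexExpr → ℕ) : Program → ℕ
  | skip => 1
  | setIndex _ e => e.cost + 1
  | write _ e u => e.cost + u.cost + 1
  | seq p q => p.costBound β + q.costBound β
  | ite t p q => t.cost + p.costBound β + q.costBound β + 1
  | loop _ e p => e.cost + β e * (p.costBound β + 1) + 1

/-- The expressions for the numbers of iterations of the loops in a program. -/
def Program.bounds : Program → List IndexExpr
  | skip => []
  | setIndex _ _ => []
  | write _ _ _ => []
  | seq p q => p.bounds ++ q.bounds
  | ite _ p q => p.bounds ++ q.bounds
  | loop _ e p => e :: p.bounds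

lemma iterate_cost_le {body : ℕ → Store → Store × ℕ} {σ : Store} (I : Store → Prop) (hσ : I σ)
    {c : ℕ} (hI : ∀ n τ, I τ → I (body n τ).1) (hc : ∀ n τ, I τ → (body n τ).2 ≤ c) (N : ℕ) :
    I (iterate body σ N).1 ∧ (iterate body σ N).2 ≤ N * (c + 1) := by
  induction N with
  | zero => exact ⟨hσ, by simp [iterate]⟩
  | succ N ih =>
    refine ⟨hI _ _ ih.1, ?_⟩
    have h1 := hc N _ ih.1
    have h2 := ih.2
    simp only [iterate]
    rw [add_mul, one_mul]
    omega

/-- The bounds β need to hold only for stores that agree with σ on the registers the program never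
assigns. This suffices because the lengths of the loops are read from such registers. -/
lemma run_cost_le {W : List ℕ} {σ : Store} {β : IndexExpr → ℕ} (p : Program) (hW : p.regs ⊆ W)
    (hβ : ∀ e ∈ p.bounds, ∀ τ : Store, (∀ v, v ∉ W → τ.reg v = σ.reg v) → e.eval τ ≤ β e)
    (τ : Store) (hτ : ∀ v, v ∉ W → τ.reg v = σ.reg v) : (p.run τ).2 ≤ p.costBound β := by
  have hexec : ∀ (q : Program), q.regs ⊆ W → ∀ τ : Store, (∀ v, v ∉ W → τ.reg v = σ.reg v) →
      ∀ v, v ∉ W → (q.run τ).1.reg v = σ.reg v := fun q hq τ hτ v hv =>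
    ((exec_agreeOff q τ).reg v fun hc => hv (hq hc)).trans (hτ v hv)
  induction p generalizing τ with
  | skip => exact le_rfl
  | setIndex v e => exact le_rfl
  | write r e u => exact le_rfl
  | seq p q hp hq =>
    simp only [Program.regs, Program.bounds, List.append_subset, List.mem_append] at hW hβ
    have h1 := hp hW.1 (fun e he => hβ e (Or.inl he)) τ hτ
    have h2 := hq hW.2 (fun e he => hβ e (Or.inr he)) _ (hexec p hW.1 τ hτ)
    exact add_le_add h1 h2
  | ite t p q hp hq =>
    simp only [Program.regs, Program.bounds, List.append_subset, List.mem_append] at hW hβ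
    have h1 := hp hW.1 (fun e he => hβ e (Or.inl he)) τ hτ
    have h2 := hq hW.2 (fun e he => hβ e (Or.inr he)) τ hτ
    simp only [Program.run, Program.costBound]
    split_ifs <;> simp only <;> omega
  | loop v e p hp =>
    simp only [Program.regs, Program.bounds, List.cons_subset, List.mem_cons] at hW hβ
    have hset : ∀ n (υ : Store), (∀ w, w ∉ W → υ.reg w = σ.reg w) →
        ∀ w, w ∉ W → (υ.setReg v n).reg w = σ.reg w := by
      intro n υ hυ w hw
      rw [Store.reg_setReg, if_neg (fun hc => hw (by rw [hc]; exact hW.1)), hυ w hw]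
    have h1 := (iterate_cost_le (body := fun n τ => p.run (τ.setReg v n)) (σ := τ)
      (fun υ => ∀ w, w ∉ W → υ.reg w = σ.reg w) hτ
      (fun n υ hυ => hexec p hW.2 _ (hset n υ hυ))
      (fun n υ hυ => hp hW.2 (fun e he => hβ e (Or.inr he)) _ (hset n υ hυ)) (e.eval τ)).2
    have h2 := Nat.mul_le_mul_right (p.costBound β + 1) (hβ e (Or.inl rfl) τ hτ)
    simp only [Program.run, Program.costBound]
    omega

/-- Bounds for the numbers of iterations in the recovery program. -/
def loopBound (d δ l : ℕ) : IndexExpr → ℕ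
  | .var 0 => d
  | .var 2 => 2 * δ
  | .var 3 => 8 * δ
  | .var 4 => l
  | .var 6 => l
  | .sub _ _ => δ
  | _ => 0

end BlockPR
end

noncomputable section
open scoped ComplexConjugate
open Matrix
namespace BlockPR

/-! ### Evaluation of the operation count -/

lemma loopBound_var_zero (d δ l : ℕ) : loopBound d δ l (.var 0) = d := rfl

lemma loopBound_var_two (d δ l : ℕ) : loopBound d δ l (.var 2) = 2 * δ := rfl

lemma loopBound_var_three (d δ l : ℕ) : loopBound d δ l (.var 3) = 8 * δ := rfl

lemma loopBound_var_four (d δ l : ℕ) : loopBound d δ l (.var 4) = l := rfl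

lemma loopBound_var_six (d δ l : ℕ) : loopBound d δ l (.var 6) = l := rfl

lemma loopBound_sub (d δ l : ℕ) (e f : IndexExpr) : loopBound d δ l (e - f) = δ := rfl

lemma costBound_transformColumns {d δ l : ℕ} (hd : 1 ≤ d) (hδ : 1 ≤ δ) (hl : 1 ≤ l) :
    transformColumns.costBound (loopBound d δ l) ≤ 10000 * (δ * d * l) := by
  -- With each parameter written as 1 plus a natural number, both sides are polynomials with
  -- nonnegative coefficients, and the bound can be checked linearly in the monomials.
  obtain ⟨a, rfl⟩ := Nat.exists_eq_add_of_le hd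
  obtain ⟨b, rfl⟩ := Nat.exists_eq_add_of_le hδ
  obtain ⟨c, rfl⟩ := Nat.exists_eq_add_of_le hl
  simp only [transformColumns, prepareChirp, transformColumn, loadColumn, fft, fftStage,
    multiplyChirp, storeColumn, chirpExpr, Program.costBound, loopBound_var_zero, loopBound_var_two,
    loopBound_var_three, loopBound_var_four, IndexExpr.cost, NumExpr.cost, IndexExpr.cost_div,
    NumExpr.cost_div, NumExpr.cost_sub]
  ring_nf
  omega

lemma costBound_solveSystems {d δ l : ℕ} (hd : 1 ≤ d) (hδ : 1 ≤ δ) (hl : 1 ≤ l) :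
    solveSystems.costBound (loopBound d δ l) ≤ 10000 * (δ * d * l) := by
  obtain ⟨a, rfl⟩ := Nat.exists_eq_add_of_le hd
  obtain ⟨b, rfl⟩ := Nat.exists_eq_add_of_le hδ
  obtain ⟨c, rfl⟩ := Nat.exists_eq_add_of_le hl
  simp only [solveSystems, solveSystem, setOffsets, reduceSystem, sumSeries, doubleSeries,
    storeSolution, ratioPow, Program.costBound, Test.cost, loopBound_var_zero, loopBound_var_two,
    loopBound_var_six, IndexExpr.cost, NumExpr.cost, IndexExpr.cost_div, NumExpr.cost_div,
    IndexExpr.cost_sub, NumExpr.cost_sub]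
  ring_nf
  omega

lemma costBound_synchronize {d δ l : ℕ} (hd : 1 ≤ d) (hδ : 1 ≤ δ) (hl : 1 ≤ l) :
    synchronize.costBound (loopBound d δ l) ≤ 10000 * (δ * d * l) := by
  obtain ⟨a, rfl⟩ := Nat.exists_eq_add_of_le hd
  obtain ⟨b, rfl⟩ := Nat.exists_eq_add_of_le hδ
  obtain ⟨c, rfl⟩ := Nat.exists_eq_add_of_le hl
  simp only [synchronize, initSync, syncPass, findUnset, setWindow, setEntry, setPositions,
    chooseNext, Program.costBound, Test.cost, loopBound_var_zero, loopBound_var_two, loopBound_sub,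
    IndexExpr.cost, NumExpr.cost, NumExpr.cost_div, IndexExpr.cost_sub, NumExpr.cost_sub]
  ring_nf
  omega

lemma costBound_assemble {d δ l : ℕ} (hd : 1 ≤ d) (hδ : 1 ≤ δ) (hl : 1 ≤ l) :
    assemble.costBound (loopBound d δ l) ≤ 10000 * (δ * d * l) := by
  obtain ⟨a, rfl⟩ := Nat.exists_eq_add_of_le hd
  obtain ⟨b, rfl⟩ := Nat.exists_eq_add_of_le hδ
  obtain ⟨c, rfl⟩ := Nat.exists_eq_add_of_le hl
  simp only [assemble, Program.costBound, loopBound_var_zero, IndexExpr.cost, NumExpr.cost]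
  ring_nf
  omega

lemma costBound_setup {d δ l : ℕ} (hd : 1 ≤ d) (hδ : 1 ≤ δ) (hl : 1 ≤ l) :
    setup.costBound (loopBound d δ l) ≤ 10000 * (δ * d * l) := by
  obtain ⟨a, rfl⟩ := Nat.exists_eq_add_of_le hd
  obtain ⟨b, rfl⟩ := Nat.exists_eq_add_of_le hδ
  obtain ⟨c, rfl⟩ := Nat.exists_eq_add_of_le hl
  simp only [setup, powerOfTwo, storeDamping, Program.costBound, Test.cost, loopBound_var_zero,
    IndexExpr.cost, NumExpr.cost, NumExpr.cost_div, IndexExpr.cost_sub]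
  ring_nf
  omega

lemma run_setup_cost_le {d δ : ℕ} (l : ℕ) {σ : Store} (h0 : σ.reg 0 = d) :
    (setup.run σ).2 ≤ setup.costBound (loopBound d δ l) := by
  refine run_cost_le (W := [2, 3, 4, 5, 6, 8]) (σ := σ) setup (by decide) ?_ σ fun _ _ => rfl
  intro e he τ hτ
  obtain rfl : e = .var 0 := by
    simpa [setup, powerOfTwo, storeDamping, Program.bounds] using he
  simp [loopBound, hτ 0 (by decide), h0]

/-- Separate from the setup, which assigns the registers that bound the loops here. -/
lemma run_recoverBody_cost_le {d δ l : ℕ} (hδ : 0 < δ) {σ : Store} (hp : Prepared d δ σ)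
    (h4 : σ.reg 4 ≤ l) (h6 : σ.reg 6 ≤ l) :
    (recoverBody.run σ).2 ≤ recoverBody.costBound (loopBound d δ l) := by
  refine run_cost_le (W := [7, 8, 9, 10, 11, 12, 13, 14, 15, 16, 17, 18, 19, 20, 21, 22]) (σ := σ)
    recoverBody (by decide) ?_ σ fun _ _ => rfl
  intro e he τ hτ
  obtain ⟨m, m1, -, -, m4⟩ := hp.length
  have he' : e = .var 0 ∨ e = .var 2 ∨ e = .var 3 ∨ e = .var 4 ∨ e = .var 6 ∨
      e = .var 1 - 1 := by
    simp only [recoverBody, transformColumns, prepareChirp, transformColumn, loadColumn, fft,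
      fftStage, multiplyChirp, storeColumn, solveSystems, solveSystem, setOffsets, reduceSystem,
      sumSeries, doubleSeries, storeSolution, synchronize, initSync, syncPass, findUnset,
      setWindow, setEntry, setPositions, chooseNext, assemble, Program.bounds, List.mem_append,
      List.mem_cons, List.not_mem_nil, or_false, false_or] at he
    tauto
  rcases he' with rfl | rfl | rfl | rfl | rfl | rfl
  · simp [loopBound, hτ 0 (by decide), hp.reg_zero]
  · simp only [loopBound, IndexExpr.eval_var, hτ 2 (by decide), hp.reg_two]; omega
  · simp only [loopBound, IndexExpr.eval_var, hτ 3 (by decide), m1]; omega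
  · simpa [loopBound, hτ 4 (by decide)] using h4
  · simpa [loopBound, hτ 6 (by decide)] using h6
  · simp [loopBound_sub, hτ 1 (by decide), hp.reg_one]

lemma operations_recover_le {d δ : ℕ} [NeZero d] [NeZero δ] (hd : 2 < d) (hδd : 2 * δ - 1 ≤ d)
    (b : Fin (2 * δ - 1) × ZMod d → ℝ) :
    recover.operations b ≤ 50000 * (δ * d * (Nat.log 2 d + 2)) := by
  have hδ := NeZero.pos δ
  have h0 : (inputStore b).reg 0 = d := by simp [inputStore]
  have hp := setup_spec (σ := inputStore b) hd hδ hδd h0 (by simp [inputStore])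
  obtain ⟨m, -, m2, -, m4⟩ := hp.length
  obtain ⟨n, -, n2, -, n4⟩ := hp.steps
  have hlog := Nat.lt_pow_succ_log_self (b := 2) (by norm_num) d
  -- The longer of the two powers of two is at most 4(2δ - 1) ≤ 4d.
  have hle : ∀ k, 2 ^ k ≤ 4 * d → k ≤ Nat.log 2 d + 2 := by
    intro k hk
    have h : 2 ^ k < 2 ^ (Nat.log 2 d + 3) := by
      rw [show Nat.log 2 d + 3 = (Nat.log 2 d).succ + 2 by omega, pow_add]; omega
    have := (Nat.pow_lt_pow_iff_right (by norm_num : 1 < 2)).mp h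
    omega
  have h1 := run_setup_cost_le (δ := δ) (Nat.log 2 d + 2) h0
  have h2 := run_recoverBody_cost_le hδ hp (l := Nat.log 2 d + 2)
    (by rw [m2]; exact hle m (by omega)) (by rw [n2]; exact hle n (by omega))
  have h3 : recover.operations b = (setup.run (inputStore b)).2 +
      (recoverBody.run (setup.exec (inputStore b))).2 := rfl
  have h4 : recoverBody.costBound (loopBound d δ (Nat.log 2 d + 2)) =
      transformColumns.costBound (loopBound d δ (Nat.log 2 d + 2)) +
      (solveSystems.costBound (loopBound d δ (Nat.log 2 d + 2)) +
      (synchronize.costBound (loopBound d δ (Nat.log 2 d + 2)) +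
        assemble.costBound (loopBound d δ (Nat.log 2 d + 2)))) := rfl
  have hd1 : 1 ≤ d := by omega
  have c1 := costBound_setup hd1 hδ (l := Nat.log 2 d + 2) (by omega)
  have c2 := costBound_transformColumns hd1 hδ (l := Nat.log 2 d + 2) (by omega)
  have c3 := costBound_solveSystems hd1 hδ (l := Nat.log 2 d + 2) (by omega)
  have c4 := costBound_synchronize hd1 hδ (l := Nat.log 2 d + 2) (by omega)
  have c5 := costBound_assemble hd1 hδ (l := Nat.log 2 d + 2) (by omega)
  omega

/-- Since d ≥ 3 > e, the constant 2 is at most 2 log d; since log 2 > 1/2, the binary logarithm is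
too. -/
lemma log_two_add_two_le {d : ℕ} (hd : 2 < d) : ((Nat.log 2 d + 2 : ℕ) : ℝ) ≤ 4 * Real.log d := by
  have hd3 : (3 : ℝ) ≤ d := by exact_mod_cast hd
  have h1 : (1 : ℝ) ≤ Real.log d := by
    rw [Real.le_log_iff_exp_le (by linarith)]
    linarith [Real.exp_one_lt_d9]
  have h2 : (Nat.log 2 d : ℝ) * Real.log 2 ≤ Real.log d := by
    rw [← Real.log_pow]
    apply Real.log_le_log (by positivity)
    exact_mod_cast Nat.pow_log_le_self 2 (by omega)
  have h3 := Real.log_two_gt_d9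
  have h4 : (Nat.log 2 d : ℝ) ≤ 2 * Real.log d := by
    have : (0 : ℝ) ≤ Nat.log 2 d := by positivity
    nlinarith
  push_cast
  linarith

end BlockPR
end

theorem mainTheorem2 :
    ∃ (C C' K : ℝ) (p : BlockPR.Program), 0 < C ∧ 0 < C' ∧ 0 < K ∧
      ∀ (d δ : ℕ) [NeZero d] [NeZero δ], 2 < d → 2 * δ - 1 ≤ d →
        IsUnit (BlockPR.liftedMatrix d δ).det ∧
        (∀ (x : EuclideanSpace ℂ (ZMod d))
            (n : EuclideanSpace ℝ (Fin (2 * δ - 1) × ZMod d)),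
          BlockPR.IsFlat ((δ - 3) / 2) x →
          C * ((δ : ℝ) - 1) * (d : ℝ) ^ 2 * ‖n‖ ≤ ‖x‖ ^ 2 →
          ∀ x' : EuclideanSpace ℂ (ZMod d),
            BlockPR.IsOutput (BlockPR.measurements x n) x' →
            ∃ θ ∈ Set.Icc (0 : ℝ) (2 * Real.pi),
              IsMinOn (fun t : ℝ => ‖x - Complex.exp (Complex.I * (t : ℂ)) • x'‖ ^ 2)
                (Set.Icc 0 (2 * Real.pi)) θ ∧
              ‖x - Complex.exp (Complex.I * (θ : ℂ)) • x'‖ ^ 2 ≤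
                C' * (d : ℝ) ^ 2 * ((δ : ℝ) - 1) * ‖n‖) ∧
        (∀ b : Fin (2 * δ - 1) × ZMod d → ℝ,
          BlockPR.IsOutput b (p.output b) ∧
          (p.operations b : ℝ) ≤ K * ((δ : ℝ) * (d : ℝ) * Real.log d)) := by
  -- With ε ≤ 8 exp(3) (δ - 1)‖n‖ the constants are 16 · 8 exp(3) and 900 · 8 exp(3); the last one
  -- is 5 parts times 10000 times 4 from the logarithm.
  refine ⟨128 * Real.exp 3, 7200 * Real.exp 3, 200000, BlockPR.recover, by positivity,
    by positivity, by norm_num, fun d δ _ _ hd hδd => ⟨BlockPR.isUnit_det_liftedMatrix hδd,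
      fun x n hflat hn x' hout => BlockPR.recovery_error hδd x n hflat hn x' hout,
      fun b => ⟨BlockPR.isOutput_recover hd hδd b, ?_⟩⟩⟩
  have h1 : (BlockPR.recover.operations b : ℝ) ≤
      ((50000 * (δ * d * (Nat.log 2 d + 2)) : ℕ) : ℝ) := by
    exact_mod_cast BlockPR.operations_recover_le hd hδd b
  have h2 : (δ : ℝ) * d * ((Nat.log 2 d + 2 : ℕ) : ℝ) ≤ δ * d * (4 * Real.log d) :=
    mul_le_mul_of_nonneg_left (BlockPR.log_two_add_two_le hd) (by positivity)
  rw [Nat.cast_mul, Nat.cast_mul, Nat.cast_mul] at h1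
  norm_num at h1 h2 ⊢
  linarith
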